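/- Let $N=\mathbb Z^d$, $M=\mathrm{Hom}(N,\mathbb Z)$, and let $\Sigma$ be a complete simplicial fan in $N_{\mathbb R}$ whose one-dimensional cones have minimal integral generators $e_1,\dots,e_n$. Let ${\bf P}_\Sigma=(\mathbb C^n\setminus{\bf V}(B(\Sigma)))/G(\Sigma)$ be its toric variety with homogeneous coordinates $x_1,\dots,x_n$; here $B(\Sigma)=\langle\prod_{e_i\notin\sigma}x_i:\sigma\in\Sigma\rangle$ and $G(\Sigma)=\{g\in(\mathbb C^*)^n:\prod_i g_i^{\langle m,e_i\rangle}=1\text{ for all }m\in M\}$. Polynomials in the $x_i$ are graded by the Chow group $A_{d-1}({\bf P}_\Sigma)=\mathbb Z^n/M$, with $\deg x_i=[D_i]$, $D_i=\{x_i=0\}$. Assume that the anticanonical degree $\beta=[\sum_i D_i]$ is semiample, that is, for some $m>0$ the homogeneous polynomials of degree $m\beta$ have no common zero on ${\bf P}_\Sigma$. Let $\Delta^\circ\subset N_{\mathbb R}$ be a reflexive polytope (for instance, if $\Delta=\{m\in M_{\mathbb R}:\langle m,e_i\rangle\ge-1\ \forall i\}$ is reflexive, its dual polytope) such that $e_1,\dots,e_n$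 lie on the boundary of $\Delta^\circ$ and include all lattice points of one of its edges $\Gamma^*$. Let $e_{i_0},e_{i_1},\dots,e_{i_{k+1}}$ be the lattice points of $\Gamma^*$, ordered along the edge. Put $\delta=\frac1{k+1}(e_{i_{k+1}}-e_{i_0})$, let $v_1,\dots,v_k$ be the standard basis of $\mathbb Z^k$, and define the following vectors of $N\oplus\mathbb Z^k$: $$\tilde e_{s_j}=v_j\ (1\le j\le k),\quad \tilde e_{s_{k+1}}=e_{i_0}-v_1-\dots-v_k,\quad \tilde e_{t_{j-1}}=\tilde e_{s_j}+\delta\ (1\le j\le k+1),\quad \tilde e_i=e_i\ (e_i\notin\Gamma^*).$$ Let $\Sigma(\Gamma^*)$ be the collection of the following cones and all their faces, for $\sigma\in\Sigma$, where $\sigma\cap\Gamma^*$ is understood as the set of those generators $e_i$ of $\sigma$ that lie on $\Gamma^*$: (i) $\sigma$, if $\sigma\cap\Gamma^*=\emptyset$; (ii) $\langle e_i\in\sigma\setminus\{e_{i_j}\},\ \tilde e_{t_0},\dots,\tilde e_{t_{j-1}},\tilde e_{s_{j+1}},\dots,\tilde e_{s_{k+1}}\rangle$, if $\sigma\cap\Gamma^*=\{e_{i_j}\}$;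 (iii) $\langle e_i\in\sigma\setminus\{e_{i_j},e_{i_{j+1}}\},\ \tilde e_{t_0},\dots,\tilde e_{t_j},\tilde e_{s_{j+1}},\dots,\tilde e_{s_{k+1}}\rangle$, if $\sigma\cap\Gamma^*=\{e_{i_j},e_{i_{j+1}}\}$. Then $\delta\in N$, and $\Sigma(\Gamma^*)$ is a simplicial fan in $N\oplus\mathbb Z^k$ whose one-dimensional cones span $N_{\mathbb R}\oplus\mathbb R^k$ and have minimal integral generators $\tilde e_{s_1},\dots,\tilde e_{s_{k+1}},\tilde e_{t_0},\dots,\tilde e_{t_k},\tilde e_i$ $(e_i\notin\Gamma^*)$, all distinct. Let $s_j,t_j,y_i$ be the corresponding homogeneous coordinates of its toric variety ${\bf P}_{\Sigma(\Gamma^*)}$. The formulas $$s_j=x_{i_0}x_{i_1}\cdots x_{i_{j-1}}\ (1\le j\le k+1),\qquad t_j=x_{i_{j+1}}\cdots x_{i_{k+1}}\ (0\le j\le k),\qquad y_i=x_i\ (e_i\notin\Gamma^*)$$ give a well-defined morphism $\phi_{\Gamma^*}:{\bf P}_\Sigma\to{\bf P}_{\Sigma(\Gamma^*)}$, which is a closed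 embedding of algebraic varieties. Its image is the quasismooth complete intersection given by $$s_{j+1}t_j=s_jt_{j-1},\qquad j=1,\dots,k,$$ that is: these $k$ equations are homogeneous, the image is their common zero set, every irreducible component of their zero set in the complement of ${\bf V}(B(\Sigma(\Gamma^*)))$ has codimension $k$, and their Jacobian matrix has rank $k$ at every point of that zero set. -/

import Mathlib

namespace ToricEdge

open scoped Matrix

/-! ### Fans in the lattice `N = ℤ^ι`

The dual lattice `M = Hom(N, ℤ)` is identified with `ℤ^ι` through the dot product. -/

section Fans

variable {ι κ : Type*}

/-- A lattice vector `v ∈ N`, seen in `N_ℝ`. -/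
def latVec (v : ι → ℤ) : ι → ℝ := fun c => (v c : ℝ)

/-- A fan: a finite collection of strongly convex rational polyhedral cones, closed under taking
faces, in which any two cones intersect in a face of each. -/
structure IsFan (fan : Set (PointedCone ℝ (ι → ℝ))) : Prop where
  finite : fan.Finite
  rational : ∀ σ ∈ fan, ∃ s : Set (ι → ℤ), s.Finite ∧ PointedCone.hull ℝ (latVec '' s) = σ
  stronglyConvex : ∀ σ ∈ fan, ∀ v, v ∈ σ → -v ∈ σ → v = 0
  face_mem : ∀ σ ∈ fan, ∀ τ : PointedCone ℝ (ι → ℝ), τ.IsFaceOf σ → τ ∈ fan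
  inter_face : ∀ σ ∈ fan, ∀ τ ∈ fan, (σ ⊓ τ).IsFaceOf σ ∧ (σ ⊓ τ).IsFaceOf τ

/-- `v` is a nonzero lattice vector which is not a proper multiple of a lattice vector. -/
def IsPrimitive (v : ι → ℤ) : Prop :=
  ∀ (c : ℤ) (w : ι → ℤ), v = c • w → IsUnit c

/-- The minimal integral generators of the one-dimensional cones of a fan. -/
def rayGenerators (fan : Set (PointedCone ℝ (ι → ℝ))) : Set (ι → ℤ) :=
  {v | IsPrimitive v ∧ PointedCone.hull ℝ {latVec v} ∈ fan}

/-- `fan` is a simplicial fan, its one-dimensional cones span `N_ℝ`, and `e` lists the minimal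
integral generators of its one-dimensional cones without repetition. -/
structure IsSimplicialFan (fan : Set (PointedCone ℝ (ι → ℝ))) (e : κ → ι → ℤ) : Prop where
  isFan : IsFan fan
  simplicial : ∀ σ ∈ fan, σ.IsSimplicial
  injective : Function.Injective e
  range_eq : Set.range e = rayGenerators fan
  span_eq_top : Submodule.span ℝ (Set.range fun i => latVec (e i)) = ⊤

/-- The fan covers `N_ℝ`, i.e. its toric variety is complete. -/
def IsComplete (fan : Set (PointedCone ℝ (ι → ℝ))) : Prop :=
  ∀ v : ι → ℝ, ∃ σ ∈ fan, v ∈ σ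

end Fans

/-! ### Reflexive polytopes -/

section Polytopes

variable {ι : Type*} [Fintype ι]

/-- The convex hull of finitely many lattice points. -/
def IsLatticePolytope (P : Set (ι → ℝ)) : Prop :=
  ∃ s : Set (ι → ℤ), s.Finite ∧ P = convexHull ℝ (latVec '' s)

/-- The dual polytope `{v | ⟨m, v⟩ ≥ -1 for all m ∈ P}`. -/
def polarDual (P : Set (ι → ℝ)) : Set (ι → ℝ) :=
  {v | ∀ m ∈ P, -1 ≤ m ⬝ᵥ v}

/-- A reflexive polytope: the polytope and its dual are lattice polytopes, and the origin is the
only interior lattice point of each. -/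
structure IsReflexive (P : Set (ι → ℝ)) : Prop where
  lattice : IsLatticePolytope P
  interior_eq : {v : ι → ℤ | latVec v ∈ interior P} = {0}
  dual_lattice : IsLatticePolytope (polarDual P)
  dual_interior_eq : {v : ι → ℤ | latVec v ∈ interior (polarDual P)} = {0}

/-- A one-dimensional face of a polytope. -/
def IsEdge (Γ P : Set (ι → ℝ)) : Prop :=
  IsExposed ℝ P Γ ∧ Module.finrank ℝ (vectorSpan ℝ Γ) = 1

/-- The lattice points of the edge `Γ` are exactly `e (a 0), …, e (a (k + 1))`, listed without
repetition in the order in which they lie along the edge. -/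
structure IsEdgeEnumeration {κ : Type*} {k : ℕ} (e : κ → ι → ℤ) (Γ : Set (ι → ℝ))
    (a : Fin (k + 2) → κ) : Prop where
  mem_iff : ∀ v : ι → ℤ, latVec v ∈ Γ ↔ ∃ j, e (a j) = v
  ordered : ∃ m : ι → ℝ, StrictMono fun j => m ⬝ᵥ latVec (e (a j))

end Polytopes

/-! ### Toric varieties as quotients, in homogeneous coordinates

The toric variety of a simplicial fan is the geometric quotient of `ℂ^κ ∖ V(B)` by the group `G`.
Its points are the `G`-orbits, it carries the quotient of the Zariski topology, and its regular
functions are the functions whose pullback to `ℂ^κ ∖ V(B)` is regular. -/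

section Cox

variable {ι κ : Type*} [Fintype ι] [Fintype κ]

open Classical in
/-- The ideal `B` generated by the monomials `∏_{e_i ∉ σ} x_i`, for `σ` in the fan. -/
noncomputable def irrelevantIdeal (fan : Set (PointedCone ℝ (ι → ℝ))) (e : κ → ι → ℤ) :
    Ideal (MvPolynomial κ ℂ) :=
  Ideal.span {p | ∃ σ ∈ fan,
    p = ∏ i ∈ Finset.univ.filter (fun i => latVec (e i) ∉ σ), MvPolynomial.X i}

/-- The Zariski open set `ℂ^κ ∖ V(B)`. -/
def CoxSpace (fan : Set (PointedCone ℝ (ι → ℝ))) (e : κ → ι → ℤ) : Type _ :=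
  {x : κ → ℂ // x ∉ MvPolynomial.zeroLocus ℂ (irrelevantIdeal fan e)}

/-- The Zariski topology on `ℂ^κ`. -/
@[reducible] def zariskiTopology (κ : Type*) : TopologicalSpace (κ → ℂ) :=
  TopologicalSpace.generateFrom
    {D | ∃ p : MvPolynomial κ ℂ, D = {x | MvPolynomial.eval x p ≠ 0}}

instance (fan : Set (PointedCone ℝ (ι → ℝ))) (e : κ → ι → ℤ) :
    TopologicalSpace (CoxSpace fan e) :=
  TopologicalSpace.induced Subtype.val (zariskiTopology κ)

/-- The group `G ⊆ (ℂ^*)^κ` given by the equations `∏_i g_i ^ ⟨m, e_i⟩ = 1`, for `m ∈ M`. -/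
def coxGroup (e : κ → ι → ℤ) : Subgroup (κ → ℂˣ) where
  carrier := {g | ∀ m : ι → ℤ, ∏ i, g i ^ (m ⬝ᵥ e i) = 1}
  mul_mem' := by
    intro g h hg hh m
    simp only [Pi.mul_apply, mul_zpow, Finset.prod_mul_distrib, hg m, hh m, mul_one]
  one_mem' := by
    intro m
    simp
  inv_mem' := by
    intro g hg m
    simp only [Pi.inv_apply, inv_zpow, Finset.prod_inv_distrib, hg m, inv_one]

/-- Two points are equivalent if they lie in the same orbit of `G`, which acts diagonally. -/
def orbitSetoid (fan : Set (PointedCone ℝ (ι → ℝ))) (e : κ → ι → ℤ) :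
    Setoid (CoxSpace fan e) where
  r x y := ∃ g ∈ coxGroup e, ∀ i, y.1 i = (g i : ℂ) * x.1 i
  iseqv :=
    { refl := fun x => ⟨1, one_mem _, fun i => by simp⟩
      symm := by
        rintro x y ⟨g, hg, h⟩
        exact ⟨g⁻¹, inv_mem hg, fun i => by simp [h i]⟩
      trans := by
        rintro x y z ⟨g, hg, h⟩ ⟨g', hg', h'⟩
        exact ⟨g' * g, mul_mem hg' hg, fun i => by simp [h i, h' i, mul_assoc]⟩ }

/-- The toric variety of a simplicial fan whose ray generators are listed by `e`. -/
def ToricVariety (fan : Set (PointedCone ℝ (ι → ℝ))) (e : κ → ι → ℤ) : Type _ :=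
  Quotient (orbitSetoid fan e)

/-- The point of the toric variety with given homogeneous coordinates. -/
def toricPoint {fan : Set (PointedCone ℝ (ι → ℝ))} {e : κ → ι → ℤ} (x : CoxSpace fan e) :
    ToricVariety fan e :=
  Quotient.mk (orbitSetoid fan e) x

instance (fan : Set (PointedCone ℝ (ι → ℝ))) (e : κ → ι → ℤ) :
    TopologicalSpace (ToricVariety fan e) :=
  TopologicalSpace.coinduced toricPoint inferInstance

/-- A function on the toric variety is regular on the open set `V` if, in homogeneous coordinates,
it is locally on the preimage of `V` a quotient of two polynomials. -/
def IsRegularOn {fan : Set (PointedCone ℝ (ι → ℝ))} {e : κ → ι → ℤ}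
    (V : Set (ToricVariety fan e)) (f : ToricVariety fan e → ℂ) : Prop :=
  ∀ x : CoxSpace fan e, toricPoint x ∈ V → ∃ p q : MvPolynomial κ ℂ,
    MvPolynomial.eval x.1 q ≠ 0 ∧
    ∀ y : CoxSpace fan e, toricPoint y ∈ V → MvPolynomial.eval y.1 q ≠ 0 →
      f (toricPoint y) = MvPolynomial.eval y.1 p / MvPolynomial.eval y.1 q

section Morphisms

variable {ι' κ' : Type*} [Fintype ι'] [Fintype κ']
variable {fan : Set (PointedCone ℝ (ι → ℝ))} {e : κ → ι → ℤ}
variable {fan' : Set (PointedCone ℝ (ι' → ℝ))} {e' : κ' → ι' → ℤ}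

/-- A morphism of varieties: a continuous map that pulls regular functions back to regular
functions. -/
structure IsMorphism (φ : ToricVariety fan e → ToricVariety fan' e') : Prop where
  continuous : Continuous φ
  regular_comp : ∀ (V : Set (ToricVariety fan' e')) (f : ToricVariety fan' e' → ℂ),
    IsOpen V → IsRegularOn V f → IsRegularOn (φ ⁻¹' V) (f ∘ φ)

/-- An embedding (closed immersion) of varieties: a morphism that is a homeomorphism onto a closed
subset, such that every regular function on the source is locally the pullback of a regular
function on the target. Equivalently, it is an isomorphism onto a closed subvariety. -/
structure IsClosedImmersion (φ : ToricVariety fan e → ToricVariety fan' e') : Prop where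
  isMorphism : IsMorphism φ
  isClosedEmbedding : Topology.IsClosedEmbedding φ
  locally_surjective : ∀ (V : Set (ToricVariety fan e)) (f : ToricVariety fan e → ℂ),
    IsOpen V → IsRegularOn V f → ∀ x ∈ V,
      ∃ (W : Set (ToricVariety fan' e')) (g : ToricVariety fan' e' → ℂ),
        IsOpen W ∧ φ x ∈ W ∧ IsRegularOn W g ∧ ∀ y ∈ V, φ y ∈ W → f y = g (φ y)

end Morphisms

/-! ### The grading of the homogeneous coordinate ring -/

/-- The Chow group `A_{d-1} = ℤ^κ / M`, where `m ∈ M` is sent to `(⟨m, e_i⟩)_i`. -/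
abbrev ChowGroup (e : κ → ι → ℤ) : Type _ :=
  (κ → ℤ) ⧸ LinearMap.range (Matrix.mulVecLin (Matrix.of e))

open Classical in
/-- `deg x_i = [D_i]`. -/
noncomputable def varDegree (e : κ → ι → ℤ) (i : κ) : ChowGroup e :=
  Submodule.Quotient.mk (Pi.single i 1)

/-- `β = [∑ D_i]`. -/
noncomputable def anticanonicalDegree (e : κ → ι → ℤ) : ChowGroup e :=
  ∑ i, varDegree e i

/-- `β` is semiample: for some `m > 0`, the homogeneous polynomials of degree `m β` (the sections
of the corresponding sheaf) have no common zero on the toric variety. -/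
def IsSemiample (fan : Set (PointedCone ℝ (ι → ℝ))) (e : κ → ι → ℤ) (β : ChowGroup e) : Prop :=
  ∃ m : ℕ, 0 < m ∧ ∀ x : CoxSpace fan e, ∃ p : MvPolynomial κ ℂ,
    MvPolynomial.IsWeightedHomogeneous (varDegree e) p (m • β) ∧ MvPolynomial.eval x.1 p ≠ 0

/-- The closed subset `Z` of the toric variety is the quasismooth complete intersection given by the
equations `f_j = 0`, `j < k`: the `f_j` are homogeneous, `Z` is their common zero set, every
irreducible component of the zero set of the `f_j` in `ℂ^κ ∖ V(B)` has codimension `k`, and the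
Jacobian matrix has rank `k` at all points of this zero set. -/
structure IsQuasismoothCompleteIntersection {fan : Set (PointedCone ℝ (ι → ℝ))} {e : κ → ι → ℤ}
    {k : ℕ} (f : Fin k → MvPolynomial κ ℂ) (Z : Set (ToricVariety fan e)) : Prop where
  homogeneous : ∀ j, ∃ β : ChowGroup e, MvPolynomial.IsWeightedHomogeneous (varDegree e) (f j) β
  mem_iff : ∀ x : CoxSpace fan e, toricPoint x ∈ Z ↔ ∀ j, MvPolynomial.eval x.1 (f j) = 0
  codim : ∀ p ∈ (Ideal.span (Set.range f)).minimalPrimes,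
    (∃ x : CoxSpace fan e, x.1 ∈ MvPolynomial.zeroLocus ℂ p) → p.height = k
  quasismooth : ∀ x : CoxSpace fan e, (∀ j, MvPolynomial.eval x.1 (f j) = 0) →
    (Matrix.of fun j i => MvPolynomial.eval x.1 (MvPolynomial.pderiv i (f j))).rank = k

end Cox

/-! ### The fan `Σ(Γ*)` in `N ⊕ ℤ^k` and the map `φ_{Γ*}` -/

section Edge

variable {ι κ : Type*} {k : ℕ}

/-- The indices `i` with `e_i ∉ Γ`. -/
def OffEdge (e : κ → ι → ℤ) (Γ : Set (ι → ℝ)) : Type _ := {i : κ // latVec (e i) ∉ Γ}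

noncomputable instance [Fintype κ] (e : κ → ι → ℤ) (Γ : Set (ι → ℝ)) :
    Fintype (OffEdge e Γ) :=
  @Fintype.ofFinite _ (inferInstanceAs (Finite {i : κ // latVec (e i) ∉ Γ}))

/-- The labels of the homogeneous coordinates of the new toric variety, see `sVar`, `tVar`,
`yVar`. -/
abbrev EdgeCoord (k : ℕ) (e : κ → ι → ℤ) (Γ : Set (ι → ℝ)) : Type _ :=
  Fin (k + 1) ⊕ Fin (k + 1) ⊕ OffEdge e Γ

variable {e : κ → ι → ℤ} {Γ : Set (ι → ℝ)}

/-- `sVar p` labels the coordinate `s_{p+1}`, for `p = 0, …, k`. -/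
def sVar (p : Fin (k + 1)) : EdgeCoord k e Γ := Sum.inl p

/-- `tVar p` labels the coordinate `t_p`, for `p = 0, …, k`. -/
def tVar (p : Fin (k + 1)) : EdgeCoord k e Γ := Sum.inr (Sum.inl p)

/-- `yVar i` labels the coordinate `y_i`, for `e_i ∉ Γ`. -/
def yVar (i : OffEdge e Γ) : EdgeCoord k e Γ := Sum.inr (Sum.inr i)

/-- The vector `(e_{i_{k+1}} - e_{i_0}) / (k + 1)`. The division of integers is exact when the
`e_{i_j}` are the consecutive lattice points of a segment. -/
def edgeStep (e : κ → ι → ℤ) (a : Fin (k + 2) → κ) : ι → ℤ :=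
  fun c => (e (a (Fin.last (k + 1))) c - e (a 0) c) / ((k : ℤ) + 1)

/-- The vectors of `N ⊕ ℤ^k` for the labels `s_1, …, s_{k+1}`: these are `v_1, …, v_k`, followed by
`e_{i_0} - v_1 - ⋯ - v_k`. -/
def sGen (e : κ → ι → ℤ) (a : Fin (k + 2) → κ) (p : Fin (k + 1)) : ι ⊕ Fin k → ℤ :=
  Fin.lastCases (motive := fun _ => ι ⊕ Fin k → ℤ)
    (Sum.elim (e (a 0)) (fun _ => -1))
    (fun j => Sum.elim 0 (Pi.single j 1)) p

/-- The ray generators of the new fan in `N ⊕ ℤ^k`; the one for `t_{j-1}` is the one for `s_j` plus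
`(e_{i_{k+1}} - e_{i_0}) / (k + 1)`, for `j = 1, …, k + 1`. -/
def edgeGen (e : κ → ι → ℤ) (Γ : Set (ι → ℝ)) (a : Fin (k + 2) → κ) :
    EdgeCoord k e Γ → ι ⊕ Fin k → ℤ
  | Sum.inl p => sGen e a p
  | Sum.inr (Sum.inl p) => sGen e a p + Sum.elim (edgeStep e a) 0
  | Sum.inr (Sum.inr i) => Sum.elim (e i.1) 0

/-- The generators of `σ` that lie on `Γ`, as positions in the list `e_{i_0}, …, e_{i_{k+1}}`. -/
def onEdge (e : κ → ι → ℤ) (a : Fin (k + 2) → κ) (σ : PointedCone ℝ (ι → ℝ)) :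
    Set (Fin (k + 2)) :=
  {l | latVec (e (a l)) ∈ σ}

/-- The labels `y_i` of the generators `e_i` of `σ` that do not lie on `Γ`. -/
def offEdge (k : ℕ) (e : κ → ι → ℤ) (Γ : Set (ι → ℝ)) (σ : PointedCone ℝ (ι → ℝ)) :
    Set (EdgeCoord k e Γ) :=
  {c | ∃ i : OffEdge e Γ, latVec (e i.1) ∈ σ ∧ c = yVar i}

/-- The sets of labels whose vectors generate the cones of types (i), (ii), (iii):
* (i) the generators of `σ`, if `σ ∩ Γ = ∅`;
* (ii) `t_0, …, t_{j-1}, s_{j+1}, …, s_{k+1}` and the generators of `σ` off `Γ`, if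
  `σ ∩ Γ = {e_{i_j}}`;
* (iii) `t_0, …, t_j, s_{j+1}, …, s_{k+1}` and the generators of `σ` off `Γ`, if
  `σ ∩ Γ = {e_{i_j}, e_{i_{j+1}}}`. -/
inductive IsEdgeConeLabels (fan : Set (PointedCone ℝ (ι → ℝ))) (e : κ → ι → ℤ)
    (Γ : Set (ι → ℝ)) (a : Fin (k + 2) → κ) : Set (EdgeCoord k e Γ) → Prop
  | type_i (σ : PointedCone ℝ (ι → ℝ)) (hσ : σ ∈ fan) (h : onEdge e a σ = ∅) :
      IsEdgeConeLabels fan e Γ a (offEdge k e Γ σ)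
  | type_ii (σ : PointedCone ℝ (ι → ℝ)) (hσ : σ ∈ fan) (j : Fin (k + 2))
      (h : onEdge e a σ = {j}) :
      IsEdgeConeLabels fan e Γ a
        (tVar '' {p | p.val < j.val} ∪ sVar '' {p | j.val ≤ p.val} ∪ offEdge k e Γ σ)
  | type_iii (σ : PointedCone ℝ (ι → ℝ)) (hσ : σ ∈ fan) (j : Fin (k + 1))
      (h : onEdge e a σ = {j.castSucc, j.succ}) :
      IsEdgeConeLabels fan e Γ a
        (tVar '' {p | p.val ≤ j.val} ∪ sVar '' {p | j.val ≤ p.val} ∪ offEdge k e Γ σ)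

/-- The collection of the cones of types (i), (ii), (iii) and all of their faces. -/
def edgeFan (fan : Set (PointedCone ℝ (ι → ℝ))) (e : κ → ι → ℤ) (Γ : Set (ι → ℝ))
    (a : Fin (k + 2) → κ) : Set (PointedCone ℝ (ι ⊕ Fin k → ℝ)) :=
  {τ | ∃ L : Set (EdgeCoord k e Γ), IsEdgeConeLabels fan e Γ a L ∧
    τ.IsFaceOf (PointedCone.hull ℝ ((fun c => latVec (edgeGen e Γ a c)) '' L))}

/-- The map in homogeneous coordinates: `s_j = x_{i_0} ⋯ x_{i_{j-1}}` for `j = 1, …, k + 1`,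
`t_j = x_{i_{j+1}} ⋯ x_{i_{k+1}}` for `j = 0, …, k`, and `y_i = x_i` for `e_i ∉ Γ`. -/
def edgeMap (e : κ → ι → ℤ) (Γ : Set (ι → ℝ)) (a : Fin (k + 2) → κ) (x : κ → ℂ) :
    EdgeCoord k e Γ → ℂ
  | Sum.inl p => ∏ l ∈ Finset.univ.filter (fun l : Fin (k + 2) => l.val ≤ p.val), x (a l)
  | Sum.inr (Sum.inl p) => ∏ l ∈ Finset.univ.filter (fun l : Fin (k + 2) => p.val < l.val), x (a l)
  | Sum.inr (Sum.inr i) => x i.1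

/-- The polynomials `s_{j+1} t_j - s_j t_{j-1}`, for `j = 1, …, k`; the argument is `j - 1`. -/
noncomputable def edgeEquation (k : ℕ) (e : κ → ι → ℤ) (Γ : Set (ι → ℝ)) (j : Fin k) :
    MvPolynomial (EdgeCoord k e Γ) ℂ :=
  MvPolynomial.X (sVar j.succ) * MvPolynomial.X (tVar j.succ) -
    MvPolynomial.X (sVar j.castSucc) * MvPolynomial.X (tVar j.castSucc)

end Edge

end ToricEdge

/-!
The edge. Translating a lattice point of a convex segment by a difference of two others stays among
the lattice points as long as it stays in the segment; therefore they are equally spaced, and the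
step is `δ` (`IsEdgeEnumeration.sub_eq_sub`).

The fan. A family of primitive vectors with a family of index sets generates a simplicial fan with
these ray generators as soon as two nonnegative combinations supported on members of the family
agree only if their coefficients do (`UniqueRep`, `UniqueRep.isSimplicialFan`), and every simplicial
fan has this property (`IsSimplicialFan.uniqueRep`). For `Σ(Γ*)` the property is reduced to the one
for `Σ`. The component in `ℤ^k` of a combination with coefficients `α` determines the sums
`α(s_{p+1}) + α(t_p)` up to a common constant, and how the sum for `p` is shared between the two is
governed by a single position `x` on the edge: the share of `t_p` is that part of the interval
`[p, p + 1]` which lies to the left of `x` (`IsEdgeConeLabels.exists_position`). Compare two equal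
combinations, at positions `x` and `x'`, the first with sums larger by `h ≥ 0`. Once the common part
of their components in `N` is cancelled, the first exceeds the second along the edge by
`h (e_{i_0} + x δ) + E (x - x') δ`, where `E ≥ 0` since shares increase with the position. After
`E (e_{i_0} + x' δ)` is added to both sides, `h + E` times the point of the edge at `x` is opposed
to `E` times the point at `x'`. Both sides are now combinations in cones of `Σ`, and uniqueness in
`Σ` gives uniqueness in `Σ(Γ*)` (`IsSimplicialFan.uniqueRep_edgeGen`).

The embedding. At a point of the new Cox space, `s_{p+1} ≠ 0` for all `p` before some place `j`, and
`t_p ≠ 0` for all `p` after it (`IsSplitAt`). So the equations `s_{j+1} t_j = s_j t_{j-1}` say that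
the `s_p` and the `t_p` are the initial and the final partial products of one sequence
(`exists_partial_products`), whose terms are quotients with denominators that do not vanish. Hence
the formulas for `φ` embed the Cox space of `Σ` as the zero set of the equations in that of
`Σ(Γ*)`, with rational local inverses, and the same reasoning on tori identifies the groups `G(Σ)`
and `G(Σ(Γ*))` (`isCoxEmbedding_edgeMap`). Such an embedding descends to a closed immersion of the
quotients (`IsCoxEmbedding.isClosedImmersion_toricMap`): a regular function on the source is locally
a fraction of polynomials, which lifts to a fraction on the target, and the lift becomes invariant
if numerator and denominator are replaced by their parts of one character of the group, because
distinct characters are linearly independent.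

The complete intersection. At a split point a linear relation between the rows of the Jacobian
matrix has coefficients which are constant along the edge and zero at its ends
(`IsSplitAt.rank_jacobian`). The codimension of a component is at most `k` by Krull's height
theorem. It is at least `k` because, on split points, imposing the equations one at a time gives a
strict chain of irreducible loci, each parametrized by rational functions (`IsSplitAt.height_eq`).
-/

namespace ToricEdge

open scoped Matrix

/-! ### Simplicial fans and unique nonnegative representations -/

section UniqueRepresentation

variable {ι κ : Type*}

/-- Vectors labelled by `κ` have unique nonnegative representations along a family `K` of sets of
labels: two nonnegative combinations, each supported on some member of `K`, have the same value
only if they have the same coefficients. For the sets of generators of the cones of a collection,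
this says that the cones are simplicial and meet in common faces. -/
def UniqueRep [Fintype κ] (g : κ → ι → ℤ) (K : Set (Set κ)) : Prop :=
  ∀ L ∈ K, ∀ L' ∈ K, ∀ α β : κ → ℝ, (∀ c, 0 ≤ α c) → (∀ c, 0 ≤ β c) →
    (∀ c, α c ≠ 0 → c ∈ L) → (∀ c, β c ≠ 0 → c ∈ L') →
    ∑ c, α c • latVec (g c) = ∑ c, β c • latVec (g c) → α = β

lemma latVec_injective : Function.Injective (latVec : (ι → ℤ) → ι → ℝ) := fun v w h => by
  funext c
  have := congrFun h c
  simpa [latVec] using this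

lemma latVec_zero : latVec (0 : ι → ℤ) = 0 := by
  funext c; simp [latVec]

lemma IsPrimitive.ne_zero {v : ι → ℤ} (hv : IsPrimitive v) : v ≠ 0 := by
  rintro rfl
  simpa using hv 0 0 (by simp)

lemma IsPrimitive.latVec_ne_zero {v : ι → ℤ} (hv : IsPrimitive v) : latVec v ≠ 0 := fun h =>
  hv.ne_zero (latVec_injective (h.trans latVec_zero.symm))

lemma isPrimitive_of_isUnit {v : ι → ℤ} (c : ι) (h : IsUnit (v c)) : IsPrimitive v := by
  intro b w hw
  rw [hw] at h
  exact isUnit_of_mul_isUnit_left h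

lemma IsPrimitive.sumElim_zero {ι' : Type*} {v : ι → ℤ} (hv : IsPrimitive v) :
    IsPrimitive (Sum.elim v (0 : ι' → ℤ)) := fun c w h =>
  hv c (fun i => w (Sum.inl i)) (funext fun i => congrFun h (Sum.inl i))

/-- Proportional primitive vectors agree up to sign. -/
lemma IsPrimitive.eq_or_eq_neg {v w : ι → ℤ} (hv : IsPrimitive v) (hw : IsPrimitive w) (t : ℝ)
    (h : latVec v = t • latVec w) : v = w ∨ v = -w := by
  obtain ⟨c, hc⟩ := Function.ne_iff.1 hw.ne_zero
  have hi : ∀ i, (v i : ℝ) = t * w i := fun i => congrFun h i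
  have key : ∀ i, v c * w i = w c * v i := fun i => by
    have : (v c : ℝ) * w i = w c * v i := by rw [hi, hi]; ring
    exact_mod_cast this
  obtain ⟨g, p, q, hg, hpq, hp, hq⟩ := Int.exists_gcd_one' (m := v c) (n := w c)
    (Int.gcd_pos_of_ne_zero_right _ hc)
  have key' : ∀ i, p * w i = q * v i := fun i => by
    have := key i
    rw [hp, hq] at this
    have hg' : (g : ℤ) ≠ 0 := by exact_mod_cast hg.ne'
    apply mul_right_cancel₀ hg'
    linarith
  obtain ⟨a, b, hab⟩ := Int.isCoprime_iff_gcd_eq_one.2 hpq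
  have hqu : IsUnit q := hw q (a • v + b • w) (funext fun i => by
    simp only [Pi.smul_apply, Pi.add_apply, smul_eq_mul]
    linear_combination a * key' i - w i * hab)
  have hpu : IsUnit p := hv p (a • v + b • w) (funext fun i => by
    simp only [Pi.smul_apply, Pi.add_apply, smul_eq_mul]
    linear_combination (-b) * key' i - v i * hab)
  rcases Int.isUnit_iff.1 hqu with h1 | h1 <;> rcases Int.isUnit_iff.1 hpu with h2 | h2 <;>
    subst h1 <;> subst h2
  · left; funext i; linarith [key' i]
  · right; funext i; simp only [Pi.neg_apply]; linarith [key' i]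
  · right; funext i; simp only [Pi.neg_apply]; linarith [key' i]
  · left; funext i; linarith [key' i]

lemma IsPrimitive.eq_of_pos {v w : ι → ℤ} (hv : IsPrimitive v) (hw : IsPrimitive w) {t : ℝ}
    (ht : 0 < t) (h : latVec v = t • latVec w) : v = w := by
  rcases hv.eq_or_eq_neg hw t h with h' | h'
  · exact h'
  · exfalso
    apply hw.latVec_ne_zero
    funext i
    have h1 : (v i : ℝ) = t * w i := congrFun h i
    have h2 : (v i : ℝ) = -w i := by rw [h']; simp
    have h3 : (t + 1) * (w i : ℝ) = 0 := by linarith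
    simpa [latVec] using (mul_eq_zero.1 h3).resolve_left (by positivity)

lemma mem_hull_image_iff [Fintype κ] {E : Type*} [AddCommGroup E] [Module ℝ E] {v : κ → E}
    {L : Set κ} {w : E} :
    w ∈ PointedCone.hull ℝ (v '' L) ↔
      ∃ α : κ → ℝ, (∀ c, 0 ≤ α c) ∧ (∀ c, α c ≠ 0 → c ∈ L) ∧ ∑ c, α c • v c = w := by
  classical
  constructor
  · intro hw
    induction hw using Submodule.span_induction with
    | mem x hx =>
      obtain ⟨c, hc, rfl⟩ := hx
      refine ⟨Pi.single c 1, fun i => ?_, fun i hi => ?_, ?_⟩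
      · by_cases h : i = c
        · subst h; simp
        · simp [h]
      · by_cases h : i = c
        · exact h ▸ hc
        · simp [h] at hi
      · simp [Pi.single_apply, ite_smul]
    | zero => exact ⟨0, by simp, by simp, by simp⟩
    | add x y _ _ hx hy =>
      obtain ⟨α, h0, hL, rfl⟩ := hx
      obtain ⟨β, h0', hL', rfl⟩ := hy
      refine ⟨α + β, fun c => add_nonneg (h0 c) (h0' c), fun c hc => ?_, ?_⟩
      · by_cases h : α c = 0
        · exact hL' c (by simpa [h] using hc)
        · exact hL c h
      · simp [add_smul, Finset.sum_add_distrib]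
    | smul r x _ hx =>
      obtain ⟨α, h0, hL, rfl⟩ := hx
      refine ⟨fun c => r.1 * α c, fun c => mul_nonneg r.2 (h0 c), fun c hc => hL c ?_, ?_⟩
      · exact right_ne_zero_of_mul hc
      · rw [Finset.smul_sum]
        exact Finset.sum_congr rfl fun c _ => mul_smul _ _ _
  · rintro ⟨α, h0, hL, rfl⟩
    refine Submodule.sum_mem _ fun c _ => ?_
    by_cases h : α c = 0
    · simp [h]
    · exact PointedCone.smul_mem _ (h0 c) (Submodule.subset_span ⟨c, hL c h, rfl⟩)

lemma mem_hull_singleton_iff {E : Type*} [AddCommGroup E] [Module ℝ E] {v w : E} :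
    w ∈ PointedCone.hull ℝ {v} ↔ ∃ t : ℝ, 0 ≤ t ∧ t • v = w := by
  have : ({v} : Set E) = (fun _ : Unit => v) '' Set.univ := by simp
  rw [this, mem_hull_image_iff]
  constructor
  · rintro ⟨α, h0, -, h⟩
    exact ⟨α (), h0 _, by simpa using h⟩
  · rintro ⟨t, h0, h⟩
    exact ⟨fun _ => t, fun _ => h0, by simp, by simpa using h⟩

/-- A face of a cone generated by finitely many vectors is generated by those of them which it
contains. -/
lemma IsFaceOf.eq_hull [Fintype κ] {E : Type*} [AddCommGroup E] [Module ℝ E] {v : κ → E}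
    {L : Set κ} {τ : PointedCone ℝ E} (h : τ.IsFaceOf (PointedCone.hull ℝ (v '' L))) :
    τ = PointedCone.hull ℝ (v '' {c ∈ L | v c ∈ τ}) := by
  apply le_antisymm
  · intro w hw
    obtain ⟨α, h0, hL, rfl⟩ := mem_hull_image_iff.1 (h.le hw)
    refine mem_hull_image_iff.2 ⟨α, h0, fun c hc => ⟨hL c hc, ?_⟩, rfl⟩
    have hmem : ∀ c, α c • v c ∈ PointedCone.hull ℝ (v '' L) := fun c => by
      by_cases hc : α c = 0
      · simp [hc]
      · exact PointedCone.smul_mem _ (h0 c) (Submodule.subset_span ⟨c, hL c hc, rfl⟩)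
    have := h.mem_of_sum_mem hmem hw c
    exact (PointedCone.smul_mem_iff _ (lt_of_le_of_ne (h0 c) (Ne.symm hc))).1 this
  · refine Submodule.span_le.2 ?_
    rintro _ ⟨c, hc, rfl⟩
    exact hc.2

variable [Fintype κ] {g : κ → ι → ℤ} {K : Set (Set κ)}

lemma UniqueRep.isFaceOf (hK : UniqueRep g K) {L L' : Set κ} (hL : L ∈ K) (hL' : L' ⊆ L) :
    (PointedCone.hull ℝ ((fun c => latVec (g c)) '' L')).IsFaceOf
      (PointedCone.hull ℝ ((fun c => latVec (g c)) '' L)) := by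
  refine ⟨Submodule.span_mono (Set.image_mono hL'), ?_⟩
  intro x y a hx hy ha hxy
  obtain ⟨α, hα, hαL, rfl⟩ := mem_hull_image_iff.1 hx
  obtain ⟨β, hβ, hβL, rfl⟩ := mem_hull_image_iff.1 hy
  obtain ⟨γ, hγ, hγL, hs⟩ := mem_hull_image_iff.1 hxy
  have h0 : ∀ c, 0 ≤ a * α c := fun c => mul_nonneg ha.le (hα c)
  have heq : (fun c => a * α c + β c) = γ := by
    refine hK L hL L hL _ _ (fun c => add_nonneg (h0 c) (hβ c)) hγ (fun c hc => ?_)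
      (fun c hc => hL' (hγL c hc)) ?_
    · by_cases h : β c = 0
      · exact hαL c fun h' => hc (by simp [h, h'])
      · exact hβL c h
    · rw [hs, Finset.smul_sum, ← Finset.sum_add_distrib]
      exact Finset.sum_congr rfl fun c _ => by rw [add_smul, mul_smul]
  refine mem_hull_image_iff.2 ⟨α, hα, fun c hc => hγL c ?_, rfl⟩
  have h1 : 0 < a * α c := mul_pos ha (lt_of_le_of_ne (hα c) (Ne.symm hc))
  have h2 : a * α c + β c = γ c := congrFun heq c
  have h3 := hβ c
  exact (by linarith : 0 < γ c).ne'

lemma UniqueRep.inf_eq (hK : UniqueRep g K) {L₁ L₂ M₁ M₂ : Set κ} (h₁ : M₁ ∈ K) (h₂ : M₂ ∈ K)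
    (hL₁ : L₁ ⊆ M₁) (hL₂ : L₂ ⊆ M₂) :
    PointedCone.hull ℝ ((fun c => latVec (g c)) '' L₁) ⊓
      PointedCone.hull ℝ ((fun c => latVec (g c)) '' L₂) =
      PointedCone.hull ℝ ((fun c => latVec (g c)) '' (L₁ ∩ L₂)) := by
  apply le_antisymm
  · rintro x ⟨hx, hy⟩
    obtain ⟨α, hα, hαL, rfl⟩ := mem_hull_image_iff.1 hx
    obtain ⟨β, hβ, hβL, hs⟩ := mem_hull_image_iff.1 hy
    have := hK M₁ h₁ M₂ h₂ α β hα hβ (fun c hc => hL₁ (hαL c hc)) (fun c hc => hL₂ (hβL c hc))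
      hs.symm
    subst this
    exact mem_hull_image_iff.2 ⟨α, hα, fun c hc => ⟨hαL c hc, hβL c hc⟩, rfl⟩
  · exact le_inf (Submodule.span_mono (Set.image_mono Set.inter_subset_left))
      (Submodule.span_mono (Set.image_mono Set.inter_subset_right))

lemma UniqueRep.mem_of_mem_hull (hK : UniqueRep g K) (hcover : ∀ c, ∃ L ∈ K, c ∈ L) {L : Set κ}
    (hL : L ∈ K) {c : κ} (hc : latVec (g c) ∈ PointedCone.hull ℝ ((fun c => latVec (g c)) '' L)) :
    c ∈ L := by
  classical
  obtain ⟨α, hα, hαL, hs⟩ := mem_hull_image_iff.1 hc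
  obtain ⟨L', hL', hcL'⟩ := hcover c
  have := hK L hL L' hL' α (Pi.single c 1) hα (fun i => ?_) hαL (fun i hi => ?_) ?_
  · exact hαL c (by rw [this]; simp)
  · by_cases h : i = c
    · subst h; simp
    · simp [h]
  · by_cases h : i = c
    · exact h ▸ hcL'
    · simp [h] at hi
  · rw [hs]
    simp [Pi.single_apply, ite_smul]

lemma UniqueRep.injective (hK : UniqueRep g K) (hcover : ∀ c, ∃ L ∈ K, c ∈ L) :
    Function.Injective g := by
  classical
  intro c c' h
  obtain ⟨L, hL, hc⟩ := hcover c
  obtain ⟨L', hL', hc'⟩ := hcover c'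
  have hsupp : ∀ (b : κ) (S : Set κ), b ∈ S → ∀ i, (Pi.single b 1 : κ → ℝ) i ≠ 0 → i ∈ S := by
    intro b S hb i hi
    by_cases h : i = b
    · exact h ▸ hb
    · simp [h] at hi
  have hnn : ∀ b i, 0 ≤ (Pi.single b 1 : κ → ℝ) i := fun b i => by
    by_cases h : i = b
    · subst h; simp
    · simp [h]
  have := hK L hL L' hL' (Pi.single c 1) (Pi.single c' 1) (hnn c) (hnn c') (hsupp c L hc)
    (hsupp c' L' hc') (by simp [Pi.single_apply, ite_smul, h])
  by_contra hne
  simpa [hne] using congrFun this c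

lemma UniqueRep.linearIndepOn (hK : UniqueRep g K) {L : Set κ} (hL : L ∈ K) :
    LinearIndepOn ℝ (fun c => latVec (g c)) L := by
  rw [linearIndepOn_iff]
  intro l hl hsum
  rw [Finsupp.linearCombination_apply, Finsupp.sum_fintype _ _ (by simp)] at hsum
  have hmem : ∀ c, l c ≠ 0 → c ∈ L := fun c hc => hl (by simpa using hc)
  -- compare the positive and the negative part of a vanishing combination
  have := hK L hL L hL (fun c => (l c)⁺) (fun c => (l c)⁻) (fun c => posPart_nonneg _)
    (fun c => negPart_nonneg _) (fun c hc => hmem c fun h => hc (by simp [h]))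
    (fun c hc => hmem c fun h => hc (by simp [h])) (by
      rw [← sub_eq_zero, ← Finset.sum_sub_distrib, ← hsum]
      exact Finset.sum_congr rfl fun c _ => by rw [← sub_smul, posPart_sub_negPart])
  ext c
  rw [← posPart_sub_negPart (l c)]
  exact sub_eq_zero.2 (congrFun this c)

/-- Primitive vectors with unique nonnegative representations along `K` are the ray generators of a
simplicial fan: the cones spanned by the members of `K`, with all their faces. -/
theorem UniqueRep.isSimplicialFan (hK : UniqueRep g K) (hprim : ∀ c, IsPrimitive (g c))
    (hcover : ∀ c, ∃ L ∈ K, c ∈ L)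
    (hspan : Submodule.span ℝ (Set.range fun c => latVec (g c)) = ⊤) :
    IsSimplicialFan {τ : PointedCone ℝ (ι → ℝ) | ∃ L ∈ K,
      τ.IsFaceOf (PointedCone.hull ℝ ((fun c => latVec (g c)) '' L))} g := by
  have hform : ∀ τ ∈ {τ : PointedCone ℝ (ι → ℝ) | ∃ L ∈ K,
      τ.IsFaceOf (PointedCone.hull ℝ ((fun c => latVec (g c)) '' L))},
      ∃ M ∈ K, ∃ L ⊆ M, τ = PointedCone.hull ℝ ((fun c => latVec (g c)) '' L) := by
    rintro τ ⟨L, hL, hτ⟩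
    exact ⟨L, hL, _, Set.sep_subset _ _, IsFaceOf.eq_hull hτ⟩
  refine ⟨⟨?_, ?_, ?_, ?_, ?_⟩, ?_, hK.injective hcover, ?_, hspan⟩
  · refine (Set.finite_range fun L : Set κ =>
      PointedCone.hull ℝ ((fun c => latVec (g c)) '' L)).subset ?_
    intro τ hτ
    obtain ⟨-, -, L, -, rfl⟩ := hform τ hτ
    exact ⟨L, rfl⟩
  · intro τ hτ
    obtain ⟨-, -, L, -, rfl⟩ := hform τ hτ
    exact ⟨g '' L, L.toFinite.image _, by rw [Set.image_image]⟩
  · intro τ hτ v hv hv'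
    obtain ⟨M, hM, L, hL, rfl⟩ := hform τ hτ
    obtain ⟨α, hα, hαL, rfl⟩ := mem_hull_image_iff.1 hv
    obtain ⟨β, hβ, hβL, hs⟩ := mem_hull_image_iff.1 hv'
    have := hK M hM M hM (α + β) 0 (fun c => add_nonneg (hα c) (hβ c)) (by simp) (fun c hc => ?_)
      (by simp) (by simp [add_smul, Finset.sum_add_distrib, hs])
    · have h0 : α = 0 := by
        funext c
        have h1 := congrFun this c
        have h2 := hα c
        have h3 := hβ c
        simp only [Pi.add_apply, Pi.zero_apply] at *
        linarith
      simp [h0]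
    · by_cases h : α c = 0
      · exact hL (hβL c (by simpa [h] using hc))
      · exact hL (hαL c h)
  · rintro σ ⟨L, hL, hσ⟩ τ hτ
    exact ⟨L, hL, hτ.trans hσ⟩
  · intro σ hσ τ hτ
    obtain ⟨M₁, hM₁, L₁, hL₁, rfl⟩ := hform σ hσ
    obtain ⟨M₂, hM₂, L₂, hL₂, rfl⟩ := hform τ hτ
    have hinf := hK.inf_eq hM₁ hM₂ hL₁ hL₂
    rw [hinf]
    exact ⟨((hK.isFaceOf hM₁ (Set.inter_subset_left.trans hL₁)).isFaceOf_iff_le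
        (hK.isFaceOf hM₁ hL₁)).2 (hinf ▸ inf_le_left),
      ((hK.isFaceOf hM₂ (Set.inter_subset_right.trans hL₂)).isFaceOf_iff_le
        (hK.isFaceOf hM₂ hL₂)).2 (hinf ▸ inf_le_right)⟩
  · intro σ hσ
    obtain ⟨M, hM, L, hL, rfl⟩ := hform σ hσ
    exact PointedCone.IsSimplicial.hull (L.toFinite.image _)
      ((hK.linearIndepOn hM).mono hL).id_image
  · apply Set.Subset.antisymm
    · rintro _ ⟨c, rfl⟩
      obtain ⟨L, hL, hc⟩ := hcover c
      refine ⟨hprim c, L, hL, ?_⟩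
      have := hK.isFaceOf hL (Set.singleton_subset_iff.2 hc)
      rwa [Set.image_singleton] at this
    · rintro v ⟨hv, hvf⟩
      obtain ⟨M, hM, L, hL, h⟩ := hform _ hvf
      have hne : L.Nonempty := by
        by_contra hne
        rw [Set.not_nonempty_iff_eq_empty] at hne
        subst hne
        have : latVec v ∈ PointedCone.hull ℝ {latVec v} := Submodule.subset_span rfl
        rw [h] at this
        simp [PointedCone.hull] at this
        exact hv.latVec_ne_zero this
      obtain ⟨c, hc⟩ := hne
      have : latVec (g c) ∈ PointedCone.hull ℝ {latVec v} := by
        rw [h]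
        exact Submodule.subset_span ⟨c, hc, rfl⟩
      obtain ⟨t, ht, htv⟩ := mem_hull_singleton_iff.1 this
      have ht' : t ≠ 0 := by
        rintro rfl
        exact (hprim c).latVec_ne_zero (by simpa using htv.symm)
      exact ⟨c, (hprim c).eq_of_pos hv (lt_of_le_of_ne ht ht'.symm) htv.symm⟩

/-- The sets of ray generators contained in the cones of a simplicial fan have unique nonnegative
representations. -/
theorem IsSimplicialFan.uniqueRep {fan : Set (PointedCone ℝ (ι → ℝ))}
    (h : IsSimplicialFan fan g) :
    UniqueRep g {L | ∃ σ ∈ fan, L = {c | latVec (g c) ∈ σ}} := by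
  have hgen : ∀ c, IsPrimitive (g c) ∧ PointedCone.hull ℝ {latVec (g c)} ∈ fan := fun c => by
    have : g c ∈ rayGenerators fan := h.range_eq ▸ ⟨c, rfl⟩
    exact this
  -- the ray generators in one cone are linearly independent
  have hind : ∀ σ ∈ fan, LinearIndepOn ℝ (fun c => latVec (g c)) {c | latVec (g c) ∈ σ} := by
    intro σ hσ
    obtain ⟨s, hs, hli, rfl⟩ := h.simplicial σ hσ
    have := hs.fintype
    -- every ray generator in the cone is a positive multiple of a vector of the basis `s`
    have hray : ∀ c : {c | latVec (g c) ∈ PointedCone.hull ℝ s}, ∃ (v : s) (t : ℝ), 0 < t ∧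
        latVec (g c) = t • v.1 := by
      rintro ⟨c, hc⟩
      have hface := (h.isFan.inter_face _ hσ _ (hgen c).2).1
      have hle : PointedCone.hull ℝ {latVec (g c)} ≤ PointedCone.hull ℝ s :=
        Submodule.span_le.2 (by simpa using hc)
      rw [inf_eq_right.2 hle] at hface
      have himg : s = (fun v : s => v.1) '' Set.univ := by simp
      rw [himg] at hface
      have heq := IsFaceOf.eq_hull hface
      have hmem : latVec (g c) ∈ PointedCone.hull ℝ {latVec (g c)} := Submodule.subset_span rfl
      rw [heq] at hmem
      obtain ⟨α, hα, hαL, hsum⟩ := mem_hull_image_iff.1 hmem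
      obtain ⟨v, hv⟩ : ∃ v, α v ≠ 0 := by
        by_contra hne
        push Not at hne
        exact (hgen c).1.latVec_ne_zero (by rw [← hsum]; simp [hne])
      obtain ⟨t, ht, htv⟩ := mem_hull_singleton_iff.1 (hαL v hv).2
      have ht' : t ≠ 0 := by
        rintro rfl
        exact hli.ne_zero v.2 (by simpa using htv.symm)
      exact ⟨v, t⁻¹, inv_pos.2 (lt_of_le_of_ne ht ht'.symm), by
        rw [← htv, smul_smul, inv_mul_cancel₀ ht', one_smul]⟩
    choose v t ht hv using hray
    have hinj : Function.Injective v := by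
      intro c c' hcc
      apply Subtype.ext
      apply h.injective
      refine (hgen c).1.eq_of_pos (hgen c').1 (t := t c * (t c')⁻¹)
        (mul_pos (ht c) (inv_pos.2 (ht c'))) ?_
      rw [hv c, hv c', hcc, smul_smul, mul_assoc, inv_mul_cancel₀ (ht c').ne', mul_one]
    have hli' : LinearIndependent ℝ fun c => (v c).1 := LinearIndependent.comp hli v hinj
    have := hli'.units_smul fun c => Units.mk0 (t c) (ht c).ne'
    have heq : (fun c : {c | latVec (g c) ∈ PointedCone.hull ℝ s} => latVec (g c)) =
        (fun c => Units.mk0 (t c) (ht c).ne') • fun c => (v c).1 := funext fun c => hv c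
    rw [← heq] at this
    exact this
  rintro _ ⟨σ, hσ, rfl⟩ _ ⟨σ', hσ', rfl⟩ α β hα hβ hαL hβL hsum
  obtain ⟨hf, hf'⟩ := h.isFan.inter_face σ hσ σ' hσ'
  have hmemσ : ∀ c, α c • latVec (g c) ∈ σ := fun c => by
    by_cases hc : α c = 0
    · simp [hc]
    · exact PointedCone.smul_mem _ (hα c) (hαL c hc)
  have hmemσ' : ∀ c, β c • latVec (g c) ∈ σ' := fun c => by
    by_cases hc : β c = 0
    · simp [hc]
    · exact PointedCone.smul_mem _ (hβ c) (hβL c hc)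
  have hβσ : ∀ c, β c ≠ 0 → latVec (g c) ∈ σ := fun c hc => by
    have hmem : ∑ c, β c • latVec (g c) ∈ σ ⊓ σ' :=
      ⟨hsum ▸ Submodule.sum_mem _ fun c _ => hmemσ c, Submodule.sum_mem _ fun c _ => hmemσ' c⟩
    exact ((PointedCone.smul_mem_iff _ (lt_of_le_of_ne (hβ c) (Ne.symm hc))).1
      (hf'.mem_of_sum_mem hmemσ' hmem c)).1
  have hl := linearIndepOn_iff.1 (hind σ hσ) (Finsupp.equivFunOnFinite.symm (α - β)) (fun c hc => by
      by_cases h0 : α c = 0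
      · exact hβσ c (by simpa [h0] using hc)
      · exact hαL c h0) (by
      rw [Finsupp.linearCombination_apply, Finsupp.sum_fintype _ _ (by simp)]
      simp [sub_smul, hsum])
  funext c
  exact sub_eq_zero.1 (DFunLike.congr_fun hl c)

end UniqueRepresentation

/-! ### The lattice points of the edge -/

section EdgePoints

variable {ι κ : Type*} [Fintype ι] {k : ℕ} {e : κ → ι → ℤ} {Γ : Set (ι → ℝ)}
  {a : Fin (k + 2) → κ}

lemma IsEdgeEnumeration.injective (ha : IsEdgeEnumeration e Γ a) :
    Function.Injective fun j => e (a j) := by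
  obtain ⟨m, hm⟩ := ha.ordered
  intro j l h
  exact hm.injective (congrArg (fun v => m ⬝ᵥ latVec v) h)

lemma IsEdgeEnumeration.mem (ha : IsEdgeEnumeration e Γ a) (j : Fin (k + 2)) :
    latVec (e (a j)) ∈ Γ :=
  (ha.mem_iff _).2 ⟨j, rfl⟩

/-- The lattice points of a segment are equally spaced: translating one of them by a difference of
consecutive ones shorter than the next gap would give a further lattice point of the segment. -/
lemma IsEdgeEnumeration.sub_eq_sub (ha : IsEdgeEnumeration e Γ a) (hconv : Convex ℝ Γ)
    (hdim : Module.finrank ℝ (vectorSpan ℝ Γ) = 1) (i j : Fin (k + 1)) :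
    e (a i.succ) - e (a i.castSucc) = e (a j.succ) - e (a j.castSucc) := by
  obtain ⟨m, hm⟩ := ha.ordered
  let f : Fin (k + 2) → ι → ℝ := fun j => latVec (e (a j))
  have hf : ∀ j, f j ∈ Γ := ha.mem
  have hgap : ∀ j : Fin (k + 1), 0 < m ⬝ᵥ (f j.succ - f j.castSucc) := fun j => by
    rw [dotProduct_sub]
    exact sub_pos.2 (hm j.castSucc_lt_succ)
  have hmemv : ∀ j : Fin (k + 1), f j.succ - f j.castSucc ∈ vectorSpan ℝ Γ := fun j =>
    vsub_mem_vectorSpan ℝ (hf _) (hf _)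
  -- all gaps are positive multiples of each other
  have hprop : ∀ i j : Fin (k + 1), ∃ r : ℝ, 0 < r ∧
      f j.succ - f j.castSucc = r • (f i.succ - f i.castSucc) := by
    intro i j
    have hne : (⟨_, hmemv i⟩ : vectorSpan ℝ Γ) ≠ 0 := fun h => by
      have h0 : f i.succ - f i.castSucc = 0 := congrArg Subtype.val h
      have := hgap i
      simp [h0] at this
    obtain ⟨r, hr⟩ := (finrank_eq_one_iff_of_nonzero' _ hne).1 hdim ⟨_, hmemv j⟩
    have hr' : r • (f i.succ - f i.castSucc) = f j.succ - f j.castSucc := congrArg Subtype.val hr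
    refine ⟨r, ?_, hr'.symm⟩
    have h1 := hgap j
    rw [← hr', dotProduct_smul, smul_eq_mul] at h1
    exact pos_of_mul_pos_left h1 (hgap i).le
  have hle : ∀ i j : Fin (k + 1), m ⬝ᵥ (f i.succ - f i.castSucc) ≤
      m ⬝ᵥ (f j.succ - f j.castSucc) := by
    intro i j
    by_contra! hlt
    obtain ⟨r, hr, hrj⟩ := hprop i j
    have hr1 : r < 1 := by
      rw [hrj, dotProduct_smul, smul_eq_mul] at hlt
      have := hgap i
      by_contra! h
      nlinarith
    let w : ι → ℤ := e (a i.castSucc) + (e (a j.succ) - e (a j.castSucc))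
    have hw : latVec w = f i.castSucc + (f j.succ - f j.castSucc) := by
      funext c; simp [w, latVec, f]
    have hwΓ : latVec w ∈ Γ := by
      have : latVec w = AffineMap.lineMap (f i.castSucc) (f i.succ) r := by
        rw [hw, hrj, AffineMap.lineMap_apply_module']
        abel
      rw [this]
      exact hconv.lineMap_mem (hf _) (hf _) ⟨hr.le, hr1.le⟩
    obtain ⟨l, hl⟩ := (ha.mem_iff w).1 hwΓ
    have hml : m ⬝ᵥ f l = m ⬝ᵥ f i.castSucc + m ⬝ᵥ (f j.succ - f j.castSucc) := by
      rw [← dotProduct_add, ← hw, ← hl]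
    have h1 : i.castSucc < l := hm.lt_iff_lt.1 (show m ⬝ᵥ f _ < m ⬝ᵥ f _ by
      rw [hml]; linarith [hgap j])
    have h2 : l < i.succ := hm.lt_iff_lt.1 (show m ⬝ᵥ f _ < m ⬝ᵥ f _ by
      have h3 := hlt
      rw [dotProduct_sub _ (f i.succ)] at h3
      rw [hml]
      linarith)
    simp only [Fin.lt_def, Fin.val_castSucc, Fin.val_succ] at h1 h2
    omega
  obtain ⟨r, hr, hrj⟩ := hprop i j
  have hr1 : r = 1 := by
    have h1 := le_antisymm (hle i j) (hle j i)
    rw [hrj, dotProduct_smul, smul_eq_mul] at h1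
    exact (mul_right_cancel₀ (hgap i).ne' (by rw [← h1, one_mul])).symm
  apply latVec_injective
  have : ∀ j : Fin (k + 1), latVec (e (a j.succ) - e (a j.castSucc)) = f j.succ - f j.castSucc :=
    fun j => by funext c; simp [latVec, f]
  rw [this, this, hrj, hr1, one_smul]

lemma IsEdgeEnumeration.eq_add_edgeStep (ha : IsEdgeEnumeration e Γ a) (hconv : Convex ℝ Γ)
    (hdim : Module.finrank ℝ (vectorSpan ℝ Γ) = 1) (j : Fin (k + 2)) (c : ι) :
    e (a j) c = e (a 0) c + j.val * edgeStep e a c := by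
  have key : ∀ j : Fin (k + 2), e (a j) c =
      e (a 0) c + j.val * (e (a (0 : Fin (k + 1)).succ) c - e (a 0) c) := by
    intro j
    induction j using Fin.induction with
    | zero => simp
    | succ i ih =>
      have := congrFun (ha.sub_eq_sub hconv hdim i 0) c
      simp only [Pi.sub_apply, Fin.castSucc_zero] at this
      rw [Fin.val_succ, Nat.cast_succ]
      rw [Fin.val_castSucc] at ih
      linear_combination this + ih
  have hstep : edgeStep e a c = e (a (0 : Fin (k + 1)).succ) c - e (a 0) c := by
    rw [edgeStep, key (Fin.last (k + 1)), add_sub_cancel_left, Fin.val_last]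
    push_cast
    exact Int.mul_ediv_cancel_left _ (by positivity)
  rw [hstep]
  exact key j

lemma IsEdgeEnumeration.latVec_eq (ha : IsEdgeEnumeration e Γ a) (hconv : Convex ℝ Γ)
    (hdim : Module.finrank ℝ (vectorSpan ℝ Γ) = 1) (j : Fin (k + 2)) :
    latVec (e (a j)) = latVec (e (a 0)) + (j.val : ℝ) • latVec (edgeStep e a) := by
  funext c
  have := ha.eq_add_edgeStep hconv hdim j c
  simp only [latVec, Pi.add_apply, Pi.smul_apply, smul_eq_mul]
  exact_mod_cast this

end EdgePoints

/-! ### Unique representations for the fan of the edge -/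

section EdgeFan

variable {ι κ : Type*} {k : ℕ} {e : κ → ι → ℤ} {Γ : Set (ι → ℝ)} {a : Fin (k + 2) → κ}

/-- The indices split into those off the edge and the positions on the edge. -/
noncomputable def edgeSplit [Fintype ι] (he : Function.Injective e)
    (ha : IsEdgeEnumeration e Γ a) : OffEdge e Γ ⊕ Fin (k + 2) ≃ κ :=
  Equiv.ofBijective (Sum.elim (fun i => i.1) a) (by
    constructor
    · rintro (i | i) (j | j) h
      · exact congrArg Sum.inl (Subtype.ext h)
      · exact absurd (ha.mem j) (by rw [← show i.1 = a j from h]; exact i.2)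
      · exact absurd (ha.mem i) (by rw [show a i = j.1 from h]; exact j.2)
      · exact congrArg Sum.inr (ha.injective (congrArg e h))
    · intro i
      by_cases h : latVec (e i) ∈ Γ
      · obtain ⟨j, hj⟩ := (ha.mem_iff _).1 h
        exact ⟨Sum.inr j, he hj⟩
      · exact ⟨Sum.inl ⟨i, h⟩, rfl⟩)

/-- Uniqueness of representations in the original fan, with the generators on the edge listed
separately. -/
lemma IsSimplicialFan.uniqueRep_edge [Fintype ι] [Fintype κ]
    {fan : Set (PointedCone ℝ (ι → ℝ))} (hfan : IsSimplicialFan fan e)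
    (ha : IsEdgeEnumeration e Γ a) {σ σ' : PointedCone ℝ (ι → ℝ)} (hσ : σ ∈ fan) (hσ' : σ' ∈ fan)
    {c c' : OffEdge e Γ → ℝ} {w w' : Fin (k + 2) → ℝ} (hc : ∀ i, 0 ≤ c i) (hc' : ∀ i, 0 ≤ c' i)
    (hw : ∀ l, 0 ≤ w l) (hw' : ∀ l, 0 ≤ w' l)
    (hcσ : ∀ i, c i ≠ 0 → latVec (e i.1) ∈ σ) (hcσ' : ∀ i, c' i ≠ 0 → latVec (e i.1) ∈ σ')
    (hwσ : ∀ l, w l ≠ 0 → l ∈ onEdge e a σ) (hwσ' : ∀ l, w' l ≠ 0 → l ∈ onEdge e a σ')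
    (h : ∑ i, c i • latVec (e i.1) + ∑ l, w l • latVec (e (a l)) =
      ∑ i, c' i • latVec (e i.1) + ∑ l, w' l • latVec (e (a l))) : c = c' ∧ w = w' := by
  let E := edgeSplit hfan.injective ha
  have hsum : ∀ (c : OffEdge e Γ → ℝ) (w : Fin (k + 2) → ℝ),
      ∑ i, (Sum.elim c w (E.symm i)) • latVec (e i) =
        ∑ i, c i • latVec (e i.1) + ∑ l, w l • latVec (e (a l)) := by
    intro c w
    rw [← E.sum_comp, Fintype.sum_sum_type]
    simp only [Equiv.symm_apply_apply, Sum.elim_inl, Sum.elim_inr]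
    rfl
  have hE : ∀ {P : κ → Prop}, (∀ i : OffEdge e Γ, P i.1) → (∀ l, P (a l)) → ∀ i, P i := by
    intro P h1 h2 i
    obtain ⟨x, rfl⟩ := E.surjective i
    rcases x with x | x
    · exact h1 x
    · exact h2 x
  have hEl : ∀ i : OffEdge e Γ, E.symm i.1 = Sum.inl i := fun i => E.symm_apply_eq.2 rfl
  have hEr : ∀ l, E.symm (a l) = Sum.inr l := fun l => E.symm_apply_eq.2 rfl
  have := hfan.uniqueRep _ ⟨σ, hσ, rfl⟩ _ ⟨σ', hσ', rfl⟩
    (fun i => Sum.elim c w (E.symm i)) (fun i => Sum.elim c' w' (E.symm i))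
    (hE (by simpa [hEl] using hc) (by simpa [hEr] using hw))
    (hE (by simpa [hEl] using hc') (by simpa [hEr] using hw'))
    (hE (by simpa [hEl] using hcσ) (by simpa [hEr, onEdge] using hwσ))
    (hE (by simpa [hEl] using hcσ') (by simpa [hEr, onEdge] using hwσ'))
    (by rw [hsum, hsum, h])
  constructor
  · funext i
    simpa [hEl] using congrFun this i.1
  · funext l
    simpa [hEr] using congrFun this (a l)

lemma sVar_mem_labels {A B : Set (Fin (k + 1))} {σ : PointedCone ℝ (ι → ℝ)} {p : Fin (k + 1)} :
    (sVar p : EdgeCoord k e Γ) ∈ tVar '' A ∪ sVar '' B ∪ offEdge k e Γ σ ↔ p ∈ B := by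
  constructor
  · rintro ((⟨i, -, h⟩ | ⟨i, hi, h⟩) | ⟨i, -, h⟩)
    · cases h
    · cases h
      exact hi
    · cases h
  · exact fun h => Or.inl (Or.inr ⟨p, h, rfl⟩)

lemma tVar_mem_labels {A B : Set (Fin (k + 1))} {σ : PointedCone ℝ (ι → ℝ)} {p : Fin (k + 1)} :
    (tVar p : EdgeCoord k e Γ) ∈ tVar '' A ∪ sVar '' B ∪ offEdge k e Γ σ ↔ p ∈ A := by
  constructor
  · rintro ((⟨i, hi, h⟩ | ⟨i, -, h⟩) | ⟨i, -, h⟩)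
    · cases h
      exact hi
    · cases h
    · cases h
  · exact fun h => Or.inl (Or.inl ⟨p, h, rfl⟩)

lemma yVar_mem_offEdge {σ : PointedCone ℝ (ι → ℝ)} {i : OffEdge e Γ} :
    (yVar i : EdgeCoord k e Γ) ∈ offEdge k e Γ σ ↔ latVec (e i.1) ∈ σ := by
  constructor
  · rintro ⟨i', hi', h⟩
    have : i = i' := Sum.inr_injective (Sum.inr_injective h)
    exact this ▸ hi'
  · exact fun h => ⟨i, h, rfl⟩

lemma yVar_mem_labels {A B : Set (Fin (k + 1))} {σ : PointedCone ℝ (ι → ℝ)} {i : OffEdge e Γ} :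
    (yVar i : EdgeCoord k e Γ) ∈ tVar '' A ∪ sVar '' B ∪ offEdge k e Γ σ ↔
      latVec (e i.1) ∈ σ := by
  rw [Set.mem_union, yVar_mem_offEdge, or_iff_right]
  rintro (⟨i, -, h⟩ | ⟨i, -, h⟩) <;> cases h

/-- The share of the `p`-th unit interval that lies to the left of `x`. -/
noncomputable def share (x : ℝ) (p : ℕ) : ℝ := min 1 (max 0 (x - p))

lemma share_mono (p : ℕ) : Monotone fun x => share x p := fun x y h => by
  exact min_le_min_left _ (max_le_max_left _ (sub_le_sub_right h _))

lemma share_of_le {x : ℝ} {p : ℕ} (h : x ≤ p) : share x p = 0 := by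
  unfold share
  rw [max_eq_left (by linarith)]
  norm_num

lemma share_of_ge {x : ℝ} {p : ℕ} (h : p + 1 ≤ x) : share x p = 1 := by
  unfold share
  rw [max_eq_right (by linarith), min_eq_left (by linarith)]

lemma share_add {t : ℝ} (p : ℕ) (h0 : 0 ≤ t) (h1 : t ≤ 1) : share (p + t) p = t := by
  unfold share
  rw [add_sub_cancel_left, max_eq_right h0, min_eq_right h1]

lemma sum_share {x : ℝ} {n : ℕ} (h0 : 0 ≤ x) (h1 : x ≤ n) : ∑ p : Fin n, share x p = x := by
  have : ∀ n : ℕ, ∑ p ∈ Finset.range n, share x p = min (n : ℝ) x := by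
    intro n
    induction n with
    | zero => simp [min_eq_left h0]
    | succ n ih =>
      rw [Finset.sum_range_succ, ih]
      push_cast
      rcases le_total x n with h | h
      · rw [share_of_le h, min_eq_right h, min_eq_right (by linarith), add_zero]
      · rcases le_total x (n + 1) with h' | h'
        · rw [min_eq_left h, min_eq_right h', share, max_eq_right (by linarith),
            min_eq_right (by linarith)]
          ring
        · rw [min_eq_left h, min_eq_left h', share_of_ge h']
  rw [Fin.sum_univ_eq_sum_range (fun p => share x p), this, min_eq_right h1]

/-- The point of the edge at position `x`, in units of its lattice length, is a convex combination
of generators of `σ` on the edge. -/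
def HasEdgePosition (e : κ → ι → ℤ) (a : Fin (k + 2) → κ) (σ : PointedCone ℝ (ι → ℝ)) (x : ℝ) :
    Prop :=
  ∃ w : Fin (k + 2) → ℝ, (∀ l, 0 ≤ w l) ∧ (∀ l, w l ≠ 0 → l ∈ onEdge e a σ) ∧ ∑ l, w l = 1 ∧
    ∑ l, w l * l.val = x

/-- Nonnegative combinations of the generators of a cone of the new fan are parametrized by a cone
`σ` of the old fan, a position `x` on the edge, and the sums of the coefficients of `s_{p+1}` and
`t_p`: the position determines how each sum is shared between the two. -/
lemma IsEdgeConeLabels.exists_position {fan : Set (PointedCone ℝ (ι → ℝ))}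
    {L : Set (EdgeCoord k e Γ)} (hL : IsEdgeConeLabels fan e Γ a L) {α : EdgeCoord k e Γ → ℝ}
    (hα : ∀ c, 0 ≤ α c) (hαL : ∀ c, α c ≠ 0 → c ∈ L) :
    ∃ σ ∈ fan, ∃ x : ℝ, 0 ≤ x ∧ x ≤ k + 1 ∧
      (HasEdgePosition e a σ x ∨ ∀ p, α (sVar p) + α (tVar p) = 0) ∧
      (∀ p : Fin (k + 1), α (tVar p) = share x p * (α (sVar p) + α (tVar p))) ∧
      (∀ i, α (yVar i) ≠ 0 → latVec (e i.1) ∈ σ) := by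
  have hs : ∀ p, sVar p ∉ L → α (sVar p) = 0 := fun p h => by
    by_contra h0
    exact h (hαL _ h0)
  have ht : ∀ p, tVar p ∉ L → α (tVar p) = 0 := fun p h => by
    by_contra h0
    exact h (hαL _ h0)
  cases hL with
  | type_i σ hσ h =>
    have hs0 : ∀ p, α (sVar p) = 0 := fun p => hs p (by rintro ⟨i, -, h⟩; cases h)
    have ht0 : ∀ p, α (tVar p) = 0 := fun p => ht p (by rintro ⟨i, -, h⟩; cases h)
    exact ⟨σ, hσ, 0, le_rfl, by positivity, Or.inr fun p => by rw [hs0, ht0, add_zero],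
      fun p => by rw [hs0, ht0]; simp, fun i hi => yVar_mem_offEdge.1 (hαL _ hi)⟩
  | type_ii σ hσ j h =>
    have hs0 : ∀ p : Fin (k + 1), p.val < j.val → α (sVar p) = 0 := fun p hp =>
      hs p fun h => absurd (sVar_mem_labels.1 h) (not_le.2 hp)
    have ht0 : ∀ p : Fin (k + 1), j.val ≤ p.val → α (tVar p) = 0 := fun p hp =>
      ht p fun h => absurd (tVar_mem_labels.1 h) (not_lt.2 hp)
    refine ⟨σ, hσ, j.val, by positivity, by exact_mod_cast Nat.lt_succ_iff.1 j.2,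
      Or.inl ⟨Pi.single j 1, fun l => ?_, fun l hl => ?_, ?_, ?_⟩, fun p => ?_, fun i hi => ?_⟩
    · by_cases hlj : l = j
      · subst hlj; simp
      · simp [hlj]
    · by_cases hlj : l = j
      · rw [h, hlj]; rfl
      · simp [hlj] at hl
    · simp
    · simp [Pi.single_apply]
    · rcases lt_or_ge p.val j.val with hp | hp
      · rw [hs0 p hp, share_of_ge (by exact_mod_cast hp), zero_add, one_mul]
      · rw [ht0 p hp, share_of_le (by exact_mod_cast hp), zero_mul]
    · exact yVar_mem_labels.1 (hαL _ hi)
  | type_iii σ hσ j h =>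
    have hs0 : ∀ p : Fin (k + 1), p.val < j.val → α (sVar p) = 0 := fun p hp =>
      hs p fun h => absurd (sVar_mem_labels.1 h) (not_le.2 hp)
    have ht0 : ∀ p : Fin (k + 1), j.val < p.val → α (tVar p) = 0 := fun p hp =>
      ht p fun h => absurd (tVar_mem_labels.1 h) (not_le.2 hp)
    obtain ⟨t, ht0', ht1, htj⟩ : ∃ t : ℝ, 0 ≤ t ∧ t ≤ 1 ∧
        α (tVar j) = t * (α (sVar j) + α (tVar j)) := by
      have h1 := hα (sVar j)
      have h2 := hα (tVar j)
      rcases (add_nonneg h1 h2).eq_or_lt with h0 | h0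
      · exact ⟨0, le_rfl, zero_le_one, by linarith⟩
      · exact ⟨α (tVar j) / (α (sVar j) + α (tVar j)), by positivity,
          (div_le_one h0).2 (by linarith), (div_mul_cancel₀ _ h0.ne').symm⟩
    have hj : (j.val : ℝ) ≤ k := by exact_mod_cast Nat.lt_succ_iff.1 j.2
    refine ⟨σ, hσ, j.val + t, by positivity, by linarith,
      Or.inl ⟨Pi.single j.castSucc (1 - t) + Pi.single j.succ t, fun l => ?_, fun l hl => ?_,
        ?_, ?_⟩, fun p => ?_, fun i hi => ?_⟩
    · refine add_nonneg ?_ ?_ <;> rw [Pi.single_apply] <;> split_ifs <;> linarith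
    · rw [h]
      by_contra hlj
      simp only [Set.mem_insert_iff, Set.mem_singleton_iff, not_or] at hlj
      simp [hlj.1, hlj.2] at hl
    · simp [Finset.sum_add_distrib]
    · simp only [Pi.add_apply, add_mul, Finset.sum_add_distrib, Pi.single_apply, ite_mul, zero_mul,
        Finset.sum_ite_eq', Finset.mem_univ, if_true, Fin.val_castSucc, Fin.val_succ]
      push_cast
      ring
    · rcases lt_trichotomy p.val j.val with hp | hp | hp
      · have : (p.val : ℝ) + 1 ≤ j.val := by exact_mod_cast hp
        rw [hs0 p hp, share_of_ge (by linarith), zero_add, one_mul]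
      · obtain rfl : p = j := Fin.ext hp
        rw [share_add _ ht0' ht1]
        exact htj
      · have : (j.val : ℝ) + 1 ≤ p.val := by exact_mod_cast hp
        rw [ht0 p hp, share_of_le (by linarith), zero_mul]
    · exact yVar_mem_labels.1 (hαL _ hi)

/-- The `N`-component of a combination of the generators of the new fan. -/
lemma sum_edgeGen_inl [Fintype κ] (α : EdgeCoord k e Γ → ℝ) (b : ι) :
    (∑ c, α c • latVec (edgeGen e Γ a c)) (Sum.inl b) =
      (α (sVar (Fin.last k)) + α (tVar (Fin.last k))) * e (a 0) b +
        (∑ p : Fin (k + 1), α (tVar p)) * edgeStep e a b + ∑ i, α (yVar i) * e i.1 b := by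
  have hs : ∀ p : Fin (k + 1), sGen e a p (Sum.inl b) =
      if p = Fin.last k then e (a 0) b else 0 := fun p => by
    induction p using Fin.lastCases with
    | last => simp [sGen]
    | cast p => simp [sGen]
  rw [Fintype.sum_sum_type, Fintype.sum_sum_type]
  simp only [Pi.add_apply, Finset.sum_apply, Pi.smul_apply, latVec, edgeGen, hs, smul_eq_mul,
    Sum.elim_inl, Int.cast_add, Int.cast_ite, Int.cast_zero, mul_add, mul_ite, mul_zero,
    Finset.sum_add_distrib, Finset.sum_ite_eq', Finset.mem_univ, if_true, Finset.sum_mul]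
  simp only [sVar, tVar, yVar]
  ring

/-- The `ℤ^k`-component of a combination of the generators of the new fan. -/
lemma sum_edgeGen_inr [Fintype κ] (α : EdgeCoord k e Γ → ℝ) (b : Fin k) :
    (∑ c, α c • latVec (edgeGen e Γ a c)) (Sum.inr b) =
      (α (sVar b.castSucc) + α (tVar b.castSucc)) -
        (α (sVar (Fin.last k)) + α (tVar (Fin.last k))) := by
  have hs : ∀ f : Fin (k + 1) → ℝ, ∑ p, f p * (sGen e a p (Sum.inr b) : ℝ) =
      f b.castSucc - f (Fin.last k) := fun f => by
    rw [Fin.sum_univ_castSucc]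
    simp [sGen, Pi.single_apply, sub_eq_add_neg]
  rw [Fintype.sum_sum_type, Fintype.sum_sum_type]
  simp only [Pi.add_apply, Finset.sum_apply, Pi.smul_apply, latVec, edgeGen, smul_eq_mul,
    Sum.elim_inr, Pi.zero_apply, add_zero, Int.cast_zero, mul_zero, Finset.sum_const_zero, hs]
  simp only [sVar, tVar]
  ring

/-- The generators of the new fan have unique nonnegative representations. Two equal combinations
are compared in the old fan, after a multiple of a point of the edge is added to both. -/
lemma IsSimplicialFan.uniqueRep_edgeGen [Fintype ι] [Fintype κ]
    {fan : Set (PointedCone ℝ (ι → ℝ))} (hfan : IsSimplicialFan fan e)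
    (ha : IsEdgeEnumeration e Γ a)
    (hstep : ∀ j, latVec (e (a j)) = latVec (e (a 0)) + (j.val : ℝ) • latVec (edgeStep e a)) :
    UniqueRep (edgeGen e Γ a) {L | IsEdgeConeLabels fan e Γ a L} := by
  intro L hL L' hL' α β hα hβ hαL hβL hsum
  wlog hq : β (sVar (Fin.last k)) + β (tVar (Fin.last k)) ≤
      α (sVar (Fin.last k)) + α (tVar (Fin.last k)) generalizing L L' α β
  · exact (this L' hL' L hL β α hβ hα hβL hαL hsum.symm (not_le.1 hq).le).symm
  obtain ⟨σ, hσ, x, hx0, hx1, hpos, hB, hy⟩ := hL.exists_position hα hαL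
  obtain ⟨σ', hσ', x', hx0', hx1', hpos', hB', hy'⟩ := hL'.exists_position hβ hβL
  obtain ⟨h, hh⟩ : ∃ h, h = α (sVar (Fin.last k)) + α (tVar (Fin.last k)) -
    (β (sVar (Fin.last k)) + β (tVar (Fin.last k))) := ⟨_, rfl⟩
  have hh0 : 0 ≤ h := by linarith
  have hC : ∀ p, α (sVar p) + α (tVar p) = β (sVar p) + β (tVar p) + h := by
    intro p
    induction p using Fin.lastCases with
    | last => linarith
    | cast p =>
      have := congrFun hsum (Sum.inr p)
      rw [sum_edgeGen_inr, sum_edgeGen_inr] at this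
      linarith
  -- the difference of the two combinations along the edge, and its mean slope, which for `x = x'`
  -- is zero by the convention on division
  obtain ⟨D, hD⟩ : ∃ D, D = ∑ p : Fin (k + 1),
    (share x p - share x' p) * (β (sVar p) + β (tVar p)) := ⟨_, rfl⟩
  obtain ⟨E, hED⟩ : ∃ E, E = D / (x - x') := ⟨_, rfl⟩
  have hC0 : ∀ p : Fin (k + 1), 0 ≤ β (sVar p) + β (tVar p) := fun p => add_nonneg (hβ _) (hβ _)
  -- the terms of `D` all have the sign of `x - x'`
  have hsign : 0 ≤ E ∧ D = E * (x - x') ∧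
      (D = 0 → ∀ p : Fin (k + 1), (share x p - share x' p) * (β (sVar p) + β (tVar p)) = 0) := by
    rcases lt_trichotomy x x' with hxx | hxx | hxx
    · have hle : ∀ p : Fin (k + 1), (share x p - share x' p) * (β (sVar p) + β (tVar p)) ≤ 0 :=
        fun p => mul_nonpos_of_nonpos_of_nonneg (sub_nonpos.2 (share_mono _ hxx.le)) (hC0 p)
      refine ⟨?_, by rw [hED, div_mul_cancel₀ _ (by linarith)], fun h0 p => ?_⟩
      · rw [hED, hD]
        exact div_nonneg_of_nonpos (Finset.sum_nonpos fun p _ => hle p) (by linarith)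
      · rw [hD] at h0
        exact (Finset.sum_eq_zero_iff_of_nonpos fun p _ => hle p).1 h0 p (Finset.mem_univ _)
    · subst hxx
      simp [hD, hED]
    · have hle : ∀ p : Fin (k + 1), 0 ≤ (share x p - share x' p) * (β (sVar p) + β (tVar p)) :=
        fun p => mul_nonneg (sub_nonneg.2 (share_mono _ hxx.le)) (hC0 p)
      refine ⟨?_, by rw [hED, div_mul_cancel₀ _ (by linarith)], fun h0 p => ?_⟩
      · rw [hED, hD]
        exact div_nonneg (Finset.sum_nonneg fun p _ => hle p) (by linarith)
      · rw [hD] at h0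
        exact (Finset.sum_eq_zero_iff_of_nonneg fun p _ => hle p).1 h0 p (Finset.mem_univ _)
  obtain ⟨hE0, hE, hterms⟩ := hsign
  have hsumB' : ∑ p : Fin (k + 1), β (tVar p) =
      ∑ p : Fin (k + 1), share x' p * (β (sVar p) + β (tVar p)) :=
    Finset.sum_congr rfl fun p _ => hB' p
  have hsumB : ∑ p : Fin (k + 1), α (tVar p) =
      (∑ p : Fin (k + 1), share x p * (β (sVar p) + β (tVar p))) + h * x := by
    have : h * x = ∑ p : Fin (k + 1), share x p * h := by
      rw [← Finset.sum_mul, sum_share hx0 (by push_cast; exact hx1), mul_comm]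
    rw [this, ← Finset.sum_add_distrib]
    exact Finset.sum_congr rfl fun p _ => by rw [hB p, hC p]; ring
  have hBB : ∑ p : Fin (k + 1), α (tVar p) = ∑ p : Fin (k + 1), β (tVar p) + h * x + D := by
    rw [hsumB, hsumB', hD]
    simp only [sub_mul, Finset.sum_sub_distrib]
    ring
  -- adding `E` times the point at `x'` to both sides brings both combinations into the old fan
  have hweights : ∀ (σ : PointedCone ℝ (ι → ℝ)) (x r : ℝ), 0 ≤ r →
      (HasEdgePosition e a σ x ∨ r = 0) → ∃ w : Fin (k + 2) → ℝ, (∀ l, 0 ≤ w l) ∧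
        (∀ l, w l ≠ 0 → l ∈ onEdge e a σ) ∧ ∑ l, w l = r ∧ ∑ l, w l * l.val = r * x := by
    rintro σ x r hr (⟨w, h0, hσ, h1, hx⟩ | rfl)
    · refine ⟨fun l => r * w l, fun l => mul_nonneg hr (h0 l),
        fun l hl => hσ l (right_ne_zero_of_mul hl), by rw [← Finset.mul_sum, h1, mul_one], ?_⟩
      rw [← hx, Finset.mul_sum]
      exact Finset.sum_congr rfl fun l _ => mul_assoc _ _ _
    · exact ⟨0, by simp, by simp, by simp, by simp⟩
  have hD0 : (∀ p : Fin (k + 1), β (sVar p) + β (tVar p) = 0) → E = 0 := fun h0 => by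
    rw [hED, hD]
    simp [h0]
  obtain ⟨w, hw0, hwσ, hw1, hwx⟩ := hweights σ x (h + E) (by linarith) (hpos.imp_right fun h0 => by
    have h1 : ∀ p : Fin (k + 1), β (sVar p) + β (tVar p) = 0 := fun p => by
      linarith [h0 p, hC p, hC0 p]
    rw [hD0 h1]
    linarith [hC 0, h1 0, h0 0])
  obtain ⟨w', hw0', hwσ', hw1', hwx'⟩ := hweights σ' x' E hE0 (hpos'.imp_right hD0)
  have hpoint : ∀ (w : Fin (k + 2) → ℝ) b, (∑ l, w l • latVec (e (a l))) b =
      (∑ l, w l) * e (a 0) b + (∑ l, w l * l.val) * edgeStep e a b := by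
    intro w b
    simp only [Finset.sum_apply, Pi.smul_apply, smul_eq_mul, Finset.sum_mul,
      ← Finset.sum_add_distrib]
    refine Finset.sum_congr rfl fun l _ => ?_
    rw [hstep l]
    simp only [Pi.add_apply, Pi.smul_apply, smul_eq_mul, latVec]
    ring
  obtain ⟨hcc, hww⟩ := hfan.uniqueRep_edge ha hσ hσ' (c := fun i => α (yVar i))
    (c' := fun i => β (yVar i)) (fun i => hα _) (fun i => hβ _) hw0 hw0' hy hy' hwσ hwσ' (by
      funext b
      have := congrFun hsum (Sum.inl b)
      rw [sum_edgeGen_inl, sum_edgeGen_inl, hBB] at this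
      rw [Pi.add_apply, Pi.add_apply, hpoint, hpoint, hw1, hw1', hwx, hwx']
      simp only [Finset.sum_apply, Pi.smul_apply, smul_eq_mul, latVec]
      linear_combination this + (e (a 0) b : ℝ) * hh - edgeStep e a b * hE)
  subst hww
  have hh1 : h = 0 := by linarith
  have hx : E * x = E * x' := by rw [← hwx', hwx, hh1, zero_add]
  have hterms := hterms (by rw [hE]; linarith)
  have ht : ∀ p, α (tVar p) = β (tVar p) := fun p => by
    rw [hB p, hB' p, hC p, hh1, add_zero]
    linarith [hterms p]
  funext c
  rcases c with p | p | i
  · have h1 := hC p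
    have h2 := ht p
    simp only [sVar] at h1
    linarith
  · exact ht p
  · exact congrFun hcc i

/-- The generators of a cone on the edge are consecutive lattice points. -/
lemma IsSimplicialFan.onEdge_consecutive [Fintype ι] [Fintype κ]
    {fan : Set (PointedCone ℝ (ι → ℝ))} (hfan : IsSimplicialFan fan e)
    (ha : IsEdgeEnumeration e Γ a)
    (hstep : ∀ j, latVec (e (a j)) = latVec (e (a 0)) + (j.val : ℝ) • latVec (edgeStep e a))
    {σ : PointedCone ℝ (ι → ℝ)} (hσ : σ ∈ fan) {j l : Fin (k + 2)} (hj : j ∈ onEdge e a σ)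
    (hl : l ∈ onEdge e a σ) (hjl : j < l) : l.val = j.val + 1 := by
  by_contra hne
  have hjl' : j.val < l.val := hjl
  obtain ⟨m, hm⟩ : ∃ m : Fin (k + 2), m.val = j.val + 1 := ⟨⟨j.val + 1, by omega⟩, rfl⟩
  have hmj : m ≠ j := fun h => by rw [h] at hm; omega
  have hml : m ≠ l := fun h => by rw [h] at hm; omega
  have hray : PointedCone.hull ℝ {latVec (e (a m))} ∈ fan := by
    have : e (a m) ∈ rayGenerators fan := hfan.range_eq ▸ ⟨a m, rfl⟩
    exact this.2
  have hlt : (j.val : ℝ) + 1 ≤ l.val := by exact_mod_cast hjl'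
  -- a generator strictly between the two others is a nonnegative combination of them
  have := hfan.uniqueRep_edge ha hσ hray (c := 0) (c' := 0)
    (w := Pi.single j (l.val - j.val - 1 : ℝ) + Pi.single l 1)
    (w' := Pi.single m (l.val - j.val : ℝ)) (by simp) (by simp) (fun i => ?_) (fun i => ?_)
    (by simp) (by simp) (fun i hi => ?_) (fun i hi => ?_) ?_
  · have h1 := congrFun this.2 m
    simp [hmj, hml] at h1
    linarith
  · refine add_nonneg ?_ ?_ <;> rw [Pi.single_apply] <;> split_ifs <;> linarith
  · rw [Pi.single_apply]
    split_ifs <;> linarith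
  · by_cases h1 : i = j
    · exact h1 ▸ hj
    · by_cases h2 : i = l
      · exact h2 ▸ hl
      · simp [h1, h2] at hi
  · by_cases h1 : i = m
    · subst h1
      exact Submodule.subset_span rfl
    · simp [h1] at hi
  · simp only [Pi.add_apply, add_smul, Finset.sum_add_distrib, Pi.single_apply, ite_smul, zero_smul,
      Finset.sum_ite_eq', Finset.mem_univ, if_true, Pi.zero_apply, Finset.sum_const_zero, zero_add]
    rw [hstep j, hstep l, hstep m, hm]
    push_cast
    module

/-- At most two generators of a cone lie on the edge, so that every cone of the old fan contributes
one of the three kinds of cones to the new fan. -/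
lemma IsSimplicialFan.onEdge_cases [Fintype ι] [Fintype κ]
    {fan : Set (PointedCone ℝ (ι → ℝ))} (hfan : IsSimplicialFan fan e)
    (ha : IsEdgeEnumeration e Γ a)
    (hstep : ∀ j, latVec (e (a j)) = latVec (e (a 0)) + (j.val : ℝ) • latVec (edgeStep e a))
    {σ : PointedCone ℝ (ι → ℝ)} (hσ : σ ∈ fan) :
    onEdge e a σ = ∅ ∨ (∃ j, onEdge e a σ = {j}) ∨
      ∃ j : Fin (k + 1), onEdge e a σ = {j.castSucc, j.succ} := by
  rcases (onEdge e a σ).eq_empty_or_nonempty with h | ⟨j₀, hj₀⟩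
  · exact Or.inl h
  right
  obtain ⟨j, hj, hmin⟩ := (onEdge e a σ).toFinite.exists_minimal ⟨j₀, hj₀⟩
  have hmin' : ∀ l ∈ onEdge e a σ, l ≠ j → l.val = j.val + 1 := fun l hl hne =>
    hfan.onEdge_consecutive ha hstep hσ hj hl
      (lt_of_le_of_ne ((le_total j l).elim id fun h => hmin hl h) hne.symm)
  by_cases hall : ∀ l ∈ onEdge e a σ, l = j
  · exact Or.inl ⟨j, Set.eq_singleton_iff_unique_mem.2 ⟨hj, hall⟩⟩
  · push Not at hall
    obtain ⟨l, hl, hne⟩ := hall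
    have hlj := hmin' l hl hne
    have hjk : j.val < k + 1 := by have := l.2; omega
    right
    refine ⟨⟨j.val, hjk⟩, ?_⟩
    ext i
    constructor
    · intro hi
      by_cases hij : i = j
      · left
        rw [hij]
        rfl
      · right
        exact Fin.ext (hmin' i hi hij)
    · rintro (rfl | rfl)
      · exact hj
      · have : (⟨j.val, hjk⟩ : Fin (k + 1)).succ = l := Fin.ext hlj.symm
        rw [this]
        exact hl

lemma edgeGen_isPrimitive (he : ∀ i, IsPrimitive (e i))
    (hlast : ∀ c, e (a (Fin.last (k + 1))) c = e (a 0) c + (k + 1) * edgeStep e a c)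
    (c : EdgeCoord k e Γ) : IsPrimitive (edgeGen e Γ a c) := by
  rcases c with p | p | i
  · induction p using Fin.lastCases with
    | last =>
      rcases k with _ | k
      · refine fun b w h => he (a 0) b (fun i => w (Sum.inl i)) (funext fun i => ?_)
        have := congrFun h (Sum.inl i)
        simp only [edgeGen, sGen, Fin.lastCases_last, Sum.elim_inl] at this
        simpa using this
      · exact isPrimitive_of_isUnit (Sum.inr 0) (by simp [edgeGen, sGen])
    | cast p => exact isPrimitive_of_isUnit (Sum.inr p) (by simp [edgeGen, sGen])
  · induction p using Fin.lastCases with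
    | last =>
      rcases k with _ | k
      · refine fun b w h => he (a (Fin.last 1)) b (fun i => w (Sum.inl i)) (funext fun i => ?_)
        have := congrFun h (Sum.inl i)
        simp only [edgeGen, sGen, Fin.lastCases_last, Pi.add_apply, Sum.elim_inl] at this
        rw [hlast, Pi.smul_apply]
        simpa using this
      · exact isPrimitive_of_isUnit (Sum.inr 0) (by simp [edgeGen, sGen])
    | cast p => exact isPrimitive_of_isUnit (Sum.inr p) (by simp [edgeGen, sGen])
  · exact (he i.1).sumElim_zero

/-- Every label occurs in some cone: those on the edge in the cones of its two end points. -/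
lemma IsSimplicialFan.exists_edgeConeLabels [Fintype ι] {fan : Set (PointedCone ℝ (ι → ℝ))}
    (hfan : IsSimplicialFan fan e) (ha : IsEdgeEnumeration e Γ a) (c : EdgeCoord k e Γ) :
    ∃ L ∈ {L | IsEdgeConeLabels fan e Γ a L}, c ∈ L := by
  have hgen : ∀ i, IsPrimitive (e i) ∧ PointedCone.hull ℝ {latVec (e i)} ∈ fan := fun i => by
    have : e i ∈ rayGenerators fan := hfan.range_eq ▸ ⟨i, rfl⟩
    exact this
  have hmem : ∀ i i', latVec (e i') ∈ PointedCone.hull ℝ {latVec (e i)} ↔ i' = i := fun i i' => by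
    constructor
    · intro h
      obtain ⟨t, ht, h⟩ := mem_hull_singleton_iff.1 h
      refine hfan.injective ((hgen i').1.eq_of_pos (hgen i).1 (lt_of_le_of_ne ht ?_) h.symm)
      rintro rfl
      exact (hgen i').1.latVec_ne_zero (by simpa using h.symm)
    · rintro rfl
      exact Submodule.subset_span rfl
  have honEdge : ∀ j, onEdge e a (PointedCone.hull ℝ {latVec (e (a j))}) = {j} := fun j => by
    ext l
    change latVec (e (a l)) ∈ PointedCone.hull ℝ {latVec (e (a j))} ↔ _
    rw [hmem]
    exact ⟨fun h => ha.injective (congrArg e h), fun h => congrArg a h⟩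
  rcases c with p | p | i
  · exact ⟨_, .type_ii _ (hgen (a 0)).2 0 (honEdge 0), Or.inl (Or.inr ⟨p, Nat.zero_le _, rfl⟩)⟩
  · exact ⟨_, .type_ii _ (hgen (a (Fin.last _))).2 _ (honEdge _), Or.inl (Or.inl ⟨p, p.2, rfl⟩)⟩
  · refine ⟨_, .type_i _ (hgen i.1).2 ?_, i, (hmem _ _).2 rfl, rfl⟩
    ext l
    simp only [onEdge, Set.mem_ofPred_eq, hmem, Set.mem_empty_iff_false, iff_false]
    intro h
    exact i.2 (h ▸ ha.mem l)

/-- The new collection of cones is a simplicial fan with the stated ray generators. -/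
theorem IsSimplicialFan.edgeFan [Fintype ι] [Fintype κ]
    {fan : Set (PointedCone ℝ (ι → ℝ))} (hfan : IsSimplicialFan fan e)
    (ha : IsEdgeEnumeration e Γ a)
    (hstep : ∀ (j : Fin (k + 2)) c, e (a j) c = e (a 0) c + j.val * edgeStep e a c)
    (hstep' : ∀ j, latVec (e (a j)) = latVec (e (a 0)) + (j.val : ℝ) • latVec (edgeStep e a)) :
    IsSimplicialFan (edgeFan fan e Γ a) (edgeGen e Γ a) := by
  refine (hfan.uniqueRep_edgeGen ha hstep').isSimplicialFan
    (edgeGen_isPrimitive (fun i => ?_) fun c => ?_)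
    (hfan.exists_edgeConeLabels ha) ?_
  · have : e i ∈ rayGenerators fan := hfan.range_eq ▸ ⟨i, rfl⟩
    exact this.1
  · rw [hstep, Fin.val_last]
    push_cast
    rfl
  · rw [eq_top_iff]
    rintro w -
    set S := Submodule.span ℝ (Set.range fun c => latVec (edgeGen e Γ a c)) with hS
    have hgenS : ∀ c, latVec (edgeGen e Γ a c) ∈ S := fun c => Submodule.subset_span ⟨c, rfl⟩
    let inc : (ι → ℝ) →ₗ[ℝ] (ι ⊕ Fin k → ℝ) :=
      { toFun := fun v => Sum.elim v 0
        map_add' := fun v w => by funext i; rcases i with i | i <;> simp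
        map_smul' := fun r v => by funext i; rcases i with i | i <;> simp }
    have hv : ∀ p : Fin k, (Sum.elim 0 (Pi.single p 1) : ι ⊕ Fin k → ℝ) ∈ S := fun p => by
      convert hgenS (sVar p.castSucc) using 1
      funext i
      rcases i with i | i
      · simp [latVec, edgeGen, sVar, sGen]
      · simp [latVec, edgeGen, sVar, sGen, Pi.single_apply]
    have hright : ∀ f : Fin k → ℝ, (Sum.elim 0 f : ι ⊕ Fin k → ℝ) ∈ S := fun f => by
      have : (Sum.elim 0 f : ι ⊕ Fin k → ℝ) = 
          ∑ p, f p • (Sum.elim 0 (Pi.single p 1) : ι ⊕ Fin k → ℝ) := by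
        funext i
        rcases i with i | i <;> simp [Pi.single_apply]
      rw [this]
      exact Submodule.sum_mem _ fun p _ => Submodule.smul_mem _ _ (hv p)
    have h0 : inc (latVec (e (a 0))) ∈ S := by
      have : inc (latVec (e (a 0))) =
          latVec (edgeGen e Γ a (sVar (Fin.last k))) + Sum.elim (0 : ι → ℝ) (1 : Fin k → ℝ) := by
        funext i
        rcases i with i | i <;> simp [inc, latVec, edgeGen, sVar, sGen]
      rw [this]
      exact Submodule.add_mem _ (hgenS _) (hright _)
    have hδ : inc (latVec (edgeStep e a)) ∈ S := by
      have : inc (latVec (edgeStep e a)) =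
          latVec (edgeGen e Γ a (tVar 0)) - latVec (edgeGen e Γ a (sVar 0)) := by
        funext i
        rcases i with i | i <;> simp [inc, latVec, edgeGen, tVar, sVar]
      rw [this]
      exact Submodule.sub_mem _ (hgenS _) (hgenS _)
    have hinc : ∀ v, inc v ∈ S := by
      have : Submodule.span ℝ (Set.range fun i => latVec (e i)) ≤ S.comap inc := by
        rw [Submodule.span_le]
        rintro _ ⟨i, rfl⟩
        by_cases hi : latVec (e i) ∈ Γ
        · obtain ⟨j, hj⟩ := (ha.mem_iff _).1 hi
          change inc _ ∈ S
          simp only [← hj]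
          rw [hstep', map_add, map_smul]
          exact Submodule.add_mem _ h0 (Submodule.smul_mem _ _ hδ)
        · have : inc (latVec (e i)) = latVec (edgeGen e Γ a (yVar ⟨i, hi⟩)) := by
            funext j
            rcases j with j | j <;> simp [inc, latVec, edgeGen, yVar]
          change inc (latVec (e i)) ∈ S
          rw [this]
          exact hgenS _
      rw [hfan.span_eq_top] at this
      exact fun v => this trivial
    have : w = inc (fun i => w (Sum.inl i)) +
        Sum.elim (0 : ι → ℝ) (fun i => w (Sum.inr i)) := by
      funext i
      rcases i with i | i <;> simp [inc]
    rw [this]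
    exact Submodule.add_mem _ (hinc _) (hright _)

end EdgeFan

/-! ### Closed immersions in homogeneous coordinates -/

section CoxSpaces

variable {ι κ : Type*} [Fintype κ] {fan : Set (PointedCone ℝ (ι → ℝ))} {e : κ → ι → ℤ}

lemma not_mem_zeroLocus_iff {x : κ → ℂ} :
    x ∉ MvPolynomial.zeroLocus ℂ (irrelevantIdeal fan e) ↔
      ∃ σ ∈ fan, ∀ i, x i = 0 → latVec (e i) ∈ σ := by
  classical
  have hspan : x ∈ MvPolynomial.zeroLocus ℂ (irrelevantIdeal fan e) ↔
      irrelevantIdeal fan e ≤ RingHom.ker (MvPolynomial.aeval x : MvPolynomial κ ℂ →ₐ[ℂ] ℂ) :=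
    Iff.rfl
  rw [hspan, irrelevantIdeal, Ideal.span_le, Set.not_subset]
  constructor
  · rintro ⟨_, ⟨σ, hσ, rfl⟩, hx⟩
    refine ⟨σ, hσ, fun i hi => ?_⟩
    by_contra h
    apply hx
    rw [SetLike.mem_coe, RingHom.mem_ker, map_prod]
    exact Finset.prod_eq_zero (Finset.mem_filter.2 ⟨Finset.mem_univ i, h⟩) (by simpa using hi)
  · rintro ⟨σ, hσ, hx⟩
    refine ⟨_, ⟨σ, hσ, rfl⟩, ?_⟩
    rw [SetLike.mem_coe, RingHom.mem_ker, map_prod, Finset.prod_eq_zero_iff]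
    rintro ⟨i, hi, h0⟩
    rw [Finset.mem_filter] at hi
    exact hi.2 (hx i (by simpa using h0))

/-- The action of the torus on the Cox space. -/
def CoxSpace.smul (g : κ → ℂˣ) (x : CoxSpace fan e) : CoxSpace fan e :=
  ⟨fun i => g i * x.1 i, by
    obtain ⟨σ, hσ, h⟩ := not_mem_zeroLocus_iff.1 x.2
    exact not_mem_zeroLocus_iff.2 ⟨σ, hσ, fun i hi => h i (by simpa using hi)⟩⟩

lemma isOpen_eval_ne_zero (p : MvPolynomial κ ℂ) :
    IsOpen {x : CoxSpace fan e | MvPolynomial.eval x.1 p ≠ 0} :=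
  ⟨{x | MvPolynomial.eval x p ≠ 0}, TopologicalSpace.isOpen_generateFrom_of_mem ⟨p, rfl⟩, rfl⟩

/-- The sets `p ≠ 0` form a basis of the Zariski topology. -/
lemma exists_eval_ne_zero_of_isOpen {U : Set (CoxSpace fan e)} (hU : IsOpen U) {x : CoxSpace fan e}
    (hx : x ∈ U) : ∃ p : MvPolynomial κ ℂ, MvPolynomial.eval x.1 p ≠ 0 ∧
      ∀ y : CoxSpace fan e, MvPolynomial.eval y.1 p ≠ 0 → y ∈ U := by
  obtain ⟨V, hV, rfl⟩ := hU
  have hV' : TopologicalSpace.GenerateOpen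
    {D | ∃ p : MvPolynomial κ ℂ, D = {x | MvPolynomial.eval x p ≠ 0}} V := hV
  suffices h : ∀ z ∈ V, ∃ p : MvPolynomial κ ℂ, MvPolynomial.eval z p ≠ 0 ∧
      ∀ y, MvPolynomial.eval y p ≠ 0 → y ∈ V by
    obtain ⟨p, hp, h⟩ := h _ hx
    exact ⟨p, hp, fun y hy => h _ hy⟩
  clear hV hx
  induction hV' with
  | basic D hD =>
    obtain ⟨p, rfl⟩ := hD
    exact fun z hz => ⟨p, hz, fun y hy => hy⟩
  | univ => exact fun z _ => ⟨1, by simp, fun _ _ => trivial⟩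
  | inter s t _ _ hs ht =>
    rintro z ⟨h1, h2⟩
    obtain ⟨p, hp, hps⟩ := hs z h1
    obtain ⟨q, hq, hqt⟩ := ht z h2
    refine ⟨p * q, by simpa using ⟨hp, hq⟩, fun y hy => ?_⟩
    rw [map_mul] at hy
    exact ⟨hps y (left_ne_zero_of_mul hy), hqt y (right_ne_zero_of_mul hy)⟩
  | sUnion S _ h =>
    rintro z ⟨s, hs, hz⟩
    obtain ⟨p, hp, hps⟩ := h s hs z hz
    exact ⟨p, hp, fun y hy => ⟨s, hs, hps y hy⟩⟩

/-- The Cox space is dense in affine space: a nonempty Zariski open subset is not contained in a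
hypersurface. -/
lemma eq_zero_of_eval_eq_zero_on_isOpen {U : Set (CoxSpace fan e)} (hU : IsOpen U)
    (hne : U.Nonempty) {p : MvPolynomial κ ℂ} (hp : ∀ x ∈ U, MvPolynomial.eval x.1 p = 0) :
    p = 0 := by
  classical
  obtain ⟨x, hx⟩ := hne
  obtain ⟨r, hr, hrU⟩ := exists_eval_ne_zero_of_isOpen hU hx
  obtain ⟨σ, hσ, hxσ⟩ := not_mem_zeroLocus_iff.1 x.2
  have hr0 : r ≠ 0 := by
    rintro rfl
    simp at hr
  have hX0 : (∏ i, MvPolynomial.X i : MvPolynomial κ ℂ) ≠ 0 :=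
    Finset.prod_ne_zero_iff.2 fun i _ => MvPolynomial.X_ne_zero i
  have : r * (∏ i, MvPolynomial.X i) * p = 0 := by
    apply MvPolynomial.funext
    intro y
    simp only [map_mul, map_prod, MvPolynomial.eval_X, map_zero, mul_eq_zero]
    by_contra! h
    have hy : y ∉ MvPolynomial.zeroLocus ℂ (irrelevantIdeal fan e) :=
      not_mem_zeroLocus_iff.2 ⟨σ, hσ, fun i hi =>
        absurd hi (Finset.prod_ne_zero_iff.1 h.1.2 i (Finset.mem_univ i))⟩
    exact h.2 (hp ⟨y, hy⟩ (hrU ⟨y, hy⟩ h.1.1))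
  exact (mul_eq_zero.1 this).resolve_left (mul_ne_zero hr0 hX0)

variable [Fintype ι]

lemma toricPoint_eq_iff {x y : CoxSpace fan e} :
    toricPoint x = toricPoint y ↔ ∃ g ∈ coxGroup e, ∀ i, y.1 i = (g i : ℂ) * x.1 i :=
  Quotient.eq (r := orbitSetoid fan e)

lemma toricPoint_smul {g : κ → ℂˣ} (hg : g ∈ coxGroup e) (x : CoxSpace fan e) :
    toricPoint (x.smul g) = toricPoint x :=
  (toricPoint_eq_iff.2 ⟨g, hg, fun _ => rfl⟩).symm

lemma toricPoint_surjective :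
    Function.Surjective (toricPoint : CoxSpace fan e → ToricVariety fan e) :=
  Quotient.mk_surjective

lemma isQuotientMap_toricPoint :
    Topology.IsQuotientMap (toricPoint : CoxSpace fan e → ToricVariety fan e) :=
  ⟨⟨rfl⟩, toricPoint_surjective⟩

/-- A local representation of a regular function as a fraction is valid, with the denominator
cleared, wherever the function is regular. -/
lemma IsRegularOn.mul_eval_eq {V : Set (ToricVariety fan e)} {f : ToricVariety fan e → ℂ}
    (hV : IsOpen V) (hf : IsRegularOn V f) {x₀ : CoxSpace fan e}
    {p q : MvPolynomial κ ℂ} (hq : MvPolynomial.eval x₀.1 q ≠ 0)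
    (hpq : ∀ y : CoxSpace fan e, toricPoint y ∈ V → MvPolynomial.eval y.1 q ≠ 0 →
      f (toricPoint y) = MvPolynomial.eval y.1 p / MvPolynomial.eval y.1 q)
    (x : CoxSpace fan e) (hx : toricPoint x ∈ V) :
    f (toricPoint x) * MvPolynomial.eval x.1 q = MvPolynomial.eval x.1 p := by
  obtain ⟨p', q', hq', hpq'⟩ := hf x hx
  have hV' : IsOpen (toricPoint ⁻¹' V : Set (CoxSpace fan e)) :=
    isQuotientMap_toricPoint.continuous.isOpen_preimage V hV
  have hq0 : q ≠ 0 := by rintro rfl; simp at hq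
  have hq0' : q' ≠ 0 := by rintro rfl; simp at hq'
  have h0 : q * q' * (p * q' - p' * q) = 0 := by
    refine eq_zero_of_eval_eq_zero_on_isOpen hV' ⟨x, hx⟩ fun y hy => ?_
    simp only [map_mul, map_sub, mul_eq_zero]
    by_contra! h
    obtain ⟨⟨h1, h2⟩, h3⟩ := h
    apply h3
    have := (hpq y hy h1).symm.trans (hpq' y hy h2)
    rw [div_eq_div_iff h1 h2] at this
    rw [this, sub_self]
  have h1 : p * q' = p' * q :=
    sub_eq_zero.1 ((mul_eq_zero.1 h0).resolve_left (mul_ne_zero hq0 hq0'))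
  have h2 := congrArg (MvPolynomial.eval x.1) h1
  rw [map_mul, map_mul] at h2
  rw [hpq' x hx hq', div_mul_eq_mul_div, div_eq_iff hq', h2]

/-! ### Semi-invariant parts of polynomials -/

/-- The character by which the group `G` acts on a monomial. -/
noncomputable def monomialChar (e : κ → ι → ℤ) (b : κ →₀ ℕ) : coxGroup e →* ℂ where
  toFun g := ∏ i, (g.1 i : ℂ) ^ b i
  map_one' := by simp
  map_mul' g h := by simp [mul_pow, Finset.prod_mul_distrib]

open Classical in
/-- The part of a polynomial on which the group `G` acts by the character `χ`. -/
noncomputable def isotypicPart (χ : coxGroup e →* ℂ) (p : MvPolynomial κ ℂ) : MvPolynomial κ ℂ :=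
  ∑ b ∈ p.support with monomialChar e b = χ, MvPolynomial.monomial b (p.coeff b)

lemma eval_smul_monomial (g : coxGroup e) (x : κ → ℂ) (b : κ →₀ ℕ) (r : ℂ) :
    MvPolynomial.eval (fun i => (g.1 i : ℂ) * x i) (MvPolynomial.monomial b r) =
      monomialChar e b g * MvPolynomial.eval x (MvPolynomial.monomial b r) := by
  rw [MvPolynomial.eval_monomial, MvPolynomial.eval_monomial,
    Finsupp.prod_fintype _ _ (fun i => pow_zero _), Finsupp.prod_fintype _ _ (fun i => pow_zero _)]
  simp only [mul_pow, monomialChar, MonoidHom.coe_mk, OneHom.coe_mk, Finset.prod_mul_distrib]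
  ring

lemma eval_smul_isotypicPart (χ : coxGroup e →* ℂ) (p : MvPolynomial κ ℂ) (g : coxGroup e)
    (x : κ → ℂ) : MvPolynomial.eval (fun i => (g.1 i : ℂ) * x i) (isotypicPart χ p) =
      χ g * MvPolynomial.eval x (isotypicPart χ p) := by
  classical
  rw [isotypicPart, map_sum, map_sum, Finset.mul_sum]
  refine Finset.sum_congr rfl fun b hb => ?_
  rw [eval_smul_monomial, (Finset.mem_filter.1 hb).2]

open Classical in
lemma eval_smul_eq_sum (p : MvPolynomial κ ℂ) {S : Finset (coxGroup e →* ℂ)}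
    (hS : ∀ b ∈ p.support, monomialChar e b ∈ S) (g : coxGroup e) (x : κ → ℂ) :
    MvPolynomial.eval (fun i => (g.1 i : ℂ) * x i) p =
      ∑ χ ∈ S, χ g * MvPolynomial.eval x (isotypicPart χ p) := by
  conv_lhs => rw [p.as_sum, ← Finset.sum_fiberwise_of_maps_to hS, map_sum]
  refine Finset.sum_congr rfl fun χ _ => ?_
  rw [← eval_smul_isotypicPart, isotypicPart]

/-- An identity `f * q = p` along an orbit passes to semi-invariant parts, since distinct characters
are linearly independent. -/
lemma mul_eval_isotypicPart {p q : MvPolynomial κ ℂ} {f : ℂ} {x : κ → ℂ}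
    (h : ∀ g : coxGroup e, f * MvPolynomial.eval (fun i => (g.1 i : ℂ) * x i) q =
      MvPolynomial.eval (fun i => (g.1 i : ℂ) * x i) p) (χ : coxGroup e →* ℂ) :
    f * MvPolynomial.eval x (isotypicPart χ q) = MvPolynomial.eval x (isotypicPart χ p) := by
  classical
  let S := insert χ ((p.support ∪ q.support).image (monomialChar e))
  have hp : ∀ b ∈ p.support, monomialChar e b ∈ S := fun b hb =>
    Finset.mem_insert_of_mem (Finset.mem_image_of_mem _ (Finset.mem_union_left _ hb))
  have hq : ∀ b ∈ q.support, monomialChar e b ∈ S := fun b hb =>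
    Finset.mem_insert_of_mem (Finset.mem_image_of_mem _ (Finset.mem_union_right _ hb))
  have := linearIndependent_iff'.1 (linearIndependent_monoidHom (coxGroup e) ℂ) S
    (fun χ => f * MvPolynomial.eval x (isotypicPart χ q) - MvPolynomial.eval x (isotypicPart χ p))
    (by
      funext g
      simp only [Finset.sum_apply, Pi.smul_apply, smul_eq_mul, sub_mul, Finset.sum_sub_distrib,
        Pi.zero_apply]
      rw [sub_eq_zero]
      have := h g
      rw [eval_smul_eq_sum q hq, eval_smul_eq_sum p hp, Finset.mul_sum] at this
      convert this using 1
      · exact Finset.sum_congr rfl fun _ _ => by ring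
      · exact Finset.sum_congr rfl fun _ _ => by ring)
    χ (Finset.mem_insert_self _ _)
  exact sub_eq_zero.1 this

lemma exists_isotypicPart_ne_zero {q : MvPolynomial κ ℂ} {x : κ → ℂ}
    (h : MvPolynomial.eval x q ≠ 0) :
    ∃ χ : coxGroup e →* ℂ, MvPolynomial.eval x (isotypicPart χ q) ≠ 0 := by
  classical
  by_contra! h0
  apply h
  have := eval_smul_eq_sum (e := e) q (S := q.support.image (monomialChar e))
    (fun b hb => Finset.mem_image_of_mem _ hb) 1 x
  simpa [h0] using this

end CoxSpaces

/-! ### The closed immersion defined by an equivariant embedding -/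

section Embedding

variable {ι κ ι' κ' : Type*} [Fintype ι] [Fintype κ] [Fintype ι'] [Fintype κ']

/-- A polynomial map `F` that embeds the Cox space of the first fan as the common zero set of the
polynomials `f` in the Cox space of the second one, and under which the two groups `G` have the
same orbits. The condition `lift` says that `F` has local inverses given by rational functions. -/
structure IsCoxEmbedding {J : Type*} (fan : Set (PointedCone ℝ (ι → ℝ))) (e : κ → ι → ℤ)
    (fan' : Set (PointedCone ℝ (ι' → ℝ))) (e' : κ' → ι' → ℤ) (F : (κ → ℂ) → κ' → ℂ)
    (f : J → MvPolynomial κ' ℂ) : Prop where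
  polynomial : ∀ c, ∃ P : MvPolynomial κ ℂ, ∀ x, F x c = MvPolynomial.eval x P
  mem : ∀ x : CoxSpace fan e, F x.1 ∉ MvPolynomial.zeroLocus ℂ (irrelevantIdeal fan' e')
  map_group : ∀ g ∈ coxGroup e, ∃ h ∈ coxGroup e', ∀ x : κ → ℂ,
    F (fun i => (g i : ℂ) * x i) = fun c => (h c : ℂ) * F x c
  lift_group : ∀ h ∈ coxGroup e', ∃ g ∈ coxGroup e, ∀ x : κ → ℂ,
    F (fun i => (g i : ℂ) * x i) = fun c => (h c : ℂ) * F x c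
  eval_eq_zero : ∀ x j, MvPolynomial.eval (F x) (f j) = 0
  exists_preimage : ∀ z : CoxSpace fan' e', (∀ j, MvPolynomial.eval z.1 (f j) = 0) →
    ∃ x : CoxSpace fan e, F x.1 = z.1
  lift : ∀ (x : CoxSpace fan e) (p : MvPolynomial κ ℂ), ∃ q u : MvPolynomial κ' ℂ,
    MvPolynomial.eval (F x.1) u ≠ 0 ∧ ∀ y,
      MvPolynomial.eval (F y) q = MvPolynomial.eval (F y) u * MvPolynomial.eval y p

namespace IsCoxEmbedding

variable {J : Type*} {fan : Set (PointedCone ℝ (ι → ℝ))} {e : κ → ι → ℤ}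
  {fan' : Set (PointedCone ℝ (ι' → ℝ))} {e' : κ' → ι' → ℤ} {F : (κ → ℂ) → κ' → ℂ}
  {f : J → MvPolynomial κ' ℂ}

/-- The map of Cox spaces. -/
def coxMap (hF : IsCoxEmbedding fan e fan' e' F f) (x : CoxSpace fan e) : CoxSpace fan' e' :=
  ⟨F x.1, hF.mem x⟩

/-- The induced map of toric varieties. -/
def toricMap (hF : IsCoxEmbedding fan e fan' e' F f) :
    ToricVariety fan e → ToricVariety fan' e' :=
  Quotient.lift (fun x => toricPoint (hF.coxMap x)) (by
    rintro x y ⟨g, hg, hxy⟩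
    obtain ⟨h, hh, hFh⟩ := hF.map_group g hg
    refine toricPoint_eq_iff.2 ⟨h, hh, fun c => ?_⟩
    have : y.1 = fun i => (g i : ℂ) * x.1 i := funext hxy
    change F y.1 c = _
    rw [this, hFh]
    rfl)

lemma coxMap_injective (hF : IsCoxEmbedding fan e fan' e' F f) :
    Function.Injective hF.coxMap := by
  intro x y hxy
  have hxy' : F x.1 = F y.1 := congrArg Subtype.val hxy
  apply Subtype.ext
  funext i
  obtain ⟨q, u, hu, h⟩ := hF.lift x (MvPolynomial.X i)
  have h1 := h x.1
  have h2 := h y.1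
  rw [← hxy', h1] at h2
  simpa using mul_left_cancel₀ hu h2

lemma exists_comp (hF : IsCoxEmbedding fan e fan' e' F f) (p : MvPolynomial κ' ℂ) :
    ∃ P : MvPolynomial κ ℂ, ∀ x, MvPolynomial.eval (F x) p = MvPolynomial.eval x P := by
  choose P hP using hF.polynomial
  refine ⟨MvPolynomial.bind₁ P p, fun x => ?_⟩
  have : F x = fun c => MvPolynomial.eval x (P c) := funext fun c => hP c x
  rw [this]
  simp only [MvPolynomial.eval, MvPolynomial.eval₂Hom_bind₁]

lemma continuous_coxMap (hF : IsCoxEmbedding fan e fan' e' F f) : Continuous hF.coxMap := by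
  let := zariskiTopology κ'
  refine continuous_induced_rng.2 (continuous_generateFrom_iff.2 ?_)
  rintro _ ⟨p, rfl⟩
  obtain ⟨P, hP⟩ := hF.exists_comp p
  have h := isOpen_eval_ne_zero (fan := fan) (e := e) P
  simp only [← hP] at h
  exact h

lemma isClosedMap_coxMap (hF : IsCoxEmbedding fan e fan' e' F f) : IsClosedMap hF.coxMap := by
  intro Z hZ
  rw [← isOpen_compl_iff, isOpen_iff_forall_mem_open]
  intro z hz
  by_cases hzf : ∀ j, MvPolynomial.eval z.1 (f j) = 0
  · obtain ⟨x, hx⟩ := hF.exists_preimage z hzf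
    have hxz : hF.coxMap x = z := Subtype.ext hx
    have hxZ : x ∈ Zᶜ := fun h => hz ⟨x, h, hxz⟩
    obtain ⟨p, hp, hpZ⟩ := exists_eval_ne_zero_of_isOpen hZ.isOpen_compl hxZ
    obtain ⟨q, u, hu, hq⟩ := hF.lift x p
    refine ⟨{y | MvPolynomial.eval y.1 q ≠ 0}, ?_, isOpen_eval_ne_zero q, ?_⟩
    · rintro _ hy ⟨y, hyZ, rfl⟩
      change MvPolynomial.eval (F y.1) q ≠ 0 at hy
      rw [hq] at hy
      exact hpZ y (right_ne_zero_of_mul hy) hyZ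
    · change MvPolynomial.eval z.1 q ≠ 0
      rw [← hx, hq]
      exact mul_ne_zero hu hp
  · push Not at hzf
    obtain ⟨j, hj⟩ := hzf
    refine ⟨{y | MvPolynomial.eval y.1 (f j) ≠ 0}, ?_, isOpen_eval_ne_zero _, hj⟩
    rintro _ hy ⟨y, -, rfl⟩
    exact hy (hF.eval_eq_zero y.1 j)

/-- A point in the orbit of an image point is itself the image of a point in the same orbit. -/
lemma exists_of_toricPoint_eq (hF : IsCoxEmbedding fan e fan' e' F f) {x : CoxSpace fan e}
    {z : CoxSpace fan' e'} (h : toricPoint (hF.coxMap x) = toricPoint z) :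
    ∃ y, hF.coxMap y = z ∧ toricPoint y = toricPoint x := by
  obtain ⟨h, hh, hz⟩ := toricPoint_eq_iff.1 h
  obtain ⟨g, hg, hgF⟩ := hF.lift_group h hh
  refine ⟨x.smul g, Subtype.ext ?_, toricPoint_smul hg x⟩
  change F (fun i => (g i : ℂ) * x.1 i) = z.1
  rw [hgF]
  exact (funext hz).symm

lemma continuous_toricMap (hF : IsCoxEmbedding fan e fan' e' F f) : Continuous hF.toricMap :=
  isQuotientMap_toricPoint.continuous_iff.2
    (isQuotientMap_toricPoint.continuous.comp hF.continuous_coxMap)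

lemma toricMap_injective (hF : IsCoxEmbedding fan e fan' e' F f) :
    Function.Injective hF.toricMap := by
  intro X Y hXY
  obtain ⟨x, rfl⟩ := toricPoint_surjective X
  obtain ⟨y, rfl⟩ := toricPoint_surjective Y
  obtain ⟨w, hw, hwx⟩ := hF.exists_of_toricPoint_eq hXY
  rw [← hwx, hF.coxMap_injective hw]

lemma isClosedMap_toricMap (hF : IsCoxEmbedding fan e fan' e' F f) :
    IsClosedMap hF.toricMap := by
  intro Z hZ
  rw [← isQuotientMap_toricPoint.isClosed_preimage]
  have : toricPoint ⁻¹' (hF.toricMap '' Z) = hF.coxMap '' (toricPoint ⁻¹' Z) := by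
    ext z
    constructor
    · rintro ⟨X, hX, hXz⟩
      obtain ⟨x, rfl⟩ := toricPoint_surjective X
      obtain ⟨y, hy, hyx⟩ := hF.exists_of_toricPoint_eq hXz
      exact ⟨y, by rwa [Set.mem_preimage, hyx], hy⟩
    · rintro ⟨x, hx, rfl⟩
      exact ⟨toricPoint x, hx, rfl⟩
  rw [this]
  exact hF.isClosedMap_coxMap _ (hZ.preimage isQuotientMap_toricPoint.continuous)

lemma mem_range_toricMap_iff (hF : IsCoxEmbedding fan e fan' e' F f) (z : CoxSpace fan' e') :
    toricPoint z ∈ Set.range hF.toricMap ↔ ∀ j, MvPolynomial.eval z.1 (f j) = 0 := by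
  constructor
  · rintro ⟨X, hX⟩ j
    obtain ⟨x, rfl⟩ := toricPoint_surjective X
    obtain ⟨y, rfl, -⟩ := hF.exists_of_toricPoint_eq hX
    exact hF.eval_eq_zero y.1 j
  · intro h
    obtain ⟨x, hx⟩ := hF.exists_preimage z h
    exact ⟨toricPoint x, congrArg toricPoint (Subtype.ext hx)⟩

lemma isMorphism_toricMap (hF : IsCoxEmbedding fan e fan' e' F f) : IsMorphism hF.toricMap := by
  refine ⟨hF.continuous_toricMap, fun V r _ hr x hx => ?_⟩
  obtain ⟨p, q, hq, hpq⟩ := hr (hF.coxMap x) hx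
  obtain ⟨P, hP⟩ := hF.exists_comp p
  obtain ⟨Q, hQ⟩ := hF.exists_comp q
  refine ⟨P, Q, by rw [← hQ]; exact hq, fun y hy hyQ => ?_⟩
  rw [← hQ] at hyQ
  rw [← hP, ← hQ]
  exact hpq (hF.coxMap y) hy hyQ

/-- A regular function on the source extends locally: a fraction representing it is pulled back from
a fraction on the target, and the latter is made invariant by passing to semi-invariant parts. -/
lemma exists_regular_extension (hF : IsCoxEmbedding fan e fan' e' F f)
    {V : Set (ToricVariety fan e)} {r : ToricVariety fan e → ℂ} (hV : IsOpen V)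
    (hr : IsRegularOn V r) {X : ToricVariety fan e} (hX : X ∈ V) :
    ∃ (W : Set (ToricVariety fan' e')) (s : ToricVariety fan' e' → ℂ),
      IsOpen W ∧ hF.toricMap X ∈ W ∧ IsRegularOn W s ∧
        ∀ Y ∈ V, hF.toricMap Y ∈ W → r Y = s (hF.toricMap Y) := by
  obtain ⟨x₀, rfl⟩ := toricPoint_surjective X
  obtain ⟨p, q, hq, hpq⟩ := hr x₀ hX
  have hrq := hr.mul_eval_eq hV hq hpq
  obtain ⟨p₁, u, hu, hp₁⟩ := hF.lift x₀ p
  obtain ⟨q₁, v, hv, hq₁⟩ := hF.lift x₀ q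
  -- the numerator and the denominator on the target
  let P := p₁ * v
  let Q := q₁ * u
  have hPQ : ∀ x : CoxSpace fan e, toricPoint x ∈ V →
      r (toricPoint x) * MvPolynomial.eval (F x.1) Q = MvPolynomial.eval (F x.1) P := by
    intro x hx
    simp only [P, Q, map_mul, hp₁, hq₁]
    linear_combination MvPolynomial.eval (F x.1) u * MvPolynomial.eval (F x.1) v * hrq x hx
  have hQ0 : MvPolynomial.eval (F x₀.1) Q ≠ 0 := by
    simp only [Q, map_mul, hq₁]
    exact mul_ne_zero (mul_ne_zero hv hq) hu
  obtain ⟨χ, hχ⟩ := exists_isotypicPart_ne_zero (e := e') hQ0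
  have hiso : ∀ x : CoxSpace fan e, toricPoint x ∈ V →
      r (toricPoint x) * MvPolynomial.eval (F x.1) (isotypicPart χ Q) =
        MvPolynomial.eval (F x.1) (isotypicPart χ P) := by
    intro x hx
    refine mul_eval_isotypicPart (fun h => ?_) χ
    obtain ⟨g, hg, hgF⟩ := hF.lift_group h.1 h.2
    have := hPQ (x.smul g) (by rwa [toricPoint_smul hg])
    rw [toricPoint_smul hg] at this
    rw [← hgF]
    exact this
  have hχ0 : ∀ h : coxGroup e', χ h ≠ 0 := fun h h0 => by
    have := χ.map_mul h h⁻¹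
    rw [mul_inv_cancel, χ.map_one, h0, zero_mul] at this
    exact one_ne_zero this
  have hscale : ∀ (R : MvPolynomial κ' ℂ) (h : κ' → ℂˣ) (hh : h ∈ coxGroup e')
      (y z : CoxSpace fan' e'), (∀ c, z.1 c = (h c : ℂ) * y.1 c) →
      MvPolynomial.eval z.1 (isotypicPart χ R) =
        χ ⟨h, hh⟩ * MvPolynomial.eval y.1 (isotypicPart χ R) := by
    intro R h hh y z hyz
    rw [← eval_smul_isotypicPart, show z.1 = _ from funext hyz]
  let s : ToricVariety fan' e' → ℂ := Quotient.lift
    (fun z : CoxSpace fan' e' => MvPolynomial.eval z.1 (isotypicPart χ P) /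
      MvPolynomial.eval z.1 (isotypicPart χ Q)) (by
      rintro y z ⟨h, hh, hyz⟩
      rw [hscale P h hh y z hyz, hscale Q h hh y z hyz, mul_div_mul_left _ _ (hχ0 _)])
  let W : Set (ToricVariety fan' e') :=
    toricPoint '' {z : CoxSpace fan' e' | MvPolynomial.eval z.1 (isotypicPart χ Q) ≠ 0}
  have hW : ∀ z : CoxSpace fan' e', toricPoint z ∈ W ↔
      MvPolynomial.eval z.1 (isotypicPart χ Q) ≠ 0 := by
    intro z
    constructor
    · rintro ⟨y, hy, hyz⟩
      obtain ⟨h, hh, hyz⟩ := toricPoint_eq_iff.1 hyz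
      rw [hscale Q h hh y z hyz]
      exact mul_ne_zero (hχ0 _) hy
    · exact fun h => ⟨z, h, rfl⟩
  refine ⟨W, s, ?_, (hW _).2 hχ, fun z hz => ⟨_, _, (hW z).1 hz, fun _ _ _ => rfl⟩, ?_⟩
  · rw [← isQuotientMap_toricPoint.isOpen_preimage]
    convert isOpen_eval_ne_zero (fan := fan') (e := e') (isotypicPart χ Q) using 1
    ext z
    exact hW z
  · intro Y hY hYW
    obtain ⟨y, rfl⟩ := toricPoint_surjective Y
    exact eq_div_of_mul_eq ((hW (hF.coxMap y)).1 hYW) (hiso y hY)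

theorem isClosedImmersion_toricMap (hF : IsCoxEmbedding fan e fan' e' F f) :
    IsClosedImmersion hF.toricMap where
  isMorphism := hF.isMorphism_toricMap
  isClosedEmbedding := .of_continuous_injective_isClosedMap hF.continuous_toricMap
    hF.toricMap_injective hF.isClosedMap_toricMap
  locally_surjective := fun _ _ hV hr _ hX => hF.exists_regular_extension hV hr hX

end IsCoxEmbedding

end Embedding

/-! ### The map of the edge in homogeneous coordinates -/

section Products

lemma prod_filter_le {H : Type*} [CommMonoid H] (w : ℕ → H) {p n : ℕ} (hp : p < n) :
    ∏ l ∈ Finset.univ.filter (fun l : Fin n => l.val ≤ p), w l.val =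
      ∏ l ∈ Finset.range (p + 1), w l := by
  rw [Finset.prod_filter, Fin.prod_univ_eq_prod_range (fun l => if l ≤ p then w l else 1) n,
    ← Finset.prod_filter]
  congr 1
  ext l
  simp only [Finset.mem_filter, Finset.mem_range]
  omega

lemma prod_filter_lt {H : Type*} [CommMonoid H] (w : ℕ → H) (p n : ℕ) :
    ∏ l ∈ Finset.univ.filter (fun l : Fin n => p < l.val), w l.val =
      ∏ l ∈ Finset.Ico (p + 1) n, w l := by
  rw [Finset.prod_filter, Fin.prod_univ_eq_prod_range (fun l => if p < l then w l else 1) n,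
    ← Finset.prod_filter]
  congr 1
  ext l
  simp only [Finset.mem_filter, Finset.mem_range, Finset.mem_Ico]
  omega

lemma prod_zpow_eq_zpow_sum {H J : Type*} [CommGroup H] (s : Finset J) (f : J → ℤ) (b : H) :
    ∏ i ∈ s, b ^ f i = b ^ ∑ i ∈ s, f i := by
  classical
  induction s using Finset.induction_on with
  | empty => simp
  | insert i s hi ih => rw [Finset.prod_insert hi, Finset.sum_insert hi, zpow_add, ih]

/-- Sequences `s` and `t` with constant products `s p * t p` are the initial and the final partial
products of one sequence, if the terms of `s` before some place `j` and the terms of `t` after it do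
not vanish. -/
lemma exists_partial_products {F : Type*} [Field F] (s t : ℕ → F) {j k : ℕ} (hj : j ≤ k)
    (hst : ∀ p < k, s (p + 1) * t (p + 1) = s p * t p) (hs : ∀ p < j, s p ≠ 0)
    (ht : ∀ p, j < p → p ≤ k → t p ≠ 0) :
    ∃ w : ℕ → F, ∀ p ≤ k, ∏ l ∈ Finset.range (p + 1), w l = s p ∧
      ∏ l ∈ Finset.Ico (p + 1) (k + 2), w l = t p := by
  let w : ℕ → F := fun l =>
    if l ≤ j then (if l = 0 then s 0 else s l / s (l - 1))
    else (if l = k + 1 then t k else t (l - 1) / t l)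
  have hs' : ∀ p ≤ j, ∏ l ∈ Finset.range (p + 1), w l = s p := by
    intro p
    induction p with
    | zero => intro _; simp [w]
    | succ p ih =>
      intro hp
      rw [Finset.prod_range_succ, ih (by omega)]
      simp only [w, if_pos hp, Nat.succ_ne_zero, if_false, Nat.add_sub_cancel]
      exact mul_div_cancel₀ _ (hs p (by omega))
  have ht' : ∀ n p, j ≤ p → p + n = k → ∏ l ∈ Finset.Ico (p + 1) (k + 2), w l = t p := by
    intro n
    induction n with
    | zero =>
      intro p hp hpk
      obtain rfl : p = k := hpk
      rw [Nat.Ico_succ_singleton, Finset.prod_singleton]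
      simp only [w, if_neg (by omega : ¬ p + 1 ≤ j), if_true]
    | succ n ih =>
      intro p hp hpk
      rw [Finset.prod_eq_prod_Ico_succ_bot (by omega), ih (p + 1) (by omega) (by omega)]
      simp only [w, if_neg (by omega : ¬ p + 1 ≤ j), if_neg (by omega : p + 1 ≠ k + 1),
        Nat.add_sub_cancel]
      exact div_mul_cancel₀ _ (ht (p + 1) (by omega) (by omega))
  have hconst : ∀ p ≤ k, s p * t p = s 0 * t 0 := by
    intro p
    induction p with
    | zero => intro _; rfl
    | succ p ih => intro hp; rw [hst p (by omega), ih (by omega)]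
  have htotal : ∀ p ≤ k, (∏ l ∈ Finset.range (p + 1), w l) *
      ∏ l ∈ Finset.Ico (p + 1) (k + 2), w l = s p * t p := by
    intro p hp
    rw [Finset.prod_range_mul_prod_Ico _ (by omega), hconst p hp, ← hconst j hj, ← hs' j le_rfl,
      ← ht' (k - j) j le_rfl (by omega), Finset.prod_range_mul_prod_Ico _ (by omega)]
  refine ⟨w, fun p hp => ?_⟩
  have h := htotal p hp
  rcases lt_trichotomy p j with hpj | rfl | hpj
  · rw [hs' p hpj.le] at h ⊢
    exact ⟨rfl, mul_left_cancel₀ (hs p hpj) h⟩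
  · exact ⟨hs' p le_rfl, ht' (k - p) p le_rfl (by omega)⟩
  · rw [ht' (k - p) p hpj.le (by omega)] at h ⊢
    exact ⟨mul_right_cancel₀ (ht p hpj hp) h, rfl⟩

end Products

section EdgeMap

variable {ι κ : Type*} {k : ℕ} {e : κ → ι → ℤ} {Γ : Set (ι → ℝ)} {a : Fin (k + 2) → κ}

lemma edgeMap_sVar_zero (x : κ → ℂ) : edgeMap e Γ a x (sVar 0) = x (a 0) := by
  have : Finset.univ.filter (fun l : Fin (k + 2) => l.val ≤ (0 : Fin (k + 1)).val) = {0} := by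
    ext l
    rw [Finset.mem_filter_univ, Finset.mem_singleton]
    exact Nat.le_zero.trans (Fin.val_eq_zero_iff)
  simp only [sVar, edgeMap, this, Finset.prod_singleton]

lemma edgeMap_sVar_succ (x : κ → ℂ) (p : Fin k) :
    edgeMap e Γ a x (sVar p.succ) =
      edgeMap e Γ a x (sVar p.castSucc) * x (a p.succ.castSucc) := by
  have : Finset.univ.filter (fun l : Fin (k + 2) => l.val ≤ p.succ.val) =
      insert p.succ.castSucc
        (Finset.univ.filter (fun l : Fin (k + 2) => l.val ≤ p.castSucc.val)) := by
    ext l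
    simp [Fin.ext_iff]
    omega
  simp only [sVar, edgeMap]
  rw [this, Finset.prod_insert (by simp), mul_comm]

lemma edgeMap_tVar_last (x : κ → ℂ) :
    edgeMap e Γ a x (tVar (Fin.last k)) = x (a (Fin.last (k + 1))) := by
  have : Finset.univ.filter (fun l : Fin (k + 2) => (Fin.last k).val < l.val) =
      {Fin.last (k + 1)} := by
    ext l
    simp [Fin.ext_iff]
    omega
  simp only [tVar, edgeMap, this, Finset.prod_singleton]

lemma edgeMap_tVar_castSucc (x : κ → ℂ) (p : Fin k) :
    edgeMap e Γ a x (tVar p.castSucc) =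
      edgeMap e Γ a x (tVar p.succ) * x (a p.succ.castSucc) := by
  have : Finset.univ.filter (fun l : Fin (k + 2) => p.castSucc.val < l.val) =
      insert p.succ.castSucc
        (Finset.univ.filter (fun l : Fin (k + 2) => p.succ.val < l.val)) := by
    ext l
    simp [Fin.ext_iff]
    omega
  simp only [tVar, edgeMap]
  rw [this, Finset.prod_insert (by simp), mul_comm]

lemma edgeMap_sVar_eq_zero {x : κ → ℂ} {p : Fin (k + 1)} :
    edgeMap e Γ a x (sVar p) = 0 ↔ ∃ l : Fin (k + 2), l.val ≤ p.val ∧ x (a l) = 0 := by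
  simp [sVar, edgeMap, Finset.prod_eq_zero_iff]

lemma edgeMap_tVar_eq_zero {x : κ → ℂ} {p : Fin (k + 1)} :
    edgeMap e Γ a x (tVar p) = 0 ↔ ∃ l : Fin (k + 2), p.val < l.val ∧ x (a l) = 0 := by
  simp [tVar, edgeMap, Finset.prod_eq_zero_iff]

lemma eval_edgeEquation (z : EdgeCoord k e Γ → ℂ) (j : Fin k) :
    MvPolynomial.eval z (edgeEquation k e Γ j) =
      z (sVar j.succ) * z (tVar j.succ) - z (sVar j.castSucc) * z (tVar j.castSucc) := by
  simp [edgeEquation]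

lemma eval_edgeMap_edgeEquation (x : κ → ℂ) (j : Fin k) :
    MvPolynomial.eval (edgeMap e Γ a x) (edgeEquation k e Γ j) = 0 := by
  rw [eval_edgeEquation, edgeMap_sVar_succ, edgeMap_tVar_castSucc]
  ring

/-- The point `z` is split at `j`: its coordinates `s_{p+1}` with `p < j` and `t_p` with `p > j` do
not vanish. Every point of the new Cox space is split at some `j`, and at split points the map of
the edge can be inverted. -/
def IsSplitAt (z : EdgeCoord k e Γ → ℂ) (j : Fin (k + 1)) : Prop :=
  (∀ p < j, z (sVar p) ≠ 0) ∧ ∀ p, j < p → z (tVar p) ≠ 0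

lemma IsSplitAt.exists_lift {z : EdgeCoord k e Γ → ℂ} {j : Fin (k + 1)} (hz : IsSplitAt z j)
    [Fintype ι] (he : Function.Injective e) (ha : IsEdgeEnumeration e Γ a)
    (p : MvPolynomial κ ℂ) : ∃ q u : MvPolynomial (EdgeCoord k e Γ) ℂ,
      MvPolynomial.eval z u ≠ 0 ∧ ∀ y, MvPolynomial.eval (edgeMap e Γ a y) q =
        MvPolynomial.eval (edgeMap e Γ a y) u * MvPolynomial.eval y p := by
  have hX : ∀ i, ∃ q u : MvPolynomial (EdgeCoord k e Γ) ℂ,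
      MvPolynomial.eval z u ≠ 0 ∧ ∀ y, MvPolynomial.eval (edgeMap e Γ a y) q =
        MvPolynomial.eval (edgeMap e Γ a y) u * y i := by
    intro i
    obtain ⟨i | l, rfl⟩ := (edgeSplit he ha).surjective i
    · exact ⟨MvPolynomial.X (yVar i), 1, by simp, fun y => by
        rw [MvPolynomial.eval_X, map_one, one_mul]
        rfl⟩
    change ∃ q u : MvPolynomial (EdgeCoord k e Γ) ℂ,
      MvPolynomial.eval z u ≠ 0 ∧ ∀ y, MvPolynomial.eval (edgeMap e Γ a y) q =
        MvPolynomial.eval (edgeMap e Γ a y) u * y (a l)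
    induction l using Fin.lastCases with
    | last =>
      exact ⟨MvPolynomial.X (tVar (Fin.last k)), 1, by simp, fun y => by
        simp [edgeMap_tVar_last]⟩
    | cast l =>
      induction l using Fin.cases with
      | zero => exact ⟨MvPolynomial.X (sVar 0), 1, by simp, fun y => by
          simp [edgeMap_sVar_zero]⟩
      | succ l =>
        rcases le_or_gt l.succ j with hl | hl
        · refine ⟨MvPolynomial.X (sVar l.succ), MvPolynomial.X (sVar l.castSucc), ?_,
            fun y => by simp [edgeMap_sVar_succ]⟩
          rw [MvPolynomial.eval_X]
          exact hz.1 _ (lt_of_lt_of_le l.castSucc_lt_succ hl)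
        · refine ⟨MvPolynomial.X (tVar l.castSucc), MvPolynomial.X (tVar l.succ), ?_,
            fun y => by simp [edgeMap_tVar_castSucc]⟩
          rw [MvPolynomial.eval_X]
          exact hz.2 _ hl
  induction p using MvPolynomial.induction_on with
  | C r => exact ⟨MvPolynomial.C r, 1, by simp, fun y => by simp⟩
  | add p₁ p₂ h₁ h₂ =>
    obtain ⟨q₁, u₁, hu₁, h₁⟩ := h₁
    obtain ⟨q₂, u₂, hu₂, h₂⟩ := h₂
    refine ⟨q₁ * u₂ + q₂ * u₁, u₁ * u₂, by simpa using ⟨hu₁, hu₂⟩, fun y => ?_⟩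
    simp only [map_add, map_mul, h₁, h₂]
    ring
  | mul_X p i h =>
    obtain ⟨q₁, u₁, hu₁, h₁⟩ := h
    obtain ⟨q₂, u₂, hu₂, h₂⟩ := hX i
    refine ⟨q₁ * q₂, u₁ * u₂, by simpa using ⟨hu₁, hu₂⟩, fun y => ?_⟩
    simp only [map_mul, h₁, h₂, MvPolynomial.eval_X]
    ring

/-- The polynomials `s_{j+1} t_j - s_j t_{j-1}` cut out the image of the map, on split points. -/
lemma IsSplitAt.exists_preimage {z : EdgeCoord k e Γ → ℂ} {j : Fin (k + 1)} (hz : IsSplitAt z j)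
    [Fintype ι] (he : Function.Injective e) (ha : IsEdgeEnumeration e Γ a)
    (hzf : ∀ j, MvPolynomial.eval z (edgeEquation k e Γ j) = 0) :
    ∃ x : κ → ℂ, edgeMap e Γ a x = z := by
  obtain ⟨w, hw⟩ := exists_partial_products
    (fun p => if hp : p < k + 1 then z (sVar ⟨p, hp⟩) else 0)
    (fun p => if hp : p < k + 1 then z (tVar ⟨p, hp⟩) else 0)
    (j := j.val) (k := k) (Nat.lt_succ_iff.1 j.2)
    (fun p hp => by
      have := hzf ⟨p, hp⟩
      rw [eval_edgeEquation, sub_eq_zero] at this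
      simp only [dif_pos (by omega : p < k + 1), dif_pos (by omega : p + 1 < k + 1)]
      exact this)
    (fun p hp => by
      simp only [dif_pos (hp.trans j.2)]
      exact hz.1 _ hp)
    (fun p hp hpk => by
      simp only [dif_pos (Nat.lt_succ_iff.2 hpk)]
      exact hz.2 _ hp)
  let E := edgeSplit he ha
  let x : κ → ℂ := fun i => Sum.elim (fun i => z (yVar i)) (fun l : Fin (k + 2) => w l.val)
    (E.symm i)
  have hx : ∀ l, x (a l) = w l.val := fun l => by
    have : E.symm (a l) = Sum.inr l := E.symm_apply_eq.2 rfl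
    simp [x, this]
  have hx' : ∀ i : OffEdge e Γ, x i.1 = z (yVar i) := fun i => by
    have : E.symm i.1 = Sum.inl i := E.symm_apply_eq.2 rfl
    simp [x, this]
  refine ⟨x, funext fun c => ?_⟩
  rcases c with p | p | i
  · simp only [edgeMap, hx]
    rw [prod_filter_le w (by omega), (hw p.val (by omega)).1, dif_pos p.2]
    rfl
  · simp only [edgeMap, hx]
    rw [prod_filter_lt w, (hw p.val (by omega)).2, dif_pos p.2]
    rfl
  · exact hx' i

/-! ### The group of the new toric variety -/

/-- The map of tori given by the formulas of `edgeMap`. -/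
def edgeMapUnits (e : κ → ι → ℤ) (Γ : Set (ι → ℝ)) (a : Fin (k + 2) → κ) (g : κ → ℂˣ) :
    EdgeCoord k e Γ → ℂˣ
  | Sum.inl p => ∏ l ∈ Finset.univ.filter (fun l : Fin (k + 2) => l.val ≤ p.val), g (a l)
  | Sum.inr (Sum.inl p) => ∏ l ∈ Finset.univ.filter (fun l : Fin (k + 2) => p.val < l.val), g (a l)
  | Sum.inr (Sum.inr i) => g i.1

lemma coe_edgeMapUnits (g : κ → ℂˣ) (c : EdgeCoord k e Γ) :
    (edgeMapUnits e Γ a g c : ℂ) = edgeMap e Γ a (fun i => (g i : ℂ)) c := by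
  rcases c with p | p | i <;> simp [edgeMapUnits, edgeMap]

lemma edgeMap_smul (g : κ → ℂˣ) (x : κ → ℂ) :
    edgeMap e Γ a (fun i => (g i : ℂ) * x i) =
      fun c => (edgeMapUnits e Γ a g c : ℂ) * edgeMap e Γ a x c := by
  funext c
  rcases c with p | p | i <;> simp [edgeMapUnits, edgeMap, Finset.prod_mul_distrib]

lemma sum_sGen [Fintype ι] (m : ι ⊕ Fin k → ℤ) :
    ∑ p, m ⬝ᵥ sGen e a p = (fun i => m (Sum.inl i)) ⬝ᵥ e (a 0) := by
  rw [Fin.sum_univ_castSucc]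
  simp only [sGen, Fin.lastCases_castSucc, Fin.lastCases_last, dotProduct, Fintype.sum_sum_type,
    Sum.elim_inl, Sum.elim_inr]
  simp [Pi.single_apply]

/-- The character of `M ⊕ ℤ^k` evaluated on an image of the torus depends on the component in `M`
only. -/
lemma prod_edgeMapUnits [Fintype ι] [Fintype κ] (he : Function.Injective e)
    (ha : IsEdgeEnumeration e Γ a)
    (hstep : ∀ (j : Fin (k + 2)) c, e (a j) c = e (a 0) c + j.val * edgeStep e a c)
    (g : κ → ℂˣ) (m : ι ⊕ Fin k → ℤ) :
    ∏ c, edgeMapUnits e Γ a g c ^ (m ⬝ᵥ edgeGen e Γ a c) =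
      ∏ i, g i ^ ((fun i => m (Sum.inl i)) ⬝ᵥ e i) := by
  let m₀ : ι → ℤ := fun i => m (Sum.inl i)
  have hinl : ∀ v : ι → ℤ, m ⬝ᵥ Sum.elim v 0 = m₀ ⬝ᵥ v := fun v => by
    simp [dotProduct, Fintype.sum_sum_type, m₀]
  have hstep' : ∀ j : Fin (k + 2), m₀ ⬝ᵥ e (a j) =
      m₀ ⬝ᵥ e (a 0) + j.val * (m₀ ⬝ᵥ edgeStep e a) := fun j => by
    simp only [dotProduct, Finset.mul_sum, ← Finset.sum_add_distrib]
    exact Finset.sum_congr rfl fun c _ => by rw [hstep]; ring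
  have hst : ∀ p : Fin (k + 1), edgeMapUnits e Γ a g (Sum.inl p) *
      edgeMapUnits e Γ a g (Sum.inr (Sum.inl p)) = ∏ l, g (a l) := fun p => by
    simp only [edgeMapUnits]
    have := Finset.prod_filter_mul_prod_filter_not Finset.univ
      (fun l : Fin (k + 2) => l.val ≤ p.val) (fun l => g (a l))
    simpa only [not_le] using this
  have ht : ∏ p : Fin (k + 1), edgeMapUnits e Γ a g (Sum.inr (Sum.inl p)) =
      ∏ l, g (a l) ^ l.val := by
    simp only [edgeMapUnits, Finset.prod_filter]
    rw [Finset.prod_comm]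
    refine Finset.prod_congr rfl fun l _ => ?_
    rw [← Finset.prod_filter, Finset.prod_const]
    congr 1
    rw [Fin.card_filter_val_lt]
    have := l.2
    omega
  have hedge : (∏ p : Fin (k + 1), edgeMapUnits e Γ a g (Sum.inl p) ^ (m ⬝ᵥ sGen e a p)) *
      ∏ p : Fin (k + 1), edgeMapUnits e Γ a g (Sum.inr (Sum.inl p)) ^
        (m ⬝ᵥ (sGen e a p + Sum.elim (edgeStep e a) 0)) =
      ∏ l, g (a l) ^ (m₀ ⬝ᵥ e (a l)) := by
    calc _ = (∏ p : Fin (k + 1), (∏ l, g (a l)) ^ (m ⬝ᵥ sGen e a p)) *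
          ∏ p : Fin (k + 1), edgeMapUnits e Γ a g (Sum.inr (Sum.inl p)) ^
            (m₀ ⬝ᵥ edgeStep e a) := by
          rw [← Finset.prod_mul_distrib, ← Finset.prod_mul_distrib]
          refine Finset.prod_congr rfl fun p _ => ?_
          rw [dotProduct_add, hinl, zpow_add, ← hst p, mul_zpow, mul_assoc]
      _ = (∏ l, g (a l)) ^ (m₀ ⬝ᵥ e (a 0)) * (∏ l, g (a l) ^ l.val) ^ (m₀ ⬝ᵥ edgeStep e a) := by
          rw [Finset.prod_zpow, ht, prod_zpow_eq_zpow_sum, sum_sGen]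
      _ = _ := by
          rw [← Finset.prod_zpow, ← Finset.prod_zpow, ← Finset.prod_mul_distrib]
          refine Finset.prod_congr rfl fun l _ => ?_
          rw [hstep' l, zpow_add, zpow_mul, zpow_natCast]
  rw [Fintype.prod_sum_type, Fintype.prod_sum_type, ← mul_assoc]
  rw [← (edgeSplit he ha).prod_comp, Fintype.prod_sum_type, mul_comm]
  simp only [edgeGen]
  rw [hedge]
  congr 1
  refine Finset.prod_congr rfl fun i _ => ?_
  rw [hinl]
  rfl

lemma edgeMapUnits_mem_coxGroup_iff [Fintype ι] [Fintype κ] (he : Function.Injective e)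
    (ha : IsEdgeEnumeration e Γ a)
    (hstep : ∀ (j : Fin (k + 2)) c, e (a j) c = e (a 0) c + j.val * edgeStep e a c)
    (g : κ → ℂˣ) : edgeMapUnits e Γ a g ∈ coxGroup (edgeGen e Γ a) ↔ g ∈ coxGroup e := by
  constructor
  · intro h m
    have := h (Sum.elim m 0)
    rw [prod_edgeMapUnits he ha hstep] at this
    exact this
  · intro h m
    rw [prod_edgeMapUnits he ha hstep]
    exact h _

/-- A function on the indices of the `s_{p+1}` and `t_p` with sum zero is given by a character of
the torus, since the `ℤ^k`-components of the generators satisfy a single relation. -/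
lemma exists_dotProduct_edgeGen [Fintype ι] (ν : Fin (k + 1) → ℤ) (hν : ∑ p, ν p = 0) :
    ∃ m : ι ⊕ Fin k → ℤ, ∀ c : EdgeCoord k e Γ, m ⬝ᵥ edgeGen e Γ a c =
      Sum.elim ν (Sum.elim ν 0) c := by
  have hs : ∀ p, (Sum.elim 0 (fun b : Fin k => ν b.castSucc) : ι ⊕ Fin k → ℤ) ⬝ᵥ sGen e a p =
      ν p := fun p => by
    induction p using Fin.lastCases with
    | last =>
      rw [Fin.sum_univ_castSucc] at hν
      simp only [sGen, Fin.lastCases_last, dotProduct, Fintype.sum_sum_type, Sum.elim_inl,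
        Sum.elim_inr, Pi.zero_apply, zero_mul, Finset.sum_const_zero, zero_add, mul_neg, mul_one,
        Finset.sum_neg_distrib]
      linarith
    | cast p => simp [sGen, dotProduct, Pi.single_apply]
  refine ⟨Sum.elim 0 fun b => ν b.castSucc, fun c => ?_⟩
  rcases c with p | p | i
  · exact hs p
  · simp only [edgeGen, dotProduct_add, hs]
    simp [dotProduct]
  · simp [edgeGen, dotProduct]

lemma sum_single_sub_single (j : Fin k) :
    ∑ p, (Pi.single j.succ 1 - Pi.single j.castSucc 1 : Fin (k + 1) → ℤ) p = 0 := by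
  simp

/-- Every element of the group of the new toric variety comes from the old one. -/
lemma exists_edgeMapUnits_eq [Fintype ι] [Fintype κ] (he : Function.Injective e)
    (ha : IsEdgeEnumeration e Γ a) {h : EdgeCoord k e Γ → ℂˣ}
    (hh : h ∈ coxGroup (edgeGen e Γ a)) : ∃ g : κ → ℂˣ, edgeMapUnits e Γ a g = h := by
  classical
  have hf : ∀ j, MvPolynomial.eval (fun c => (h c : ℂ)) (edgeEquation k e Γ j) = 0 := by
    intro j
    obtain ⟨m, hm⟩ := exists_dotProduct_edgeGen (e := e) (Γ := Γ) (a := a) _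
      (sum_single_sub_single j)
    have h1 := hh m
    simp only [hm] at h1
    have hprod : ∀ f : Fin (k + 1) → ℂˣ, ∏ p, f p ^
        (Pi.single j.succ 1 - Pi.single j.castSucc 1 : Fin (k + 1) → ℤ) p =
          f j.succ / f j.castSucc := fun f => by
      simp only [Pi.sub_apply, zpow_sub, Finset.prod_mul_distrib, Finset.prod_inv_distrib,
        Pi.single_apply]
      simp [div_eq_mul_inv, apply_ite]
    rw [Fintype.prod_sum_type, Fintype.prod_sum_type] at h1
    simp only [Sum.elim_inl, Sum.elim_inr, hprod, Pi.zero_apply, zpow_zero, Finset.prod_const_one,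
      mul_one, div_mul_div_comm, div_eq_one] at h1
    rw [eval_edgeEquation, sub_eq_zero]
    exact_mod_cast congrArg Units.val h1
  obtain ⟨x, hx⟩ := IsSplitAt.exists_preimage (z := fun c => (h c : ℂ)) (j := 0)
    ⟨fun p _ => (h _).ne_zero, fun p _ => (h _).ne_zero⟩ he ha hf
  have hx0 : ∀ i, x i ≠ 0 := by
    intro i h0
    obtain ⟨i | l, rfl⟩ := (edgeSplit he ha).surjective i
    · exact (h (yVar i)).ne_zero ((congrFun hx (yVar i)).symm.trans h0)
    · induction l using Fin.lastCases with
      | last => exact (h (tVar (Fin.last k))).ne_zero ((congrFun hx _).symm.trans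
          (edgeMap_tVar_eq_zero.2 ⟨Fin.last (k + 1), by simp, h0⟩))
      | cast l => exact (h (sVar l)).ne_zero ((congrFun hx _).symm.trans
          (edgeMap_sVar_eq_zero.2 ⟨l.castSucc, by simp, h0⟩))
  refine ⟨fun i => Units.mk0 (x i) (hx0 i), funext fun c => Units.ext ?_⟩
  rw [coe_edgeMapUnits]
  exact congrFun hx c

/-! ### The embedding of Cox spaces -/

/-- The vanishing coordinates of a point of affine space are compatible with the cone that `σ`
contributes to the new fan. -/
def IsCompatible (e : κ → ι → ℤ) (Γ : Set (ι → ℝ)) (a : Fin (k + 2) → κ)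
    (σ : PointedCone ℝ (ι → ℝ)) (z : EdgeCoord k e Γ → ℂ) : Prop :=
  (∀ i, z (yVar i) = 0 → latVec (e i.1) ∈ σ) ∧
  ((onEdge e a σ = ∅ ∧ ∀ p, z (sVar p) ≠ 0 ∧ z (tVar p) ≠ 0) ∨
    (∃ j, onEdge e a σ = {j} ∧ ∀ p : Fin (k + 1),
      (z (sVar p) = 0 → j.val ≤ p.val) ∧ (z (tVar p) = 0 → p.val < j.val)) ∨
    ∃ j : Fin (k + 1), onEdge e a σ = {j.castSucc, j.succ} ∧ ∀ p : Fin (k + 1),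
      (z (sVar p) = 0 → j.val ≤ p.val) ∧ (z (tVar p) = 0 → p.val ≤ j.val))

lemma IsCompatible.exists_isSplitAt {σ : PointedCone ℝ (ι → ℝ)} {z : EdgeCoord k e Γ → ℂ}
    (h : IsCompatible e Γ a σ z) : ∃ j, IsSplitAt z j := by
  rcases h.2 with ⟨-, h⟩ | ⟨j, -, h⟩ | ⟨j, -, h⟩
  · exact ⟨0, fun p _ => (h p).1, fun p _ => (h p).2⟩
  · rcases Nat.lt_or_ge j.val (k + 1) with hj | hj
    · exact ⟨⟨j.val, hj⟩, fun p hp h0 => absurd ((h p).1 h0) (not_le.2 hp),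
        fun p hp h0 => absurd ((h p).2 h0) (not_lt.2 (le_of_lt hp))⟩
    · exact ⟨Fin.last k, fun p _ h0 => absurd ((h p).1 h0) (not_le.2 (lt_of_lt_of_le p.2 hj)),
        fun p hp => absurd hp (not_lt.2 (Fin.le_last p))⟩
  · exact ⟨j, fun p hp h0 => absurd ((h p).1 h0) (not_le.2 hp),
      fun p hp h0 => absurd ((h p).2 h0) (not_le.2 hp)⟩

/-- The chart of the old Cox space belonging to `σ` is the preimage of the chart of the new one
belonging to the cone that `σ` contributes. -/
lemma isCompatible_edgeMap_iff [Fintype ι] (he : Function.Injective e)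
    (ha : IsEdgeEnumeration e Γ a) {σ : PointedCone ℝ (ι → ℝ)}
    (hσ : onEdge e a σ = ∅ ∨ (∃ j, onEdge e a σ = {j}) ∨
      ∃ j : Fin (k + 1), onEdge e a σ = {j.castSucc, j.succ}) {x : κ → ℂ} :
    IsCompatible e Γ a σ (edgeMap e Γ a x) ↔ ∀ i, x i = 0 → latVec (e i) ∈ σ := by
  constructor
  · rintro ⟨hy, h⟩ i hi
    obtain ⟨i | l, rfl⟩ := (edgeSplit he ha).surjective i
    · exact hy i hi
    change x (a l) = 0 at hi
    change l ∈ onEdge e a σ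
    have hs : ∀ p : Fin (k + 1), l.val ≤ p.val → edgeMap e Γ a x (sVar p) = 0 := fun p hp =>
      edgeMap_sVar_eq_zero.2 ⟨l, hp, hi⟩
    have ht : ∀ p : Fin (k + 1), p.val < l.val → edgeMap e Γ a x (tVar p) = 0 := fun p hp =>
      edgeMap_tVar_eq_zero.2 ⟨l, hp, hi⟩
    rcases h with ⟨-, h⟩ | ⟨j, hj, h⟩ | ⟨j, hj, h⟩
    · rcases Nat.lt_or_ge l.val (k + 1) with hl | hl
      · exact absurd (hs ⟨l.val, hl⟩ le_rfl) (h _).1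
      · exact absurd (ht (Fin.last k) hl) (h _).2
    · rw [hj]
      rcases lt_trichotomy l.val j.val with hl | hl | hl
      · exact absurd ((h ⟨l.val, by omega⟩).1 (hs _ le_rfl)) (by simpa using hl)
      · exact Fin.ext hl
      · have := (h ⟨l.val - 1, by omega⟩).2 (ht _ (by simp only; omega))
        simp only at this
        omega
    · rw [hj]
      rcases lt_trichotomy l.val j.val with hl | hl | hl
      · exact absurd ((h ⟨l.val, by omega⟩).1 (hs _ le_rfl)) (by simpa using hl)
      · exact Or.inl (Fin.ext hl)
      · have := (h ⟨l.val - 1, by omega⟩).2 (ht _ (by simp only; omega))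
        simp only at this
        exact Or.inr (Fin.ext (by rw [Fin.val_succ]; omega))
  · intro h
    refine ⟨fun i hi => h _ hi, ?_⟩
    have hmem : ∀ l, x (a l) = 0 → l ∈ onEdge e a σ := fun l hl => h _ hl
    rcases hσ with hσ | ⟨j, hσ⟩ | ⟨j, hσ⟩
    · refine Or.inl ⟨hσ, fun p => ⟨fun h0 => ?_, fun h0 => ?_⟩⟩
      · obtain ⟨l, -, hl⟩ := edgeMap_sVar_eq_zero.1 h0
        simpa [hσ] using hmem l hl
      · obtain ⟨l, -, hl⟩ := edgeMap_tVar_eq_zero.1 h0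
        simpa [hσ] using hmem l hl
    · refine Or.inr (Or.inl ⟨j, hσ, fun p => ⟨fun h0 => ?_, fun h0 => ?_⟩⟩)
      · obtain ⟨l, hlp, hl⟩ := edgeMap_sVar_eq_zero.1 h0
        have := hmem l hl
        rw [hσ] at this
        rwa [← show l = j from this]
      · obtain ⟨l, hlp, hl⟩ := edgeMap_tVar_eq_zero.1 h0
        have := hmem l hl
        rw [hσ] at this
        rwa [← show l = j from this]
    · refine Or.inr (Or.inr ⟨j, hσ, fun p => ⟨fun h0 => ?_, fun h0 => ?_⟩⟩)
      · obtain ⟨l, hlp, hl⟩ := edgeMap_sVar_eq_zero.1 h0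
        have := hmem l hl
        rw [hσ] at this
        rcases this with rfl | rfl
        · exact hlp
        · exact (Nat.le_succ _).trans hlp
      · obtain ⟨l, hlp, hl⟩ := edgeMap_tVar_eq_zero.1 h0
        have := hmem l hl
        rw [hσ] at this
        rcases this with rfl | rfl
        · exact hlp.le
        · exact Nat.lt_succ_iff.1 hlp

lemma exists_edgeMap_eq_eval (x₀ : EdgeCoord k e Γ) :
    ∃ P : MvPolynomial κ ℂ, ∀ x, edgeMap e Γ a x x₀ = MvPolynomial.eval x P := by
  rcases x₀ with p | p | i
  · exact ⟨∏ l ∈ Finset.univ.filter (fun l : Fin (k + 2) => l.val ≤ p.val), MvPolynomial.X (a l),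
      fun x => by simp [edgeMap]⟩
  · exact ⟨∏ l ∈ Finset.univ.filter (fun l : Fin (k + 2) => p.val < l.val), MvPolynomial.X (a l),
      fun x => by simp [edgeMap]⟩
  · exact ⟨MvPolynomial.X i.1, fun x => by simp [edgeMap]⟩

variable [Fintype ι] [Fintype κ] {fan : Set (PointedCone ℝ (ι → ℝ))}

lemma not_mem_zeroLocus_edgeFan_iff (hfan : IsSimplicialFan fan e) (ha : IsEdgeEnumeration e Γ a)
    (hstep : ∀ j, latVec (e (a j)) = latVec (e (a 0)) + (j.val : ℝ) • latVec (edgeStep e a))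
    {z : EdgeCoord k e Γ → ℂ} :
    z ∉ MvPolynomial.zeroLocus ℂ (irrelevantIdeal (edgeFan fan e Γ a) (edgeGen e Γ a)) ↔
      ∃ σ ∈ fan, IsCompatible e Γ a σ z := by
  rw [not_mem_zeroLocus_iff]
  constructor
  · rintro ⟨τ, ⟨L, hL, hτ⟩, h⟩
    have h' : ∀ c, z c = 0 → c ∈ L := fun c hc =>
      (hfan.uniqueRep_edgeGen ha hstep).mem_of_mem_hull
        (hfan.exists_edgeConeLabels ha) hL (hτ.le (h c hc))
    cases hL with
    | type_i σ hσ he =>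
      refine ⟨σ, hσ, fun i hi => yVar_mem_offEdge.1 (h' _ hi), Or.inl ⟨he, fun p => ⟨?_, ?_⟩⟩⟩ <;>
      · intro h0
        obtain ⟨i, -, hi⟩ := h' _ h0
        cases hi
    | type_ii σ hσ j he =>
      exact ⟨σ, hσ, fun i hi => yVar_mem_labels.1 (h' _ hi), Or.inr (Or.inl ⟨j, he, fun p =>
        ⟨fun h0 => sVar_mem_labels.1 (h' _ h0), fun h0 => tVar_mem_labels.1 (h' _ h0)⟩⟩)⟩
    | type_iii σ hσ j he =>
      exact ⟨σ, hσ, fun i hi => yVar_mem_labels.1 (h' _ hi), Or.inr (Or.inr ⟨j, he, fun p =>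
        ⟨fun h0 => sVar_mem_labels.1 (h' _ h0), fun h0 => tVar_mem_labels.1 (h' _ h0)⟩⟩)⟩
  · rintro ⟨σ, hσ, hy, h⟩
    obtain ⟨L, hL, h⟩ : ∃ L, IsEdgeConeLabels fan e Γ a L ∧ ∀ c, z c = 0 → c ∈ L := by
      rcases h with ⟨he, h⟩ | ⟨j, he, h⟩ | ⟨j, he, h⟩
      · refine ⟨_, .type_i σ hσ he, ?_⟩
        rintro (p | p | i) hc
        · exact absurd hc (h p).1
        · exact absurd hc (h p).2
        · exact yVar_mem_offEdge.2 (hy i hc)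
      · refine ⟨_, .type_ii σ hσ j he, ?_⟩
        rintro (p | p | i) hc
        · exact sVar_mem_labels.2 ((h p).1 hc)
        · exact tVar_mem_labels.2 ((h p).2 hc)
        · exact yVar_mem_labels.2 (hy i hc)
      · refine ⟨_, .type_iii σ hσ j he, ?_⟩
        rintro (p | p | i) hc
        · exact sVar_mem_labels.2 ((h p).1 hc)
        · exact tVar_mem_labels.2 ((h p).2 hc)
        · exact yVar_mem_labels.2 (hy i hc)
    exact ⟨_, ⟨L, hL, .refl _⟩, fun c hc => Submodule.subset_span ⟨c, h c hc, rfl⟩⟩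

theorem isCoxEmbedding_edgeMap (hfan : IsSimplicialFan fan e) (ha : IsEdgeEnumeration e Γ a)
    (hstep : ∀ (j : Fin (k + 2)) c, e (a j) c = e (a 0) c + j.val * edgeStep e a c)
    (hstep' : ∀ j, latVec (e (a j)) = latVec (e (a 0)) + (j.val : ℝ) • latVec (edgeStep e a)) :
    IsCoxEmbedding fan e (edgeFan fan e Γ a) (edgeGen e Γ a) (edgeMap e Γ a)
      (edgeEquation k e Γ) where
  polynomial := exists_edgeMap_eq_eval
  mem x := by
    obtain ⟨σ, hσ, h⟩ := not_mem_zeroLocus_iff.1 x.2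
    exact (not_mem_zeroLocus_edgeFan_iff hfan ha hstep').2 ⟨σ, hσ,
      (isCompatible_edgeMap_iff hfan.injective ha (hfan.onEdge_cases ha hstep' hσ)).2 h⟩
  map_group g hg := ⟨edgeMapUnits e Γ a g,
    (edgeMapUnits_mem_coxGroup_iff hfan.injective ha hstep g).2 hg, edgeMap_smul g⟩
  lift_group h hh := by
    obtain ⟨g, rfl⟩ := exists_edgeMapUnits_eq hfan.injective ha hh
    exact ⟨g, (edgeMapUnits_mem_coxGroup_iff hfan.injective ha hstep g).1 hh, edgeMap_smul g⟩
  eval_eq_zero := eval_edgeMap_edgeEquation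
  exists_preimage z hz := by
    obtain ⟨σ, hσ, h⟩ := (not_mem_zeroLocus_edgeFan_iff hfan ha hstep').1 z.2
    obtain ⟨j, hj⟩ := h.exists_isSplitAt
    obtain ⟨x, hx⟩ := hj.exists_preimage hfan.injective ha hz
    rw [← hx, isCompatible_edgeMap_iff hfan.injective ha (hfan.onEdge_cases ha hstep' hσ)] at h
    exact ⟨⟨x, not_mem_zeroLocus_iff.2 ⟨σ, hσ, h⟩⟩, hx⟩
  lift x p := by
    obtain ⟨σ, hσ, h⟩ := not_mem_zeroLocus_iff.1 x.2
    obtain ⟨j, hj⟩ := ((isCompatible_edgeMap_iff hfan.injective ha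
      (hfan.onEdge_cases ha hstep' hσ)).2 h).exists_isSplitAt
    exact hj.exists_lift hfan.injective ha p

end EdgeMap

/-! ### Heights of ideals of parametrized sets -/

section Height

lemma height_le_of_mem_minimalPrimes_span_range {R : Type*} [CommRing R] [IsNoetherianRing R]
    {k : ℕ} (f : Fin k → R) {p : Ideal R} (hp : p ∈ (Ideal.span (Set.range f)).minimalPrimes) :
    p.height ≤ k := by
  classical
  refine (Ideal.height_le_spanRank_toENat_of_mem_minimalPrimes _ p hp).trans ?_
  rw [Submodule.spanRank_toENat_eq_iInf_finset_card]
  refine (iInf_le _ ⟨Finset.univ.image f, by simp [Ideal.span]⟩).trans ?_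
  have h : (Finset.univ.image f).card ≤ k := by
    simpa using Finset.card_image_le (s := Finset.univ) (f := f)
  exact_mod_cast h

lemma le_height_of_chain {R : Type*} [CommRing R] {k : ℕ} (P : ℕ → Ideal R)
    (hprime : ∀ n ≤ k, (P n).IsPrime) (hlt : ∀ n < k, P n < P (n + 1)) :
    (k : ℕ∞) ≤ (P k).height := by
  suffices h : ∀ n ≤ k, (n : ℕ∞) ≤ (P n).height from h k le_rfl
  intro n
  induction n with
  | zero => simp
  | succ n ih =>
    intro hn
    have := hprime n (by omega)
    have := hprime (n + 1) hn
    push_cast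
    exact (add_le_add_left (ih (by omega)) 1).trans
      (Ideal.height_add_one_le_of_lt_of_isPrime (hlt n (by omega)))

/-- The polynomials vanishing on the image of a rational map, defined where `D ≠ 0`, form a prime
ideal. -/
lemma isPrime_vanishingIdeal_of_parametrization {σ : Type*} {Z : Set (σ → ℂ)}
    {D : MvPolynomial σ ℂ} (hD : D ≠ 0) {par : (σ → ℂ) → σ → ℂ}
    (hpar : ∀ z, MvPolynomial.eval z D ≠ 0 → par z ∈ Z)
    (hsurj : ∀ w ∈ Z, ∃ z, MvPolynomial.eval z D ≠ 0 ∧ par z = w)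
    (hlift : ∀ c, ∃ q u : MvPolynomial σ ℂ, ∀ z, MvPolynomial.eval z D ≠ 0 →
      MvPolynomial.eval z u ≠ 0 ∧
        MvPolynomial.eval z q = MvPolynomial.eval z u * par z c) :
    (MvPolynomial.vanishingIdeal ℂ Z).IsPrime := by
  -- the pullback of a polynomial, with denominators cleared
  have hlift' : ∀ p : MvPolynomial σ ℂ, ∃ q u : MvPolynomial σ ℂ, ∀ z,
      MvPolynomial.eval z D ≠ 0 → MvPolynomial.eval z u ≠ 0 ∧
        MvPolynomial.eval z q = MvPolynomial.eval z u * MvPolynomial.eval (par z) p := by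
    intro p
    induction p using MvPolynomial.induction_on with
    | C r => exact ⟨MvPolynomial.C r, 1, fun z _ => by simp⟩
    | add p₁ p₂ h₁ h₂ =>
      obtain ⟨q₁, u₁, h₁⟩ := h₁
      obtain ⟨q₂, u₂, h₂⟩ := h₂
      refine ⟨q₁ * u₂ + q₂ * u₁, u₁ * u₂, fun z hz => ⟨?_, ?_⟩⟩
      · rw [map_mul]
        exact mul_ne_zero (h₁ z hz).1 (h₂ z hz).1
      · simp only [map_add, map_mul, (h₁ z hz).2, (h₂ z hz).2]
        ring
    | mul_X p i h =>
      obtain ⟨q₁, u₁, h₁⟩ := h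
      obtain ⟨q₂, u₂, h₂⟩ := hlift i
      refine ⟨q₁ * q₂, u₁ * u₂, fun z hz => ⟨?_, ?_⟩⟩
      · rw [map_mul]
        exact mul_ne_zero (h₁ z hz).1 (h₂ z hz).1
      · simp only [map_mul, (h₁ z hz).2, (h₂ z hz).2, MvPolynomial.eval_X]
        ring
  have hmem : ∀ p : MvPolynomial σ ℂ, p ∈ MvPolynomial.vanishingIdeal ℂ Z ↔
      ∀ z, MvPolynomial.eval z D ≠ 0 → MvPolynomial.eval (par z) p = 0 := by
    intro p
    rw [MvPolynomial.mem_vanishingIdeal_iff]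
    constructor
    · intro h z hz
      simpa [MvPolynomial.aeval_eq_eval] using h _ (hpar z hz)
    · intro h w hw
      obtain ⟨z, hz, rfl⟩ := hsurj w hw
      simpa [MvPolynomial.aeval_eq_eval] using h z hz
  refine Ideal.isPrime_iff.2 ⟨?_, ?_⟩
  · rw [Ideal.ne_top_iff_one, hmem]
    intro h
    apply hD
    apply MvPolynomial.funext
    intro z
    by_contra hz
    simpa using h z (by simpa using hz)
  · intro p₁ p₂ h
    obtain ⟨q₁, u₁, h₁⟩ := hlift' p₁
    obtain ⟨q₂, u₂, h₂⟩ := hlift' p₂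
    have h0 : D * (q₁ * q₂) = 0 := by
      apply MvPolynomial.funext
      intro z
      by_cases hz : MvPolynomial.eval z D = 0
      · simp [hz]
      · have := (hmem _).1 h z hz
        rw [map_mul] at this
        simp only [map_mul, (h₁ z hz).2, (h₂ z hz).2, map_zero]
        linear_combination MvPolynomial.eval z D * MvPolynomial.eval z u₁ *
          MvPolynomial.eval z u₂ * this
    have key : ∀ p q u : MvPolynomial σ ℂ, (∀ z, MvPolynomial.eval z D ≠ 0 →
        MvPolynomial.eval z u ≠ 0 ∧ MvPolynomial.eval z q =
          MvPolynomial.eval z u * MvPolynomial.eval (par z) p) → q = 0 →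
        p ∈ MvPolynomial.vanishingIdeal ℂ Z := by
      rintro p _ u h rfl
      refine (hmem p).2 fun z hz => ?_
      have := (h z hz).2
      rw [map_zero, zero_eq_mul] at this
      exact this.resolve_left (h z hz).1
    rcases mul_eq_zero.1 ((mul_eq_zero.1 h0).resolve_left hD) with h | h
    · exact Or.inl (key p₁ q₁ u₁ h₁ h)
    · exact Or.inr (key p₂ q₂ u₂ h₂ h)

end Height

/-! ### The complete intersection -/

section CompleteIntersection

variable {ι κ : Type*} {k : ℕ} {e : κ → ι → ℤ} {Γ : Set (ι → ℝ)} {a : Fin (k + 2) → κ}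

lemma isWeightedHomogeneous_edgeEquation [Fintype ι] [Fintype κ] (j : Fin k) :
    ∃ β, MvPolynomial.IsWeightedHomogeneous (varDegree (edgeGen e Γ a)) (edgeEquation k e Γ j)
      β := by
  have hdeg : varDegree (edgeGen e Γ a) (sVar j.succ) + varDegree (edgeGen e Γ a) (tVar j.succ) =
      varDegree (edgeGen e Γ a) (sVar j.castSucc) +
        varDegree (edgeGen e Γ a) (tVar j.castSucc) := by
    obtain ⟨m, hm⟩ := exists_dotProduct_edgeGen (e := e) (Γ := Γ) (a := a) _
      (sum_single_sub_single j)
    simp only [varDegree, ← Submodule.Quotient.mk_add]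
    rw [Submodule.Quotient.eq]
    refine ⟨m, funext fun c => ?_⟩
    rw [Matrix.mulVecLin_apply]
    change edgeGen e Γ a c ⬝ᵥ m = _
    rw [dotProduct_comm, hm]
    rcases c with p | p | i <;> simp [Pi.single_apply, sVar, tVar]
  refine ⟨_, ((MvPolynomial.isWeightedHomogeneous_X ℂ _ _).mul
    (MvPolynomial.isWeightedHomogeneous_X ℂ _ _)).sub ?_⟩
  rw [hdeg]
  exact (MvPolynomial.isWeightedHomogeneous_X ℂ _ _).mul
    (MvPolynomial.isWeightedHomogeneous_X ℂ _ _)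

lemma eval_pderiv_tVar (z : EdgeCoord k e Γ → ℂ) (j : Fin k) (p : Fin (k + 1)) :
    MvPolynomial.eval z (MvPolynomial.pderiv (tVar p) (edgeEquation k e Γ j)) =
      (if j.succ = p then z (sVar p) else 0) - if j.castSucc = p then z (sVar p) else 0 := by
  classical
  have hs : ∀ q, (sVar q : EdgeCoord k e Γ) ≠ tVar p := fun q h => by cases h
  have ht : ∀ q, (tVar q : EdgeCoord k e Γ) = tVar p ↔ q = p := fun q =>
    ⟨fun h => Sum.inl_injective (Sum.inr_injective h), fun h => h ▸ rfl⟩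
  simp only [edgeEquation, map_sub, Derivation.leibniz, MvPolynomial.pderiv_X, smul_eq_mul,
    map_mul, MvPolynomial.eval_X, Pi.single_apply, hs, ht, if_false, mul_zero, add_zero]
  split_ifs <;> simp_all

lemma eval_pderiv_sVar (z : EdgeCoord k e Γ → ℂ) (j : Fin k) (p : Fin (k + 1)) :
    MvPolynomial.eval z (MvPolynomial.pderiv (sVar p) (edgeEquation k e Γ j)) =
      (if j.succ = p then z (tVar p) else 0) - if j.castSucc = p then z (tVar p) else 0 := by
  classical
  have ht : ∀ q, (tVar q : EdgeCoord k e Γ) ≠ sVar p := fun q h => by cases h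
  have hs : ∀ q, (sVar q : EdgeCoord k e Γ) = sVar p ↔ q = p := fun q =>
    ⟨fun h => Sum.inl_injective h, fun h => h ▸ rfl⟩
  simp only [edgeEquation, map_sub, Derivation.leibniz, MvPolynomial.pderiv_X, smul_eq_mul,
    map_mul, MvPolynomial.eval_X, Pi.single_apply, hs, ht, if_false, mul_zero, zero_add]
  split_ifs <;> simp_all

/-- The Jacobian matrix has independent rows wherever the point is split: a relation between the
rows has coefficients that do not change along the edge and vanish at its ends. -/
lemma IsSplitAt.rank_jacobian [Fintype κ] {z : EdgeCoord k e Γ → ℂ} {j₀ : Fin (k + 1)}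
    (hz : IsSplitAt z j₀) :
    (Matrix.of fun j i => MvPolynomial.eval z
      (MvPolynomial.pderiv i (edgeEquation k e Γ j))).rank = k := by
  classical
  rw [LinearIndependent.rank_matrix, Fintype.card_fin]
  rw [Fintype.linearIndependent_iff]
  intro g hg
  let A : Fin (k + 1) → ℂ := fun p => ∑ j : Fin k, if j.succ = p then g j else 0
  let B : Fin (k + 1) → ℂ := fun p => ∑ j : Fin k, if j.castSucc = p then g j else 0
  have hs : ∀ p, (A p - B p) * z (sVar p) = 0 := fun p => by
    have := congrFun hg (tVar p)
    simp only [Finset.sum_apply, Pi.smul_apply, Matrix.row, Matrix.of_apply, smul_eq_mul,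
      eval_pderiv_tVar, Pi.zero_apply] at this
    rw [← this, ← Finset.sum_sub_distrib, Finset.sum_mul]
    exact Finset.sum_congr rfl fun j _ => by split_ifs <;> ring
  have ht : ∀ p, (A p - B p) * z (tVar p) = 0 := fun p => by
    have := congrFun hg (sVar p)
    simp only [Finset.sum_apply, Pi.smul_apply, Matrix.row, Matrix.of_apply, smul_eq_mul,
      eval_pderiv_sVar, Pi.zero_apply] at this
    rw [← this, ← Finset.sum_sub_distrib, Finset.sum_mul]
    exact Finset.sum_congr rfl fun j _ => by split_ifs <;> ring
  have hsum : ∑ p, (A p - B p) = 0 := by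
    simp only [A, B, Finset.sum_sub_distrib]
    rw [Finset.sum_comm, Finset.sum_comm (s := Finset.univ (α := Fin (k + 1)))]
    simp
  have hne : ∀ p, p ≠ j₀ → A p - B p = 0 := fun p hp => by
    rcases lt_or_gt_of_ne hp with h | h
    · exact (mul_eq_zero.1 (hs p)).resolve_right (hz.1 p h)
    · exact (mul_eq_zero.1 (ht p)).resolve_right (hz.2 p h)
  have hAB : ∀ p, A p = B p := fun p => by
    by_cases hp : p = j₀
    · rw [Finset.sum_eq_single j₀ (fun p _ => hne p) (by simp)] at hsum
      rw [hp]
      exact sub_eq_zero.1 hsum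
    · exact sub_eq_zero.1 (hne p hp)
  have hA : ∀ p, A p = 0 := by
    intro p
    induction p using Fin.induction with
    | zero => simp [A]
    | succ i ih =>
      rw [hAB] at ih
      simpa [A, B] using ih
  intro j
  simpa [A] using hA j.succ

/-- The points of the locus of split points at which the first `n` of the products `s_{p+1} t_p`
with `p ≠ j` agree with the one for `p = j`. -/
def splitLocus (k : ℕ) (e : κ → ι → ℤ) (Γ : Set (ι → ℝ)) (j : Fin (k + 1)) (n : ℕ) :
    Set (EdgeCoord k e Γ → ℂ) :=
  {z | IsSplitAt z j ∧ ∀ i : Fin k, i.val < n →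
    z (sVar (j.succAbove i)) * z (tVar (j.succAbove i)) = z (sVar j) * z (tVar j)}

/-- The product of the coordinates that do not vanish at split points. -/
noncomputable def splitPoly (k : ℕ) (e : κ → ι → ℤ) (Γ : Set (ι → ℝ)) (j : Fin (k + 1)) :
    MvPolynomial (EdgeCoord k e Γ) ℂ :=
  (∏ p ∈ Finset.univ.filter (· < j), MvPolynomial.X (sVar p)) *
    ∏ p ∈ Finset.univ.filter (j < ·), MvPolynomial.X (tVar p)

lemma eval_splitPoly_ne_zero {z : EdgeCoord k e Γ → ℂ} {j : Fin (k + 1)} :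
    MvPolynomial.eval z (splitPoly k e Γ j) ≠ 0 ↔ IsSplitAt z j := by
  simp [splitPoly, IsSplitAt, Finset.prod_eq_zero_iff, map_prod]

lemma splitPoly_ne_zero (j : Fin (k + 1)) : splitPoly k e Γ j ≠ 0 :=
  mul_ne_zero (Finset.prod_ne_zero_iff.2 fun _ _ => MvPolynomial.X_ne_zero _)
    (Finset.prod_ne_zero_iff.2 fun _ _ => MvPolynomial.X_ne_zero _)

/-- On split points, the equation `s_{p+1} t_p = s_{j+1} t_j` expresses one of `s_{p+1}`, `t_p` by
the other coordinates. -/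
lemma isPrime_vanishingIdeal_splitLocus (j : Fin (k + 1)) (n : ℕ) :
    (MvPolynomial.vanishingIdeal ℂ (splitLocus k e Γ j n)).IsPrime := by
  classical
  let S : Fin (k + 1) → Prop := fun p => ∃ i : Fin k, i.val < n ∧ j.succAbove i = p
  have hSj : ¬ S j := fun ⟨i, _, hi⟩ => Fin.succAbove_ne j i hi
  let par : (EdgeCoord k e Γ → ℂ) → EdgeCoord k e Γ → ℂ := fun z c =>
    match c with
    | Sum.inl p => if S p ∧ j < p then z (sVar j) * z (tVar j) / z (tVar p) else z (sVar p)
    | Sum.inr (Sum.inl p) =>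
      if S p ∧ p < j then z (sVar j) * z (tVar j) / z (sVar p) else z (tVar p)
    | Sum.inr (Sum.inr i) => z (yVar i)
  have hps : ∀ z p, par z (sVar p) =
      if S p ∧ j < p then z (sVar j) * z (tVar j) / z (tVar p) else z (sVar p) := fun _ _ => rfl
  have hpt : ∀ z p, par z (tVar p) =
      if S p ∧ p < j then z (sVar j) * z (tVar j) / z (sVar p) else z (tVar p) := fun _ _ => rfl
  refine isPrime_vanishingIdeal_of_parametrization (splitPoly_ne_zero j) (par := par) ?_ ?_ ?_
  · intro z hz
    rw [eval_splitPoly_ne_zero] at hz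
    refine ⟨⟨fun p hp => ?_, fun p hp => ?_⟩, fun i hi => ?_⟩
    · rw [hps, if_neg fun h => lt_asymm h.2 hp]
      exact hz.1 p hp
    · rw [hpt, if_neg fun h => lt_asymm h.2 hp]
      exact hz.2 p hp
    · have hS : S (j.succAbove i) := ⟨i, hi, rfl⟩
      rw [hps z j, hpt z j, if_neg fun h => hSj h.1, if_neg fun h => hSj h.1, hps, hpt]
      rcases lt_or_gt_of_ne (Fin.succAbove_ne j i) with h | h
      · rw [if_neg fun h' => lt_asymm h'.2 h, if_pos ⟨hS, h⟩]
        exact mul_div_cancel₀ _ (hz.1 _ h)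
      · rw [if_pos ⟨hS, h⟩, if_neg fun h' => lt_asymm h'.2 h]
        exact div_mul_cancel₀ _ (hz.2 _ h)
  · rintro w ⟨hw, hwn⟩
    refine ⟨w, eval_splitPoly_ne_zero.2 hw, funext fun c => ?_⟩
    rcases c with p | p | i
    · change par w (sVar p) = w (sVar p)
      rw [hps]
      split_ifs with h
      · obtain ⟨⟨i, hi, rfl⟩, hlt⟩ := h
        rw [← hwn i hi, mul_div_cancel_right₀ _ (hw.2 _ hlt)]
      · rfl
    · change par w (tVar p) = w (tVar p)
      rw [hpt]
      split_ifs with h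
      · obtain ⟨⟨i, hi, rfl⟩, hlt⟩ := h
        rw [← hwn i hi, mul_div_cancel_left₀ _ (hw.1 _ hlt)]
      · rfl
    · rfl
  · have htriv : ∀ c c', (∀ z, par z c = z c') → ∃ q u : MvPolynomial (EdgeCoord k e Γ) ℂ, ∀ z,
        MvPolynomial.eval z (splitPoly k e Γ j) ≠ 0 → MvPolynomial.eval z u ≠ 0 ∧
          MvPolynomial.eval z q = MvPolynomial.eval z u * par z c := fun c c' h =>
      ⟨MvPolynomial.X c', 1, fun z _ => by simp [h]⟩
    rintro (p | p | i)
    · by_cases h : S p ∧ j < p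
      · refine ⟨MvPolynomial.X (sVar j) * MvPolynomial.X (tVar j), MvPolynomial.X (tVar p),
          fun z hz => ?_⟩
        have h0 := (eval_splitPoly_ne_zero.1 hz).2 p h.2
        change _ ∧ _ = _ * par z (sVar p)
        rw [hps, if_pos h]
        simp only [map_mul, MvPolynomial.eval_X]
        exact ⟨h0, (mul_div_cancel₀ _ h0).symm⟩
      · exact htriv (sVar p) (sVar p) fun z => (hps z p).trans (if_neg h)
    · by_cases h : S p ∧ p < j
      · refine ⟨MvPolynomial.X (sVar j) * MvPolynomial.X (tVar j), MvPolynomial.X (sVar p),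
          fun z hz => ?_⟩
        have h0 := (eval_splitPoly_ne_zero.1 hz).1 p h.2
        change _ ∧ _ = _ * par z (tVar p)
        rw [hpt, if_pos h]
        simp only [map_mul, MvPolynomial.eval_X]
        exact ⟨h0, (mul_div_cancel₀ _ h0).symm⟩
      · exact htriv (tVar p) (tVar p) fun z => (hpt z p).trans (if_neg h)
    · exact htriv (yVar i) (yVar i) fun z => rfl

/-- Each further equation shrinks the locus, so that the ideals form a strict chain. -/
lemma vanishingIdeal_splitLocus_lt (j : Fin (k + 1)) {n : ℕ} (hn : n < k) :
    MvPolynomial.vanishingIdeal ℂ (splitLocus k e Γ j n) <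
      MvPolynomial.vanishingIdeal ℂ (splitLocus k e Γ j (n + 1)) := by
  classical
  refine lt_of_le_not_ge (MvPolynomial.vanishingIdeal_anti_mono fun z hz =>
    ⟨hz.1, fun i hi => hz.2 i (Nat.lt_succ_of_lt hi)⟩) fun hle => ?_
  let p := j.succAbove ⟨n, hn⟩
  let F : MvPolynomial (EdgeCoord k e Γ) ℂ :=
    MvPolynomial.X (sVar p) * MvPolynomial.X (tVar p) -
      MvPolynomial.X (sVar j) * MvPolynomial.X (tVar j)
  have hF : F ∈ MvPolynomial.vanishingIdeal ℂ (splitLocus k e Γ j (n + 1)) := fun z hz => by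
    simp only [F, map_sub, map_mul, MvPolynomial.aeval_X]
    exact sub_eq_zero.2 (hz.2 ⟨n, hn⟩ (Nat.lt_succ_self n))
  -- the point with all coordinates `1`, except for one of the two in the new equation
  let z : EdgeCoord k e Γ → ℂ := fun c => if c = sVar p then 2 else 1
  have hzs : ∀ q, q ≠ p → z (sVar q) = 1 := fun q hq =>
    if_neg fun h => hq (Sum.inl_injective h)
  have hzt : ∀ q, z (tVar q) = 1 := fun q => if_neg fun h => by cases h
  have hzp : z (sVar p) = 2 := if_pos rfl
  have hjp : j ≠ p := (Fin.succAbove_ne j _).symm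
  have hz : z ∈ splitLocus k e Γ j n := by
    refine ⟨⟨fun q _ => ?_, fun q _ => by rw [hzt]; exact one_ne_zero⟩, fun i hi => ?_⟩
    · by_cases hq : q = p
      · rw [hq, hzp]
        exact two_ne_zero
      · rw [hzs q hq]
        exact one_ne_zero
    · have hip : j.succAbove i ≠ p := fun h => by
        have := Fin.succAbove_right_injective h
        rw [this] at hi
        exact lt_irrefl _ hi
      rw [hzs _ hip, hzs _ hjp, hzt, hzt]
  have := hle hF z hz
  simp only [F, map_sub, map_mul, MvPolynomial.aeval_X, hzp, hzt, hzs j hjp] at this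
  norm_num at this

/-- The codimension of the components of the complete intersection that contain split points. By
Krull's height theorem it is at most `k`; a chain of primes of length `k` is given by the ideals of
the loci on which only some of the equations hold. -/
lemma IsSplitAt.height_eq [Finite κ] {z : EdgeCoord k e Γ → ℂ} {j : Fin (k + 1)}
    (hz : IsSplitAt z j) {p : Ideal (MvPolynomial (EdgeCoord k e Γ) ℂ)}
    (hp : p ∈ (Ideal.span (Set.range (edgeEquation k e Γ))).minimalPrimes)
    (hzp : z ∈ MvPolynomial.zeroLocus ℂ p) : p.height = k := by
  have := Fintype.ofFinite κ
  have hprime : p.IsPrime := hp.1.1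
  apply le_antisymm (height_le_of_mem_minimalPrimes_span_range _ hp)
  refine (le_height_of_chain (fun n => MvPolynomial.vanishingIdeal ℂ (splitLocus k e Γ j n))
    (fun n _ => isPrime_vanishingIdeal_splitLocus j n)
    (fun n hn => vanishingIdeal_splitLocus_lt j hn)).trans (Ideal.height_mono fun h hh => ?_)
  have hnot : splitPoly k e Γ j ∉ p := fun h0 =>
    eval_splitPoly_ne_zero.2 hz (by simpa [MvPolynomial.aeval_eq_eval] using hzp _ h0)
  -- all equations hold on the split points of the complete intersection
  have hrad : splitPoly k e Γ j * h ∈ (Ideal.span (Set.range (edgeEquation k e Γ))).radical := by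
    rw [← MvPolynomial.vanishingIdeal_zeroLocus_eq_radical (K := ℂ)]
    intro w hw
    have hweq : ∀ i : Fin k, w (sVar i.succ) * w (tVar i.succ) =
        w (sVar i.castSucc) * w (tVar i.castSucc) := fun i => by
      have := hw _ (Ideal.subset_span ⟨i, rfl⟩)
      rw [MvPolynomial.aeval_eq_eval, eval_edgeEquation] at this
      exact sub_eq_zero.1 this
    have hwc : ∀ q : Fin (k + 1), w (sVar q) * w (tVar q) = w (sVar 0) * w (tVar 0) := by
      intro q
      induction q using Fin.induction with
      | zero => rfl
      | succ i ih => rw [hweq, ih]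
    rw [map_mul, mul_eq_zero]
    by_contra! hne
    refine hne.2 (hh w ⟨?_, fun i _ => by rw [hwc, hwc j]⟩)
    rw [← eval_splitPoly_ne_zero]
    simpa [MvPolynomial.aeval_eq_eval] using hne.1
  exact (hprime.mem_or_mem (hprime.radical_le_iff.2 hp.1.2 hrad)).resolve_left hnot

end CompleteIntersection

end ToricEdge

theorem mainTheorem1 {d n k : ℕ}
    (fan : Set (PointedCone ℝ (Fin d → ℝ))) (e : Fin n → Fin d → ℤ)
    (hfan : ToricEdge.IsSimplicialFan fan e)
    (hcomplete : ToricEdge.IsComplete fan)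
    (hsemiample : ToricEdge.IsSemiample fan e (ToricEdge.anticanonicalDegree e))
    (P : Set (Fin d → ℝ)) (hreflexive : ToricEdge.IsReflexive P)
    (hboundary : ∀ i, ToricEdge.latVec (e i) ∈ frontier P)
    (Γ : Set (Fin d → ℝ)) (hedge : ToricEdge.IsEdge Γ P)
    (a : Fin (k + 2) → Fin n) (ha : ToricEdge.IsEdgeEnumeration e Γ a) :
    (∀ c, ((k : ℤ) + 1) * ToricEdge.edgeStep e a c = e (a (Fin.last (k + 1))) c - e (a 0) c) ∧
    ToricEdge.IsSimplicialFan (ToricEdge.edgeFan fan e Γ a) (ToricEdge.edgeGen e Γ a) ∧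
    ∃ φ : ToricEdge.ToricVariety fan e →
        ToricEdge.ToricVariety (ToricEdge.edgeFan fan e Γ a) (ToricEdge.edgeGen e Γ a),
      (∀ x : ToricEdge.CoxSpace fan e,
        ∃ x' : ToricEdge.CoxSpace (ToricEdge.edgeFan fan e Γ a) (ToricEdge.edgeGen e Γ a),
          x'.1 = ToricEdge.edgeMap e Γ a x.1 ∧
            φ (ToricEdge.toricPoint x) = ToricEdge.toricPoint x') ∧
      ToricEdge.IsClosedImmersion φ ∧
      ToricEdge.IsQuasismoothCompleteIntersection (ToricEdge.edgeEquation k e Γ)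
        (Set.range φ) := by
  have hconvP : Convex ℝ P := by
    obtain ⟨s, -, rfl⟩ := hreflexive.lattice
    exact convex_convexHull ℝ _
  have hconv : Convex ℝ Γ := hedge.1.convex hconvP
  have hstep := ha.eq_add_edgeStep hconv hedge.2
  have hstep' := ha.latVec_eq hconv hedge.2
  have hF := ToricEdge.isCoxEmbedding_edgeMap hfan ha hstep hstep'
  have hsplit : ∀ z : ToricEdge.CoxSpace (ToricEdge.edgeFan fan e Γ a) (ToricEdge.edgeGen e Γ a),
      ∃ j, ToricEdge.IsSplitAt z.1 j := fun z => by
    obtain ⟨σ, hσ, h⟩ := (ToricEdge.not_mem_zeroLocus_edgeFan_iff hfan ha hstep').1 z.2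
    exact h.exists_isSplitAt
  refine ⟨fun c => ?_, hfan.edgeFan ha hstep hstep', hF.toricMap,
    fun x => ⟨hF.coxMap x, rfl, rfl⟩, hF.isClosedImmersion_toricMap, ?_, ?_, ?_, ?_⟩
  · have := hstep (Fin.last (k + 1)) c
    rw [Fin.val_last] at this
    push_cast at this
    linarith
  · exact ToricEdge.isWeightedHomogeneous_edgeEquation
  · exact hF.mem_range_toricMap_iff
  · rintro p hp ⟨z, hz⟩
    obtain ⟨j, hj⟩ := hsplit z
    exact hj.height_eq hp hz
  · intro z _
    obtain ⟨j, hj⟩ := hsplit z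
    exact hj.rank_jacobian
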